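/- **Model.** Base stations (BSs) form a homogeneous Poisson point process $\Phi_B\subset\mathbb R^2$ of intensity $\lambda_B>0$; eavesdroppers form an independent homogeneous Poisson process $\Phi_E$ of intensity $\lambda_E>0$; the typical user is at the origin $o$. A link of length $r$ is LOS (type $L$) with probability $C\in[0,1]$ if $r\le D$ and with probability $0$ if $r>D$ ($D>0$); otherwise it is NLOS (type $N$). The path loss of a link $x\to y$ of type $j\in\{L,N\}$ is $L(x,y)=C_j\|x-y\|^{-\alpha_j}$ with $C_j,\alpha_j>0$. Its small-scale fading ($h_{xo}$ to the user, $g_{xz}$ to an eavesdropper $z$) is gamma distributed with shape $N_j\in\{1,2,\dots\}$ and scale $1$. The antenna gain towards an eavesdropper is $G_b(\theta)=M_s>0$ if $|\theta|\le\theta_b$ and $m_s>0$ otherwise, with $\theta$ uniform on $[-180^\circ,180^\circ]$ and $0\le\theta_b\le180^\circ$. The link types, fadings and angles of different links are independent. Assume $\alpha_N>2$ and $C_ND^{-\alpha_N}\le C_LD^{-\alpha_L}$ (the latter holds if $C_L>C_N$, $\alpha_L<\alpha_N$, $D\ge1$). The serving BS is $x^*=\arg\max_{x\in\Phi_B}L(x,o)$,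 and for colluding eavesdroppers $$I_E=\sum_{z\in\Phi_E}G_b(\theta)L(x^*,z)g_{x^*z},\qquad \tau_c=\Pr\Big(\frac{M_sL(x^*,o)h_{x^*o}}{I_E}\ge1\Big).$$ **Notation.** Let $\mu=(C_L/C_N)^{-1/\alpha_N}D^{\alpha_L/\alpha_N}$, $$A_N=\int_0^{\mu}\Big(e^{-\pi C\lambda_B(C_L/C_N)^{2/\alpha_L}x^{2\alpha_N/\alpha_L}}-e^{-\pi C\lambda_BD^2}\Big)2\pi(1-C)\lambda_Bx\,e^{-\pi(1-C)\lambda_Bx^2}dx+e^{-\pi C\lambda_BD^2},\qquad A_L=1-A_N$$ (the probabilities that the serving BS is NLOS, LOS), and let $f_{r_j}$ be the conditional densities of $\|x^*\|$ given the type $j$: $$f_{r_L}(r)=\frac{1}{A_L}e^{-(1-C)\lambda_B\pi(C_N/C_L)^{2/\alpha_N}r^{2\alpha_L/\alpha_N}}\,2\pi C\lambda_Br\,e^{-C\lambda_B\pi r^2}\,\mathbb I(0\le r\le D)$$ (with $f_{r_L}=0$ if $C=0$, when $A_L=0$), $$f_{r_N}(r)=\frac{2\pi\lambda_Bre^{-\pi\lambda_Br^2}}{A_N}\Big((1-C)e^{\pi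 C\lambda_B(r^2-D^2)}\mathbb I(r\le D)+\mathbb I(r\ge D)\Big)+\frac{2\pi(1-C)\lambda_Bre^{-(1-C)\lambda_B\pi r^2}}{A_N}\Big(e^{-C\lambda_B\pi(C_L/C_N)^{2/\alpha_L}r^{2\alpha_N/\alpha_L}}-e^{-C\lambda_B\pi D^2}\Big)\mathbb I(r\le\mu).$$ Let $q_L=C$, $q_N=1-C$, $\Pr(M_s)=\theta_b/180$, $\Pr(m_s)=(180-\theta_b)/180$, $k_{j,V}=D^{\alpha_j}/(VC_j)$, and $\mathcal L_{I_E}(s)=e^{\Xi(s)}$ with $$\Xi(s)=-2\pi\lambda_Es\Big[\sum_{j\in\{L,N\}}q_j\sum_{V\in\{M_s,m_s\}}\Pr(V)\frac{(VC_j)^{2/\alpha_j}}{\alpha_j}\sum_{m=0}^{N_j-1}\frac{k_{j,V}^{m+2/\alpha_j}}{(m+\frac2{\alpha_j})(s+k_{j,V})^{m+1}}\,{}_2F_1\Big(1,m+1;m+\tfrac2{\alpha_j}+1;\tfrac{k_{j,V}}{k_{j,V}+s}\Big)$$ $$+\sum_{V\in\{M_s,m_s\}}\Pr(V)\frac{(VC_N)^{2/\alpha_N}}{\alpha_N}\sum_{m=0}^{N_N-1}\frac{k_{N,V}^{m+2/\alpha_N}}{(1-\frac2{\alpha_N})(s+k_{N,V})^{m+1}}\,{}_2F_1\Big(1,m+1;2-\tfrac2{\alpha_N};\tfrac{s}{s+k_{N,V}}\Big)\Big].$$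 **Theorem.** $I_E<\infty$ almost surely, and $\mathcal L_{I_E}(s)=\mathbb E(e^{-sI_E})$ for all $s>0$. With $a_j=(N_j!)^{-1/N_j}$, all the integrals below converge absolutely, and $$\tau_c\le\sum_{j\in\{L,N\}}A_j\sum_{n=1}^{N_j}\binom{N_j}{n}(-1)^{n+1}\int_0^\infty f_{r_j}(r)\,\mathcal L_{I_E}\Big(\frac{a_jnr^{\alpha_j}}{M_sC_j}\Big)dr .$$ The same upper bound also holds (in a weaker form) with the weights $A_j$ omitted: $$\tau_c\le\sum_{j\in\{L,N\}}\sum_{n=1}^{N_j}\binom{N_j}{n}(-1)^{n+1}\int_0^\infty f_{r_j}(r)\,\mathcal L_{I_E}\Big(\frac{a_jnr^{\alpha_j}}{M_sC_j}\Big)dr .$$ -/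

import Mathlib

open MeasureTheory ProbabilityTheory
open scoped ENNReal NNReal

noncomputable section

namespace MmWave

/-- The Euclidean plane. -/
abbrev Plane : Type := EuclideanSpace ℝ (Fin 2)

/-- Line-of-sight and non-line-of-sight links. -/
inductive LinkType : Type
  | los
  | nlos
  deriving DecidableEq

instance : Fintype LinkType := ⟨{.los, .nlos}, fun x => by cases x <;> simp⟩

/-- The two lobes (main, side) of the sectored antenna pattern. -/
inductive Lobe : Type
  | main
  | side
  deriving DecidableEq

instance : Fintype Lobe := ⟨{.main, .side}, fun x => by cases x <;> simp⟩

open LinkType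

/-- The parameters of the network. -/
structure Params where
  /-- intensity of the base stations -/
  lamB : ℝ
  /-- intensity of the eavesdroppers -/
  lamE : ℝ
  /-- main-lobe gain `M_s` -/
  Ms : ℝ
  /-- side-lobe gain `m_s` -/
  ms : ℝ
  /-- beam width of the main lobe, in degrees -/
  thetaB : ℝ
  /-- probability that a link of length at most `D` is LOS -/
  C : ℝ
  /-- radius of the LOS ball -/
  D : ℝ
  /-- path-loss intercepts `C_L`, `C_N` -/
  K : LinkType → ℝ
  /-- path-loss exponents `α_L`, `α_N` -/
  α : LinkType → ℝ
  /-- Nakagami parameters `N_L`, `N_N` -/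
  N : LinkType → ℕ
  lamB_pos : 0 < lamB
  lamE_pos : 0 < lamE
  Ms_pos : 0 < Ms
  ms_pos : 0 < ms
  thetaB_nonneg : 0 ≤ thetaB
  thetaB_le : thetaB ≤ 180
  C_nonneg : 0 ≤ C
  C_le_one : C ≤ 1
  D_pos : 0 < D
  K_pos : ∀ j, 0 < K j
  α_pos : ∀ j, 0 < α j
  /-- the total power received from the far (NLOS) field is finite -/
  two_lt_α_nlos : 2 < α nlos
  N_pos : ∀ j, 0 < N j
  /-- at the boundary of the LOS ball, an NLOS link is not better than an LOS link; this follows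
  from `C_N < C_L`, `α_L < α_N` and `1 ≤ D` -/
  nlos_le_los : K nlos * D ^ (-α nlos) ≤ K los * D ^ (-α los)

namespace Params

variable (p : Params)

/-- The probability `q_L(r)` that a link of length `r` is LOS. -/
def qLOS (r : ℝ) : ℝ := if r ≤ p.D then p.C else 0

/-- The probability that a link of length at most `D` is of type `j`: `q_L = C`, `q_N = 1 - C`. -/
def q : LinkType → ℝ
  | los => p.C
  | nlos => 1 - p.C

/-- The antenna gain `G_b(θ)`, the angle being in degrees. -/
def gain (θ : ℝ) : ℝ := if |θ| ≤ p.thetaB then p.Ms else p.ms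

/-- The value of the gain in each lobe. -/
def lobeGain : Lobe → ℝ
  | .main => p.Ms
  | .side => p.ms

/-- The probability of each lobe. -/
def lobeProb : Lobe → ℝ
  | .main => p.thetaB / 180
  | .side => (180 - p.thetaB) / 180

/-- Path loss `C_j d^{-α_j}` of a link of type `j` and length `d`. -/
def pathLoss (j : LinkType) (d : ℝ) : ℝ := p.K j * d ^ (-p.α j)

/-- The probability `A_N` of being served by an NLOS base station, in closed form. -/
def assocNLOS : ℝ :=
  (∫ x in (0 : ℝ)..((p.K los / p.K nlos) ^ (-(1 / p.α nlos)) * p.D ^ (p.α los / p.α nlos)),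
    (Real.exp (-(Real.pi * p.C * p.lamB * (p.K los / p.K nlos) ^ (2 / p.α los)
        * x ^ (2 * p.α nlos / p.α los)))
      - Real.exp (-(Real.pi * p.C * p.lamB * p.D ^ 2)))
    * (2 * Real.pi * (1 - p.C) * p.lamB * x)
    * Real.exp (-(Real.pi * (1 - p.C) * p.lamB * x ^ 2)))
  + Real.exp (-(Real.pi * p.C * p.lamB * p.D ^ 2))

/-- The association probabilities `A_L = 1 - A_N` and `A_N`. -/
def assoc : LinkType → ℝ
  | los => 1 - p.assocNLOS
  | nlos => p.assocNLOS

/-- The density `f_{r_j}` of the distance to the serving base station, given that it is of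
type `j`. (For `C = 0`, where `A_L = 0`, the function `f_{r_L}` is `0`.) -/
def distPdf : LinkType → ℝ → ℝ
  | los, r =>
    Set.indicator (Set.Icc 0 p.D) (fun r =>
      Real.exp (-((1 - p.C) * p.lamB * Real.pi * (p.K nlos / p.K los) ^ (2 / p.α nlos)
          * r ^ (2 * p.α los / p.α nlos)))
        * (2 * Real.pi * p.C * p.lamB * r) * Real.exp (-(p.C * p.lamB * Real.pi * r ^ 2))
        / p.assoc los) r
  | nlos, r =>
    2 * Real.pi * p.lamB * r * Real.exp (-(Real.pi * p.lamB * r ^ 2))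
        * ((1 - p.C) * Real.exp (Real.pi * p.C * p.lamB * (r ^ 2 - p.D ^ 2))
            * (if r ≤ p.D then 1 else 0)
          + (if p.D ≤ r then 1 else 0)) / p.assoc nlos
    + 2 * Real.pi * (1 - p.C) * p.lamB * r * Real.exp (-((1 - p.C) * p.lamB * Real.pi * r ^ 2))
        * (Real.exp (-(p.C * p.lamB * Real.pi * (p.K los / p.K nlos) ^ (2 / p.α los)
              * r ^ (2 * p.α nlos / p.α los)))
          - Real.exp (-(p.C * p.lamB * Real.pi * p.D ^ 2))) / p.assoc nlos
        * (if r ≤ (p.K nlos / p.K los) ^ (1 / p.α nlos) * p.D ^ (p.α los / p.α nlos)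
            then 1 else 0)

/-- The number `D^{α_j} / (V C_j)`. -/
def kappa (j : LinkType) (v : Lobe) : ℝ := p.D ^ p.α j / (p.lobeGain v * p.K j)

/-- The exponent `Ξ(s)`. -/
def Xi (s : ℝ) : ℝ :=
  -s * (2 * Real.pi * p.lamE * (∑ j : LinkType, p.q j * ∑ v : Lobe,
        p.lobeProb v * ((p.lobeGain v * p.K j) ^ (2 / p.α j) / p.α j)
          * ∑ m ∈ Finset.range (p.N j),
              p.kappa j v ^ ((m : ℝ) + 2 / p.α j)
                / (((m : ℝ) + 2 / p.α j) * (s + p.kappa j v) ^ (m + 1))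
              * ordinaryHypergeometric (1 : ℝ) ((m : ℝ) + 1) ((m : ℝ) + 2 / p.α j + 1)
                  (p.kappa j v / (p.kappa j v + s)))
    + 2 * Real.pi * p.lamE * ∑ v : Lobe,
        p.lobeProb v * ((p.lobeGain v * p.K nlos) ^ (2 / p.α nlos) / p.α nlos)
          * ∑ m ∈ Finset.range (p.N nlos),
              p.kappa nlos v ^ ((m : ℝ) + 2 / p.α nlos)
                / ((1 - 2 / p.α nlos) * (s + p.kappa nlos v) ^ (m + 1))
              * ordinaryHypergeometric (1 : ℝ) ((m : ℝ) + 1) (2 - 2 / p.α nlos)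
                  (s / (s + p.kappa nlos v)))

/-- The closed form `exp(Ξ(s))` of the Laplace transform of `I_E`. -/
def laplaceIE (s : ℝ) : ℝ := Real.exp (p.Xi s)

/-- The constant `a_j = (N_j !)^{-1/N_j}`. -/
def a (j : LinkType) : ℝ := ((p.N j).factorial : ℝ) ^ (-(1 / (p.N j : ℝ)))

end Params

/-- The points `X 0, X 1, …` form a Poisson point process with intensity measure `Λ`: the number
of points in a measurable set `B` with `Λ B < ∞` is Poisson with mean `Λ B`, and the numbers of
points in pairwise disjoint such sets are independent. -/
structure IsPoissonProcess {Ω E : Type*} [MeasurableSpace Ω] [MeasurableSpace E]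
    (X : ℕ → Ω → E) (Λ : Measure E) (P : Measure Ω) : Prop where
  measurable : ∀ i, Measurable (X i)
  law : ∀ B : Set E, MeasurableSet B → Λ B ≠ ∞ →
    HasLaw (fun ω => {i | X i ω ∈ B}.encard)
      ((poissonMeasure (Λ B).toNNReal).map (fun n : ℕ => (n : ℕ∞))) P
  indep : ∀ (k : ℕ) (B : Fin k → Set E), (∀ l, MeasurableSet (B l)) → (∀ l, Λ (B l) ≠ ∞) →
    Pairwise (Function.onFun Disjoint B) →
    iIndepFun (fun (l : Fin k) (ω : Ω) => {i | X i ω ∈ B l}.encard) P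

/-- Indices of the scalar random marks. In `userBlock i`, `userFade j i` the number `i` is a base
station, and the link is the one to the typical user; in `eveBlock i k`, `eveFade j i k`,
`eveAngle i k` the link is the one from base station `i` to eavesdropper `k`. -/
inductive Mark : Type
  | userBlock (i : ℕ)
  | userFade (j : LinkType) (i : ℕ)
  | eveBlock (i k : ℕ)
  | eveFade (j : LinkType) (i k : ℕ)
  | eveAngle (i k : ℕ)

/-- The law of each mark: blockage marks are uniform on `[0, 1]`, fading marks are gamma with shape
`N_j` and scale `1`, angles are uniform on `[-180, 180]` (degrees). -/
def markLaw (p : Params) : Mark → Measure ℝ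
  | .userBlock _ => cond volume (Set.Icc 0 1)
  | .userFade j _ => gammaMeasure (p.N j) 1
  | .eveBlock _ _ => cond volume (Set.Icc 0 1)
  | .eveFade j _ _ => gammaMeasure (p.N j) 1
  | .eveAngle _ _ => cond volume (Set.Icc (-180) 180)

/-- A realization of the network on a probability space: base stations and eavesdroppers form
independent homogeneous Poisson processes, and the blockage, the fading and the direction of the
links are independent of them and of each other. -/
structure Network (p : Params) {Ω : Type*} [MeasurableSpace Ω] (P : Measure Ω) where
  /-- the positions of the base stations -/
  bs : ℕ → Ω → Plane
  /-- the positions of the eavesdroppers -/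
  eve : ℕ → Ω → Plane
  /-- the scalar marks -/
  mark : Mark → Ω → ℝ
  bs_poisson : IsPoissonProcess bs (ENNReal.ofReal p.lamB • volume) P
  eve_poisson : IsPoissonProcess eve (ENNReal.ofReal p.lamE • volume) P
  mark_measurable : ∀ c, Measurable (mark c)
  mark_law : ∀ c, HasLaw (mark c) (markLaw p c) P
  mark_indep : iIndepFun mark P
  bs_indep_eve : IndepFun (fun ω i => bs i ω) (fun ω k => eve k ω) P
  points_indep_mark :
    IndepFun (fun ω => ((fun i => bs i ω), (fun k => eve k ω))) (fun ω c => mark c ω) P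

namespace Network

variable {p : Params} {Ω : Type*} [MeasurableSpace Ω] {P : Measure Ω} (net : Network p P)

/-- The type of the link from base station `i` to the typical user at the origin. -/
def userLink (i : ℕ) (ω : Ω) : LinkType :=
  if net.mark (.userBlock i) ω < p.qLOS ‖net.bs i ω‖ then los else nlos

/-- The path loss `L(x_i, o)`. -/
def userLoss (i : ℕ) (ω : Ω) : ℝ := p.pathLoss (net.userLink i ω) ‖net.bs i ω‖

/-- The fading `h_{x_i o}`. -/
def userFading (i : ℕ) (ω : Ω) : ℝ := net.mark (.userFade (net.userLink i ω) i) ω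

/-- The type of the link from base station `i` to eavesdropper `k`. -/
def eveLink (i k : ℕ) (ω : Ω) : LinkType :=
  if net.mark (.eveBlock i k) ω < p.qLOS ‖net.bs i ω - net.eve k ω‖ then los else nlos

/-- The path loss `L(x_i, z_k)`. -/
def eveLoss (i k : ℕ) (ω : Ω) : ℝ :=
  p.pathLoss (net.eveLink i k ω) ‖net.bs i ω - net.eve k ω‖

/-- The fading `g_{x_i z_k}`. -/
def eveFading (i k : ℕ) (ω : Ω) : ℝ := net.mark (.eveFade (net.eveLink i k ω) i k) ω

/-- The gain `G_b(θ)` of base station `i` towards eavesdropper `k`. -/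
def eveGain (i k : ℕ) (ω : Ω) : ℝ := p.gain (net.mark (.eveAngle i k) ω)

/-- The index of the serving base station `x* = argmax_x L(x, o)` (almost surely there is exactly
one maximizer). -/
def serving (ω : Ω) : ℕ := sInf {i | ∀ k, net.userLoss k ω ≤ net.userLoss i ω}

/-- The total eavesdropped power `I_E = ∑_z G_b(θ) L(x*, z) g_{x* z}`. -/
def powerE (ω : Ω) : ℝ≥0∞ :=
  ∑' k, ENNReal.ofReal (net.eveGain (net.serving ω) k ω * net.eveLoss (net.serving ω) k ω
    * net.eveFading (net.serving ω) k ω)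

/-- The secure connectivity probability `τ_c = Pr(M_s L(x*, o) h_{x* o} / I_E ≥ 1)` for colluding
eavesdroppers. -/
def tauC : ℝ :=
  P.real {ω | 1 ≤ ENNReal.ofReal (p.Ms * net.userLoss (net.serving ω) ω
    * net.userFading (net.serving ω) ω) / net.powerE ω}

end Network

end MmWave

end

/-!
Given the serving base station, `{M_s L h / I_E ≥ 1}` is a tail event of the gamma variable `h` at
the level `t = I_E r ^ α / (M_s K)`. Alzer's inequality `P (h ≥ t) ≤ 1 - (1 - exp (-a t)) ^ N`,
where `a ^ N * N! = 1`, followed by the binomial expansion turns this tail into a combination of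
the values `E exp (-s I_E)` at `s = a n r ^ α / (M_s K)`. As the power received from a fixed base
station has the same law wherever that station lies, these are values of the Laplace transform of
`I_E`, which the generating functional of the Poisson process expresses as the exponential of a
radial integral; the hypergeometric functions are the incomplete beta integrals that arise there.

The law of the serving distance comes from void probabilities: the nearest LOS and the nearest NLOS
base stations belong to independent thinned processes, and the association rule compares them.
-/

noncomputable section

namespace MmWave

open LinkType

/-! ### Infinite products of factors in `[0, 1]` -/

section InfiniteProducts

lemma antitone_prod_range_of_le_one {u : ℕ → ℝ≥0∞} (hu : ∀ i, u i ≤ 1) :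
    Antitone (fun n => ∏ i ∈ Finset.range n, u i) :=
  (Finset.prod_anti_set_of_le_one' hu).comp_monotone Finset.range_mono

lemma tprod_eq_iInf_prod_range {u : ℕ → ℝ≥0∞} (hu : ∀ i, u i ≤ 1) :
    ∏' i, u i = ⨅ n, ∏ i ∈ Finset.range n, u i :=
  tendsto_nhds_unique (ENNReal.multipliable_of_le_one hu).hasProd.tendsto_prod_nat
    (tendsto_atTop_iInf (antitone_prod_range_of_le_one hu))

lemma prod_iInf_of_antitone {ι : Type*} {u : ℕ → ι → ℝ≥0∞} (hu : Antitone u)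
    (hu1 : ∀ m i, u m i ≤ 1) (s : Finset ι) : ∏ i ∈ s, ⨅ m, u m i = ⨅ m, ∏ i ∈ s, u m i := by
  classical
  have prod_ne_top (s : Finset ι) (m : ℕ) : ∏ i ∈ s, u m i ≠ ∞ :=
    ne_top_of_le_ne_top ENNReal.one_ne_top (Finset.prod_le_one' fun i _ => hu1 m i)
  induction s using Finset.induction_on with
  | empty => simp
  | insert i s hi ih =>
    simp only [Finset.prod_insert hi, ih]
    refine ENNReal.iInf_mul_iInf ⟨0, ne_top_of_le_ne_top ENNReal.one_ne_top (hu1 0 i)⟩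
      ⟨0, prod_ne_top s 0⟩ fun m m' => ⟨max m m', mul_le_mul' (hu (le_max_left m m') i) ?_⟩
    exact Finset.prod_le_prod' fun j _ => hu (le_max_right m m') j

lemma tprod_finsetProd_of_le_one {κ : Type*} {u : κ → ℕ → ℝ≥0∞} (hu : ∀ c i, u c i ≤ 1)
    (T : Finset κ) : ∏' i, ∏ c ∈ T, u c i = ∏ c ∈ T, ∏' i, u c i := by
  rw [tprod_eq_iInf_prod_range fun i => Finset.prod_le_one' fun c _ => hu c i]
  simp_rw [tprod_eq_iInf_prod_range (hu _), Finset.prod_comm (t := T)]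
  exact (prod_iInf_of_antitone
    (fun m n hmn c => antitone_prod_range_of_le_one (hu c) hmn)
    (fun n c => Finset.prod_le_one' fun i _ => hu c i) T).symm

lemma tprod_iInf_of_antitone {ι : Type*} {u : ℕ → ι → ℝ≥0∞} (hu : Antitone u)
    (hu1 : ∀ m i, u m i ≤ 1) : ∏' i, ⨅ m, u m i = ⨅ m, ∏' i, u m i := by
  rw [ENNReal.tprod_eq_iInf_prod fun i => iInf_le_of_le 0 (hu1 0 i)]
  simp_rw [ENNReal.tprod_eq_iInf_prod (hu1 _), prod_iInf_of_antitone hu hu1]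
  exact iInf_comm

open Classical in
lemma tprod_ite_mem_eq_pow_ncard {ι : Type*} {A : Set ι} (hA : A.Finite) (c : ℝ≥0∞) :
    ∏' i, (if i ∈ A then c else 1) = c ^ A.ncard := by
  rw [tprod_eq_prod (s := hA.toFinset) fun i hi => if_neg (by simpa using hi),
    Set.ncard_eq_toFinset_card A hA]
  exact Finset.prod_eq_pow_card fun i hi => if_pos (by simpa using hi)

open Classical in
lemma tprod_indicator_eq_indicator {α ι : Type*} (G : Set α) (x : ι → α) :
    ∏' i, G.indicator (1 : α → ℝ≥0∞) (x i) = {z : ι → α | ∀ i, z i ∈ G}.indicator 1 x := by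
  by_cases hx : ∀ i, x i ∈ G
  · simp [hx]
  · have indicator_le_one (k : ι) : G.indicator (1 : α → ℝ≥0∞) (x k) ≤ 1 :=
      Set.indicator_le_self' (by simp) _
    obtain ⟨i, hi⟩ := not_forall.1 hx
    rw [Set.indicator_of_notMem (show x ∉ {z | ∀ i, z i ∈ G} from hx), ← nonpos_iff_eq_zero,
      ENNReal.tprod_eq_iInf_prod indicator_le_one]
    exact iInf_le_of_le {i} (by simp [hi])

lemma lintegral_tprod_eq_iInf {Ω : Type*} [MeasurableSpace Ω] {P : Measure Ω} [IsFiniteMeasure P]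
    {u : ℕ → Ω → ℝ≥0∞} (hu : ∀ i, Measurable (u i)) (hu1 : ∀ i ω, u i ω ≤ 1) :
    ∫⁻ ω, ∏' i, u i ω ∂P = ⨅ n, ∫⁻ ω, ∏ i ∈ Finset.range n, u i ω ∂P := by
  simp_rw [tprod_eq_iInf_prod_range (hu1 · _)]
  exact lintegral_iInf (fun n => Finset.measurable_prod _ fun i _ => hu i)
    (fun m n hmn ω => antitone_prod_range_of_le_one (hu1 · ω) hmn) (by simp)

end InfiniteProducts

section ExpNeg

/-- The exponential `e^{-x}` for `x ∈ [0, ∞]`, with `e^{-∞} = 0`: the form in which Laplace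
transforms and generating functionals of possibly infinite sums are computed. -/
def expNeg (x : ℝ≥0∞) : ℝ≥0∞ := EReal.exp (-(x : EReal))

@[simp]
lemma expNeg_zero : expNeg 0 = 1 := by simp [expNeg]

@[simp]
lemma expNeg_top : expNeg ∞ = 0 := by simp [expNeg]

lemma expNeg_ofReal {x : ℝ} (hx : 0 ≤ x) :
    expNeg (ENNReal.ofReal x) = ENNReal.ofReal (Real.exp (-x)) := by
  rw [expNeg, EReal.coe_ennreal_ofReal, max_eq_left hx, ← EReal.coe_neg, EReal.exp_coe]

lemma expNeg_of_ne_top {x : ℝ≥0∞} (hx : x ≠ ∞) :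
    expNeg x = ENNReal.ofReal (Real.exp (-x.toReal)) := by
  rw [← expNeg_ofReal ENNReal.toReal_nonneg, ENNReal.ofReal_toReal hx]

lemma expNeg_add (x y : ℝ≥0∞) : expNeg (x + y) = expNeg x * expNeg y := by
  rw [expNeg, EReal.coe_ennreal_add, EReal.neg_add (by simp) (by simp), sub_eq_add_neg,
    EReal.exp_add, expNeg, expNeg]

lemma antitone_expNeg : Antitone expNeg := fun _ _ hxy =>
  EReal.exp_monotone (EReal.neg_le_neg_iff.2 (EReal.coe_ennreal_le_coe_ennreal_iff.2 hxy))

lemma continuous_expNeg : Continuous expNeg :=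
  ENNReal.continuous_exp.comp (continuous_neg.comp continuous_coe_ennreal_ereal)

@[fun_prop]
lemma measurable_expNeg : Measurable expNeg := continuous_expNeg.measurable

lemma expNeg_le_one (x : ℝ≥0∞) : expNeg x ≤ 1 :=
  expNeg_zero ▸ antitone_expNeg zero_le

lemma toReal_expNeg_mem_Icc (t : ℝ≥0∞) : (expNeg t).toReal ∈ Set.Icc (0 : ℝ) 1 :=
  ⟨ENNReal.toReal_nonneg, ENNReal.toReal_le_of_le_ofReal zero_le_one (by
    simpa using expNeg_le_one t)⟩

lemma expNeg_sum {ι : Type*} (s : Finset ι) (x : ι → ℝ≥0∞) :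
    expNeg (∑ i ∈ s, x i) = ∏ i ∈ s, expNeg (x i) := by
  classical
  induction s using Finset.induction_on with
  | empty => simp
  | insert i s hi ih => rw [Finset.sum_insert hi, Finset.prod_insert hi, expNeg_add, ih]

lemma expNeg_natCast_mul (n : ℕ) (x : ℝ≥0∞) : expNeg (n * x) = expNeg x ^ n := by
  simpa using expNeg_sum (Finset.range n) fun _ => x

lemma expNeg_iSup {ι : Type*} [Nonempty ι] (x : ι → ℝ≥0∞) :
    expNeg (⨆ i, x i) = ⨅ i, expNeg (x i) :=
  antitone_expNeg.map_ciSup_of_continuousAt continuous_expNeg.continuousAt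

lemma tprod_expNeg {ι : Type*} (x : ι → ℝ≥0∞) : ∏' i, expNeg (x i) = expNeg (∑' i, x i) := by
  rw [ENNReal.tprod_eq_iInf_prod fun i => expNeg_le_one (x i), ENNReal.tsum_eq_iSup_sum,
    expNeg_iSup]
  simp_rw [expNeg_sum]

lemma ae_ne_top_of_tendsto_lintegral_expNeg {Ω : Type*} [MeasurableSpace Ω] {P : Measure Ω}
    [IsProbabilityMeasure P] {f : Ω → ℝ≥0∞} (hf : Measurable f)
    (hlim : Filter.Tendsto (fun s : ℝ => ∫⁻ ω, expNeg (ENNReal.ofReal s * f ω) ∂P)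
      (nhdsWithin 0 (Set.Ioi 0)) (nhds 1)) : ∀ᵐ ω ∂P, f ω ≠ ∞ := by
  have hfin : MeasurableSet {ω | f ω ≠ ∞} := hf (measurableSet_singleton ∞).compl
  refine (mem_ae_iff_prob_eq_one hfin).2 (le_antisymm prob_le_one (le_of_tendsto hlim ?_))
  filter_upwards [self_mem_nhdsWithin] with s hs
  rw [← lintegral_indicator_one hfin]
  refine lintegral_mono fun ω => ?_
  by_cases hω : f ω = ∞
  · simp [hω, ENNReal.mul_top (ENNReal.ofReal_pos.2 hs).ne']
  · rw [Set.indicator_of_mem (show ω ∈ {ω | f ω ≠ ∞} from hω)]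
    exact expNeg_le_one _

end ExpNeg

/-! ### Poisson processes and their generating functionals -/

lemma lintegral_pow_poissonMeasure (r c : ℝ≥0) :
    ∫⁻ n, (c : ℝ≥0∞) ^ n ∂(poissonMeasure r) = ENNReal.ofReal (Real.exp (r * (c - 1))) := by
  have weight_mul_pow (n : ℕ) :
      ENNReal.ofReal (Real.exp (-r) * r ^ n / n.factorial) * (c : ℝ≥0∞) ^ n
        = ENNReal.ofReal (Real.exp (-r) * ((r * c : ℝ) ^ n / n.factorial)) := by
    rw [← ENNReal.coe_pow, ← ENNReal.ofReal_coe_nnreal, ← ENNReal.ofReal_mul (by positivity)]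
    congr 1
    push_cast
    ring
  have exp_series : HasSum (fun n : ℕ => Real.exp (-r) * ((r * c : ℝ) ^ n / n.factorial))
      (Real.exp (-r) * Real.exp (r * c)) := by
    rw [Real.exp_eq_exp_ℝ]
    exact (NormedSpace.expSeries_div_hasSum_exp (r * c : ℝ)).mul_left _
  rw [poissonMeasure, lintegral_sum_measure]
  simp_rw [lintegral_smul_measure, lintegral_dirac, smul_eq_mul, weight_mul_pow]
  rw [← ENNReal.ofReal_tsum_of_nonneg (fun n => by positivity) exp_series.summable,
    exp_series.tsum_eq, ← Real.exp_add]
  congr 2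
  ring

lemma lintegral_one_sub_pow_poissonMeasure (r : ℝ≥0) {c : ℝ≥0∞} (hc : c ≤ 1) :
    ∫⁻ n, (1 - c) ^ n ∂(poissonMeasure r) = expNeg (c * r) := by
  lift c to ℝ≥0 using ne_top_of_le_ne_top ENNReal.one_ne_top hc
  rw [← ENNReal.coe_one, ← ENNReal.coe_sub, lintegral_pow_poissonMeasure, ← ENNReal.coe_mul,
    expNeg_of_ne_top ENNReal.coe_ne_top, NNReal.coe_sub (by exact_mod_cast hc), ENNReal.coe_toReal]
  congr 2
  push_cast
  ring

section Poisson

variable {Ω E : Type*} [MeasurableSpace Ω] [MeasurableSpace E] {X : ℕ → Ω → E} {Λ : Measure E}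
  {P : Measure Ω}

lemma measurable_encard_setOf_mem (hX : ∀ i, Measurable (X i)) {B : Set E}
    (hB : MeasurableSet B) : Measurable (fun ω => {i | X i ω ∈ B}.encard) :=
  measurable_encard.comp (measurable_set_iff.2 fun i => measurableSet_setOfPred.1 (hX i hB))

namespace IsPoissonProcess

lemma lintegral_one_sub_pow_ncard (h : IsPoissonProcess X Λ P) {B : Set E} (hB : MeasurableSet B)
    (hΛ : Λ B ≠ ∞) {c : ℝ≥0∞} (hc : c ≤ 1) :
    ∫⁻ ω, (1 - c) ^ {i | X i ω ∈ B}.ncard ∂P = expNeg (c * Λ B) := by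
  have pow_toNat_comp := (h.law B hB hΛ).lintegral_comp (f := fun n : ℕ∞ => (1 - c) ^ n.toNat)
    (Measurable.of_discrete.aemeasurable)
  rw [lintegral_map .of_discrete .of_discrete] at pow_toNat_comp
  refine pow_toNat_comp.trans ?_
  simp_rw [ENat.toNat_natCast]
  rw [lintegral_one_sub_pow_poissonMeasure _ hc, ENNReal.coe_toNNReal hΛ]

lemma ae_finite_setOf_mem (h : IsPoissonProcess X Λ P) {B : Set E} (hB : MeasurableSet B)
    (hΛ : Λ B ≠ ∞) : ∀ᵐ ω ∂P, {i | X i ω ∈ B}.Finite := by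
  have law := h.law B hB hΛ
  have ae_ne_top : ∀ᵐ n : ℕ∞ ∂(P.map (fun ω => {i | X i ω ∈ B}.encard)), n ≠ ⊤ := by
    rw [law.map_eq, ae_map_iff .of_discrete .of_discrete]
    exact ae_of_all _ fun n => ENat.natCast_ne_top n
  filter_upwards [ae_of_ae_map law.aemeasurable ae_ne_top] with ω hω
  exact Set.encard_ne_top_iff.1 hω

variable {ι : Type*} {B : ι → Set E}

lemma iIndepFun_encard [Finite ι] (h : IsPoissonProcess X Λ P) (hB : ∀ l, MeasurableSet (B l))
    (hΛ : ∀ l, Λ (B l) ≠ ∞) (hd : Pairwise (Function.onFun Disjoint B)) :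
    iIndepFun (fun l ω => {i | X i ω ∈ B l}.encard) P := by
  let e := Finite.equivFin ι
  have indep_fin := h.indep (Nat.card ι) (B ∘ e.symm) (fun l => hB _) (fun l => hΛ _)
    (hd.comp_of_injective e.symm.injective)
  simpa [Function.comp_def] using indep_fin.precomp e.injective

lemma lintegral_prod_one_sub_pow_ncard [Fintype ι] (h : IsPoissonProcess X Λ P)
    (hB : ∀ l, MeasurableSet (B l)) (hΛ : ∀ l, Λ (B l) ≠ ∞)
    (hd : Pairwise (Function.onFun Disjoint B)) {c : ι → ℝ≥0∞} (hc : ∀ l, c l ≤ 1) :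
    ∫⁻ ω, ∏ l, (1 - c l) ^ {i | X i ω ∈ B l}.ncard ∂P = expNeg (∑ l, c l * Λ (B l)) := by
  have indep := (h.iIndepFun_encard hB hΛ hd).comp (fun l (n : ℕ∞) => (1 - c l) ^ n.toNat)
    fun l => .of_discrete
  refine (lintegral_prod_eq_prod_lintegral_of_indepFun Finset.univ _ indep fun l =>
    Measurable.of_discrete.comp (measurable_encard_setOf_mem h.measurable (hB l))).trans ?_
  rw [expNeg_sum]
  exact Finset.prod_congr rfl fun l _ => h.lintegral_one_sub_pow_ncard (hB l) (hΛ l) (hc l)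

end IsPoissonProcess

open Classical in
lemma one_sub_eq_prod_ite_mem_preimage (u : SimpleFunc E ℝ≥0∞) (x : E) :
    1 - u x = ∏ c ∈ u.range with c ≠ 0, if x ∈ u ⁻¹' {c} then 1 - c else 1 := by
  simp only [Set.mem_preimage, Set.mem_singleton_iff, Finset.prod_ite_eq, Finset.mem_filter,
    SimpleFunc.mem_range_self, true_and]
  split_ifs with hx
  · rfl
  · simp [not_not.1 hx]

namespace IsPoissonProcess

lemma ae_tprod_one_sub_simpleFunc (h : IsPoissonProcess X Λ P) (u : SimpleFunc E ℝ≥0∞)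
    (hΛ : ∀ c, c ≠ 0 → Λ (u ⁻¹' {c}) ≠ ∞) :
    ∀ᵐ ω ∂P, ∏' i, (1 - u (X i ω))
      = ∏ c ∈ u.range with c ≠ 0, (1 - c) ^ {i | X i ω ∈ u ⁻¹' {c}}.ncard := by
  classical
  have ae_finite : ∀ᵐ ω ∂P, ∀ c ∈ u.range.filter (· ≠ 0), {i | X i ω ∈ u ⁻¹' {c}}.Finite :=
    (Finset.eventually_all _).2 fun c hc =>
      h.ae_finite_setOf_mem (u.measurableSet_preimage _) (hΛ c (Finset.mem_filter.1 hc).2)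
  filter_upwards [ae_finite] with ω hω
  simp_rw [one_sub_eq_prod_ite_mem_preimage]
  rw [tprod_finsetProd_of_le_one fun c i => by split_ifs <;> simp]
  exact Finset.prod_congr rfl fun c hc => tprod_ite_mem_eq_pow_ncard (hω c hc) (1 - c)

lemma lintegral_pgf_simpleFunc (h : IsPoissonProcess X Λ P) (u : SimpleFunc E ℝ≥0∞)
    (hu : ∀ x, u x ≤ 1) (hΛ : ∀ c, c ≠ 0 → Λ (u ⁻¹' {c}) ≠ ∞) :
    ∫⁻ ω, ∏' i, (1 - u (X i ω)) ∂P = expNeg (∫⁻ x, u x ∂Λ) := by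
  classical
  let T := u.range.filter (· ≠ 0)
  have value_le_one (c : T) : (c : ℝ≥0∞) ≤ 1 := by
    obtain ⟨x, hx⟩ := SimpleFunc.mem_range.1 (Finset.mem_filter.1 c.2).1
    exact hx ▸ hu x
  have level_disjoint : Pairwise (Function.onFun Disjoint fun c : T => u ⁻¹' {(c : ℝ≥0∞)}) :=
    fun c c' hcc' => Disjoint.preimage _
      (Set.disjoint_singleton.2 fun heq => hcc' (Subtype.ext heq))
  have integral_eq_sum : ∫⁻ x, u x ∂Λ = ∑ c : T, (c : ℝ≥0∞) * Λ (u ⁻¹' {(c : ℝ≥0∞)}) := by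
    rw [Finset.sum_coe_sort T fun c => c * Λ (u ⁻¹' {c}), SimpleFunc.lintegral_eq_lintegral,
      SimpleFunc.lintegral]
    exact (Finset.sum_filter_of_ne fun c _ hc => left_ne_zero_of_mul hc).symm
  rw [lintegral_congr_ae (h.ae_tprod_one_sub_simpleFunc u hΛ), integral_eq_sum,
    ← h.lintegral_prod_one_sub_pow_ncard (fun c : T => u.measurableSet_preimage _)
      (fun c => hΛ c (Finset.mem_filter.1 c.2).2) level_disjoint value_le_one]
  exact lintegral_congr fun ω =>
    (Finset.prod_coe_sort T fun c => (1 - c) ^ {i | X i ω ∈ u ⁻¹' {c}}.ncard).symm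

theorem lintegral_pgf (h : IsPoissonProcess X Λ P) {ψ : E → ℝ≥0∞}
    (hψ : Measurable ψ) (hψ1 : ∀ x, ψ x ≤ 1) (hΛ : ∫⁻ x, (1 - ψ x) ∂Λ ≠ ∞) :
    ∫⁻ ω, ∏' i, ψ (X i ω) ∂P = expNeg (∫⁻ x, (1 - ψ x) ∂Λ) := by
  have hm : Measurable fun x => 1 - ψ x := measurable_const.sub hψ
  let u := SimpleFunc.eapprox fun x => 1 - ψ x
  have u_le (m : ℕ) (x : E) : u m x ≤ 1 - ψ x :=
    (le_iSup (fun m => u m x) m).trans_eq (SimpleFunc.iSup_eapprox_apply hm x)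
  have antitone_one_sub : Antitone fun m x => 1 - u m x := fun m m' hmm' x =>
    tsub_le_tsub_left (SimpleFunc.monotone_eapprox _ hmm' x) 1
  have iInf_one_sub (x : E) : ⨅ m, (1 - u m x) = ψ x := by
    rw [← ENNReal.sub_iSup ENNReal.one_ne_top, SimpleFunc.iSup_eapprox_apply hm x,
      ENNReal.sub_sub_cancel ENNReal.one_ne_top (hψ1 x)]
  have level_finite (m : ℕ) (c : ℝ≥0∞) (hc : c ≠ 0) : Λ (u m ⁻¹' {c}) ≠ ∞ := by
    have markov := mul_meas_ge_le_lintegral (μ := Λ) hm c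
    refine ne_top_of_le_ne_top
      (ENNReal.lt_top_of_mul_ne_top_right (ne_top_of_le_ne_top hΛ markov) hc).ne (measure_mono ?_)
    rintro x rfl
    exact u_le m x
  have pgf_approx (m : ℕ) : ∫⁻ ω, ∏' i, (1 - u m (X i ω)) ∂P = expNeg (∫⁻ x, u m x ∂Λ) :=
    h.lintegral_pgf_simpleFunc (u m) (fun x => (u_le m x).trans tsub_le_self) (level_finite m)
  have hX := h.measurable
  calc ∫⁻ ω, ∏' i, ψ (X i ω) ∂P
      = ∫⁻ ω, ⨅ m, ∏' i, (1 - u m (X i ω)) ∂P := by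
        simp_rw [← iInf_one_sub]
        exact lintegral_congr fun ω => tprod_iInf_of_antitone
          (fun m m' hmm' i => antitone_one_sub hmm' (X i ω)) fun m i => tsub_le_self
    _ = ⨅ m, ∫⁻ ω, ∏' i, (1 - u m (X i ω)) ∂P := by
        refine lintegral_iInf (fun m => by fun_prop) (fun m m' hmm' ω => ?_) ?_
        · exact Multipliable.tprod_le_tprod (fun i => antitone_one_sub hmm' (X i ω))
            (ENNReal.multipliable_of_le_one fun i => tsub_le_self)
            (ENNReal.multipliable_of_le_one fun i => tsub_le_self)
        · rw [pgf_approx]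
          exact ne_top_of_le_ne_top ENNReal.one_ne_top (expNeg_le_one _)
    _ = expNeg (⨆ m, ∫⁻ x, u m x ∂Λ) := by simp_rw [pgf_approx, expNeg_iSup]
    _ = expNeg (∫⁻ x, (1 - ψ x) ∂Λ) := by
        simp_rw [lintegral_eq_iSup_eapprox_lintegral hm, SimpleFunc.lintegral_eq_lintegral, u]

end IsPoissonProcess

lemma lintegral_comp_of_indepFun {F : Type*} [MeasurableSpace F] {U : Ω → E} {V : Ω → F}
    [IsFiniteMeasure P] (hUV : IndepFun U V P) (hU : Measurable U) (hV : Measurable V)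
    {f : E × F → ℝ≥0∞} (hf : Measurable f) :
    ∫⁻ ω, f (U ω, V ω) ∂P = ∫⁻ ω, ∫⁻ ω', f (U ω, V ω') ∂P ∂P := by
  rw [← lintegral_map hf (hU.prodMk hV),
    (indepFun_iff_map_prod_eq_prod_map_map hU.aemeasurable hV.aemeasurable).1 hUV,
    lintegral_prod _ hf.aemeasurable, lintegral_map hf.lintegral_prod_right' hU]
  exact lintegral_congr fun ω => lintegral_map (hf.comp measurable_prodMk_left) hV

lemma measure_prodMk_mem_of_indepFun {F : Type*} [MeasurableSpace F] {U : Ω → E} {V : Ω → F}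
    [IsFiniteMeasure P] (hUV : IndepFun U V P) (hU : Measurable U) (hV : Measurable V)
    {S : Set (E × F)} (hS : MeasurableSet S) :
    P {ω | (U ω, V ω) ∈ S} = ∫⁻ ω, P {ω' | (U ω, V ω') ∈ S} ∂P := by
  rw [← lintegral_indicator_one (s := {ω | (U ω, V ω) ∈ S}) ((hU.prodMk hV) hS)]
  refine (lintegral_comp_of_indepFun hUV hU hV (measurable_one.indicator hS)).trans
    (lintegral_congr fun ω => ?_)
  exact lintegral_indicator_one ((measurable_const.prodMk hV) hS)

lemma lintegral_comp_select_of_indepFun {F : Type*} [MeasurableSpace F] {U : Ω → E}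
    {V : ℕ → Ω → F} {σ : E → ℕ} [IsFiniteMeasure P] (hUV : ∀ i, IndepFun U (V i) P)
    (hU : Measurable U) (hV : ∀ i, Measurable (V i)) (hσ : Measurable σ) {f : E × F → ℝ≥0∞}
    (hf : Measurable f) :
    ∫⁻ ω, f (U ω, V (σ (U ω)) ω) ∂P = ∫⁻ ω, ∫⁻ ω', f (U ω, V (σ (U ω)) ω') ∂P ∂P := by
  set g : ℕ → E × F → ℝ≥0∞ := fun i => {q | σ q.1 = i}.indicator f
  have hg (i : ℕ) : Measurable (g i) :=
    hf.indicator ((hσ.comp measurable_fst) (measurableSet_singleton i))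
  have hsum (u : E) (v : ℕ → F) : f (u, v (σ u)) = ∑' i, g i (u, v i) := by
    have hne (i : ℕ) (hi : i ≠ σ u) : g i (u, v i) = 0 :=
      Set.indicator_of_notMem (s := {q | σ q.1 = i}) hi.symm f
    have hself : g (σ u) (u, v (σ u)) = f (u, v (σ u)) :=
      Set.indicator_of_mem (s := {q | σ q.1 = σ u}) rfl f
    rw [tsum_eq_single (σ u) hne, hself]
  calc ∫⁻ ω, f (U ω, V (σ (U ω)) ω) ∂P
      = ∑' i, ∫⁻ ω, g i (U ω, V i ω) ∂P := by
        simp_rw [fun ω => hsum (U ω) fun i => V i ω]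
        exact lintegral_tsum fun i => ((hg i).comp (hU.prodMk (hV i))).aemeasurable
    _ = ∑' i, ∫⁻ ω, ∫⁻ ω', g i (U ω, V i ω') ∂P ∂P :=
        tsum_congr fun i => lintegral_comp_of_indepFun (hUV i) hU (hV i) (hg i)
    _ = ∫⁻ ω, ∫⁻ ω', ∑' i, g i (U ω, V i ω') ∂P ∂P := by
        have hinner (i : ℕ) : Measurable fun ω => ∫⁻ ω', g i (U ω, V i ω') ∂P :=
          ((hg i).comp ((hU.comp measurable_fst).prodMk
            ((hV i).comp measurable_snd))).lintegral_prod_right'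
        rw [← lintegral_tsum fun i => (hinner i).aemeasurable]
        exact lintegral_congr fun ω => (lintegral_tsum fun i =>
          ((hg i).comp (measurable_const.prodMk (hV i))).aemeasurable).symm
    _ = ∫⁻ ω, ∫⁻ ω', f (U ω, V (σ (U ω)) ω') ∂P ∂P := by
        simp_rw [fun ω ω' => hsum (U ω) fun i => V i ω']

section Marks

variable {F : Type*} [MeasurableSpace F] {Y : ℕ → Ω → F} {ν : Measure F}
  [IsProbabilityMeasure P] {φ : E → F → ℝ≥0∞}

lemma lintegral_prod_of_iIndepFun_marks (hX : ∀ i, Measurable (X i))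
    (hY : ∀ i, Measurable (Y i)) (hXY : IndepFun (fun ω i => X i ω) (fun ω i => Y i ω) P)
    (hYi : iIndepFun Y P) (hν : ∀ i, HasLaw (Y i) ν P) (hφ : Measurable (Function.uncurry φ))
    (s : Finset ℕ) :
    ∫⁻ ω, ∏ i ∈ s, φ (X i ω) (Y i ω) ∂P = ∫⁻ ω, ∏ i ∈ s, ∫⁻ y, φ (X i ω) y ∂ν ∂P := by
  have hφx (x : E) : Measurable (φ x) := hφ.comp measurable_prodMk_left
  have hprod : Measurable fun q : (ℕ → E) × (ℕ → F) => ∏ i ∈ s, φ (q.1 i) (q.2 i) :=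
    Finset.measurable_prod _ fun i _ =>
      hφ.comp (f := fun q : (ℕ → E) × (ℕ → F) => (q.1 i, q.2 i)) (by fun_prop)
  refine (lintegral_comp_of_indepFun hXY (measurable_pi_lambda _ hX) (measurable_pi_lambda _ hY)
    hprod).trans (lintegral_congr fun ω => ?_)
  refine (lintegral_prod_eq_prod_lintegral_of_indepFun s (fun i ω' => φ (X i ω) (Y i ω'))
    (hYi.comp (fun i => φ (X i ω)) fun i => hφx _) fun i => (hφx _).comp (hY i)).trans ?_
  exact Finset.prod_congr rfl fun i _ => (hν i).lintegral_comp (hφx _).aemeasurable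

theorem IsPoissonProcess.lintegral_pgf_marked (h : IsPoissonProcess X Λ P)
    (hY : ∀ i, Measurable (Y i)) (hXY : IndepFun (fun ω i => X i ω) (fun ω i => Y i ω) P)
    (hYi : iIndepFun Y P) (hν : ∀ i, HasLaw (Y i) ν P) (hφ : Measurable (Function.uncurry φ))
    (hφ1 : ∀ x y, φ x y ≤ 1) (hΛ : ∫⁻ x, (1 - ∫⁻ y, φ x y ∂ν) ∂Λ ≠ ∞) :
    ∫⁻ ω, ∏' i, φ (X i ω) (Y i ω) ∂P = expNeg (∫⁻ x, (1 - ∫⁻ y, φ x y ∂ν) ∂Λ) := by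
  have : IsProbabilityMeasure ν := (hν 0).isProbabilityMeasure_iff.1 inferInstance
  have hψ : Measurable fun x => ∫⁻ y, φ x y ∂ν := hφ.lintegral_prod_right'
  have hψ1 (x : E) : ∫⁻ y, φ x y ∂ν ≤ 1 := (lintegral_mono (hφ1 x)).trans (by simp)
  rw [← h.lintegral_pgf hψ hψ1 hΛ,
    lintegral_tprod_eq_iInf (u := fun i ω => φ (X i ω) (Y i ω))
      (fun i => hφ.comp ((h.measurable i).prodMk (hY i))) (fun i ω => hφ1 _ _),
    lintegral_tprod_eq_iInf (u := fun i ω => ∫⁻ y, φ (X i ω) y ∂ν)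
      (fun i => hψ.comp (h.measurable i)) (fun i ω => hψ1 _)]
  simp_rw [lintegral_prod_of_iIndepFun_marks h.measurable hY hXY hYi hν hφ]

end Marks

end Poisson

/-! ### Gamma distributions and Alzer's inequality -/

section Gamma

lemma integrable_gammaPDFReal {a r : ℝ} (ha : 0 < a) (hr : 0 < r) :
    Integrable (gammaPDFReal a r) := by
  refine ⟨(stronglyMeasurable_gammaPDFReal a r).aestronglyMeasurable, ?_⟩
  rw [hasFiniteIntegral_iff_ofReal (ae_of_all _ fun x => gammaPDFReal_nonneg ha hr x)]
  exact (lintegral_gammaPDF_eq_one ha hr).trans_lt ENNReal.one_lt_top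

lemma cdf_gammaMeasure_succ_one (M : ℕ) {x : ℝ} (hx : 0 ≤ x) :
    cdf (gammaMeasure ((M + 1 : ℕ) : ℝ) 1) x
      = ∫ t in (0 : ℝ)..x, t ^ M * Real.exp (-t) / M.factorial := by
  have shape_pos : (0 : ℝ) < ((M + 1 : ℕ) : ℝ) := by positivity
  have hint := integrable_gammaPDFReal shape_pos one_pos
  have integral_Iic_zero : ∫ t in Set.Iic (0 : ℝ), gammaPDFReal ((M + 1 : ℕ) : ℝ) 1 t = 0 := by
    rw [integral_Iic_eq_integral_Iio]
    exact setIntegral_eq_zero_of_forall_eq_zero fun t (ht : t < 0) => if_neg (not_le.2 ht)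
  have integral_Iic_eq := intervalIntegral.integral_Iic_sub_Iic (a := 0) (b := x)
    hint.integrableOn hint.integrableOn
  rw [integral_Iic_zero, sub_zero] at integral_Iic_eq
  rw [cdf_gammaMeasure_eq_integral shape_pos one_pos, integral_Iic_eq]
  refine intervalIntegral.integral_congr fun t ht => ?_
  rw [Set.uIcc_of_le hx] at ht
  simp only [gammaPDFReal]
  rw [if_pos ht.1]
  push_cast
  rw [Real.Gamma_nat_eq_factorial, Real.one_rpow, add_sub_cancel_right, Real.rpow_natCast, one_mul]
  ring

lemma expNeg_mul_gammaPDF {a r t : ℝ} (ha : 0 < a) (hr : 0 < r) (ht : 0 ≤ t) (g : ℝ) :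
    gammaPDF a r g * expNeg (ENNReal.ofReal (t * g))
      = ENNReal.ofReal ((r / (r + t)) ^ a) * gammaPDF a (r + t) g := by
  rcases lt_or_ge g 0 with hg | hg
  · simp [gammaPDF_of_neg hg]
  · rw [expNeg_ofReal (by positivity), gammaPDF_of_nonneg hg, gammaPDF_of_nonneg hg,
      ← ENNReal.ofReal_mul (by positivity), ← ENNReal.ofReal_mul (by positivity),
      Real.div_rpow hr.le (by positivity), neg_eq_neg_one_mul ((r + t) * g), add_mul, mul_add,
      Real.exp_add, neg_one_mul, neg_one_mul]
    congr 1
    field_simp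

lemma lintegral_expNeg_mul_gammaMeasure {a r t : ℝ} (ha : 0 < a) (hr : 0 < r) (ht : 0 ≤ t) :
    ∫⁻ g, expNeg (ENNReal.ofReal (t * g)) ∂(gammaMeasure a r)
      = ENNReal.ofReal ((r / (r + t)) ^ a) := by
  have hpdf (r : ℝ) : Measurable (gammaPDF a r) := (measurable_gammaPDFReal _ _).ennreal_ofReal
  rw [gammaMeasure, lintegral_withDensity_eq_lintegral_mul₀ (hpdf r).aemeasurable (by fun_prop)]
  simp_rw [Pi.mul_apply, expNeg_mul_gammaPDF ha hr ht]
  rw [lintegral_const_mul _ (hpdf _), lintegral_gammaPDF_eq_one ha (by positivity), mul_one]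

end Gamma

section Alzer

lemma integral_exp_neg_mul {y : ℝ} (hy : y ≠ 0) :
    ∫ t in Set.Ioc (0 : ℝ) 1, Real.exp (-(y * t)) = (1 - Real.exp (-y)) / y := by
  have hderiv (t : ℝ) :
      HasDerivAt (fun t => -Real.exp (-(y * t)) / y) (Real.exp (-(y * t))) t := by
    convert! ((((hasDerivAt_id t).const_mul y).neg).exp.neg).div_const y using 1
    simp
    field_simp
  rw [← intervalIntegral.integral_of_le zero_le_one,
    intervalIntegral.integral_eq_sub_of_hasDerivAt (fun t _ => hderiv t)
      (Continuous.intervalIntegrable (by fun_prop) _ _)]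
  simp only [mul_one, mul_zero, neg_zero, Real.exp_zero]
  ring

-- Both sides are moments of the uniform law on `[0, 1]`: this is Jensen's inequality.
lemma one_sub_exp_neg_div_le_rpow {y l : ℝ} (hy : 0 < y) (hl0 : 0 < l) (hl1 : l ≤ 1) :
    (1 - Real.exp (-(l * y))) / (l * y) ≤ ((1 - Real.exp (-y)) / y) ^ l := by
  rw [← integral_exp_neg_mul hy.ne', ← integral_exp_neg_mul (by positivity)]
  have : IsProbabilityMeasure (volume.restrict (Set.Ioc (0 : ℝ) 1)) := ⟨by simp⟩
  have exp_rpow (t : ℝ) : Real.exp (-(l * y * t)) = Real.exp (-(y * t)) ^ l := by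
    rw [← Real.exp_mul]
    ring_nf
  simp_rw [exp_rpow]
  exact (Real.concaveOn_rpow hl0.le hl1).le_map_integral
    (Real.continuous_rpow_const hl0.le).continuousOn isClosed_Ici
    (ae_of_all _ fun t => (Real.exp_pos _).le)
    ((Continuous.integrableOn_Icc (by fun_prop)).mono_set Set.Ioc_subset_Icc_self)
    ((Continuous.integrableOn_Icc ((Real.continuous_rpow_const hl0.le).comp
      (by fun_prop))).mono_set Set.Ioc_subset_Icc_self)

lemma nonneg_of_deriv_sign_change {F F' : ℝ → ℝ} (hcont : ContinuousOn F (Set.Ici 0))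
    (hderiv : ∀ x, 0 < x → HasDerivAt F (F' x) x) (h0 : F 0 = 0)
    (hlim : Filter.Tendsto F Filter.atTop (nhds 0))
    (hsign : ∀ x y, 0 < x → x ≤ y → 0 ≤ F' y → 0 ≤ F' x) {x : ℝ} (hx : 0 ≤ x) : 0 ≤ F x := by
  rcases hx.eq_or_lt with rfl | hx
  · exact h0.ge
  by_cases hx' : 0 ≤ F' x
  · have hmono : MonotoneOn F (Set.Icc 0 x) := by
      refine monotoneOn_of_hasDerivWithinAt_nonneg (f' := F') (convex_Icc 0 x)
        (hcont.mono Set.Icc_subset_Ici_self) ?_ ?_ <;>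
        rw [interior_Icc] <;> intro y hy
      · exact (hderiv y hy.1).hasDerivWithinAt
      · exact hsign y x hy.1 hy.2.le hx'
    exact h0 ▸ hmono (Set.left_mem_Icc.2 hx.le) (Set.right_mem_Icc.2 hx.le) hx.le
  · have hanti : AntitoneOn F (Set.Ici x) := by
      refine antitoneOn_of_hasDerivWithinAt_nonpos (f' := F') (convex_Ici x)
        (hcont.mono (Set.Ici_subset_Ici.2 hx.le)) ?_ ?_ <;>
        rw [interior_Ici] <;> intro y hy
      · exact (hderiv y (hx.trans hy)).hasDerivWithinAt
      · exact (not_le.1 fun hy' => hx' (hsign x y hx (le_of_lt hy) hy')).le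
    refine le_of_tendsto hlim ?_
    filter_upwards [Filter.eventually_ge_atTop x] with y hy
    exact hanti Set.self_mem_Ici hy hy

/-- The derivative of the gap `P(G ≤ x) - (1 - e^{-ax})^(M+1)` in Alzer's inequality, where `G` has
a gamma law of shape `M + 1` and scale `1`. -/
def alzerGapDeriv (M : ℕ) (a x : ℝ) : ℝ :=
  x ^ M * Real.exp (-x) / M.factorial
    - (M + 1 : ℕ) * (1 - Real.exp (-(a * x))) ^ M * (Real.exp (-(a * x)) * a)

lemma hasDerivAt_alzerGap (M : ℕ) (a x : ℝ) :
    HasDerivAt (fun x => (∫ t in (0 : ℝ)..x, t ^ M * Real.exp (-t) / M.factorial)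
      - (1 - Real.exp (-(a * x))) ^ (M + 1)) (alzerGapDeriv M a x) x := by
  have hcont : Continuous fun t : ℝ => t ^ M * Real.exp (-t) / M.factorial := by fun_prop
  convert! (hcont.integral_hasStrictDerivAt 0 x).hasDerivAt.sub
    (((((hasDerivAt_id x).const_mul a).neg).exp.const_sub 1).pow (M + 1)) using 1
  simp [alzerGapDeriv]

lemma tendsto_alzerGap (M : ℕ) {a : ℝ} (ha : 0 < a) :
    Filter.Tendsto (fun x => (∫ t in (0 : ℝ)..x, t ^ M * Real.exp (-t) / M.factorial)
      - (1 - Real.exp (-(a * x))) ^ (M + 1)) Filter.atTop (nhds 0) := by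
  have : IsProbabilityMeasure (gammaMeasure ((M + 1 : ℕ) : ℝ) 1) :=
    isProbabilityMeasure_gammaMeasure (by positivity) one_pos
  have tendsto_exp : Filter.Tendsto (fun x => Real.exp (-(a * x))) Filter.atTop (nhds 0) :=
    Real.tendsto_exp_neg_atTop_nhds_zero.comp (Filter.tendsto_id.const_mul_atTop ha)
  have tendsto_gap := (tendsto_cdf_atTop (gammaMeasure ((M + 1 : ℕ) : ℝ) 1)).sub
    ((tendsto_exp.const_sub 1).pow (M + 1))
  rw [sub_zero, one_pow, sub_self] at tendsto_gap
  refine tendsto_gap.congr' ?_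
  filter_upwards [Filter.eventually_ge_atTop 0] with y hy
  rw [cdf_gammaMeasure_succ_one M hy]

variable {M : ℕ} {a : ℝ}

lemma alzerGapDeriv_nonneg_iff (ha : 0 < a) (hpow : a ^ (M + 1) * (M + 1).factorial = 1) {x : ℝ}
    (hx : 0 < x) :
    0 ≤ alzerGapDeriv M a x
      ↔ ((1 - Real.exp (-(a * x))) / (a * x)) ^ M ≤ Real.exp (-(x * (1 - a))) := by
  have succ_mul_a : ((M + 1 : ℕ) : ℝ) * a = 1 / (M.factorial * a ^ M) := by
    rw [eq_div_iff (by positivity), ← hpow, Nat.factorial_succ]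
    push_cast
    ring
  have exp_split : Real.exp (-x) = Real.exp (-(a * x)) * Real.exp (-(x * (1 - a))) := by
    rw [← Real.exp_add]
    ring_nf
  have factorization : alzerGapDeriv M a x
      = (x ^ M * Real.exp (-(a * x)) / M.factorial) * (Real.exp (-(x * (1 - a)))
        - ((1 - Real.exp (-(a * x))) / (a * x)) ^ M) := by
    have reorder : ((M + 1 : ℕ) : ℝ) * (1 - Real.exp (-(a * x))) ^ M * (Real.exp (-(a * x)) * a)
        = (M + 1 : ℕ) * a * ((1 - Real.exp (-(a * x))) ^ M * Real.exp (-(a * x))) := by ring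
    rw [alzerGapDeriv, reorder, succ_mul_a, exp_split, div_pow, mul_pow]
    field_simp
  rw [factorization, mul_nonneg_iff_of_pos_left (by positivity), sub_nonneg]

lemma alzerGapDeriv_nonneg_of_le (ha : 0 < a) (hpow : a ^ (M + 1) * (M + 1).factorial = 1)
    {x y : ℝ} (hx : 0 < x) (hxy : x ≤ y) (hy : 0 ≤ alzerGapDeriv M a y) :
    0 ≤ alzerGapDeriv M a x := by
  have hy0 : 0 < y := hx.trans_le hxy
  rw [alzerGapDeriv_nonneg_iff ha hpow hy0] at hy
  rw [alzerGapDeriv_nonneg_iff ha hpow hx]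
  have mean_nonneg {z : ℝ} (hz : 0 < z) : 0 ≤ (1 - Real.exp (-z)) / z :=
    div_nonneg (by rw [sub_nonneg, Real.exp_le_one_iff]; linarith) hz.le
  have mean_le := one_sub_exp_neg_div_le_rpow (mul_pos ha hy0) (div_pos hx hy0)
    ((div_le_one hy0).2 hxy)
  rw [show x / y * (a * y) = a * x by field_simp] at mean_le
  calc ((1 - Real.exp (-(a * x))) / (a * x)) ^ M
      ≤ (((1 - Real.exp (-(a * y))) / (a * y)) ^ (x / y)) ^ M :=
        pow_le_pow_left₀ (mean_nonneg (mul_pos ha hx)) mean_le _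
    _ = (((1 - Real.exp (-(a * y))) / (a * y)) ^ M) ^ (x / y) := by
        rw [← Real.rpow_mul_natCast (mean_nonneg (mul_pos ha hy0)),
          ← Real.rpow_natCast_mul (mean_nonneg (mul_pos ha hy0)), mul_comm (x / y)]
    _ ≤ (Real.exp (-(y * (1 - a)))) ^ (x / y) :=
        Real.rpow_le_rpow (pow_nonneg (mean_nonneg (mul_pos ha hy0)) _) hy (by positivity)
    _ = Real.exp (-(x * (1 - a))) := by
        rw [← Real.exp_mul]
        congr 1
        field_simp

lemma one_sub_exp_neg_pow_le_cdf_gammaMeasure (ha : 0 < a)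
    (hpow : a ^ (M + 1) * (M + 1).factorial = 1) {x : ℝ} (hx : 0 ≤ x) :
    (1 - Real.exp (-(a * x))) ^ (M + 1) ≤ cdf (gammaMeasure ((M + 1 : ℕ) : ℝ) 1) x := by
  rw [cdf_gammaMeasure_succ_one M hx, ← sub_nonneg]
  exact nonneg_of_deriv_sign_change
    (fun x _ => (hasDerivAt_alzerGap M a x).continuousAt.continuousWithinAt)
    (fun x _ => hasDerivAt_alzerGap M a x) (by simp) (tendsto_alzerGap M ha)
    (fun x y hx hxy hy => alzerGapDeriv_nonneg_of_le ha hpow hx hxy hy) hx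

lemma gammaMeasure_Ici_le {N : ℕ} (hN : 0 < N) {x : ℝ} (hx : 0 ≤ x) :
    gammaMeasure N 1 (Set.Ici x) ≤ ENNReal.ofReal
      (1 - (1 - Real.exp (-((N.factorial : ℝ) ^ (-(1 / (N : ℝ))) * x))) ^ N) := by
  obtain ⟨M, rfl⟩ := Nat.exists_eq_succ_of_ne_zero hN.ne'
  have hfac : (0 : ℝ) < (M + 1).factorial := by positivity
  have hpow : (((M + 1).factorial : ℝ) ^ (-(1 / ((M + 1 : ℕ) : ℝ)))) ^ (M + 1)
      * (M + 1).factorial = 1 := by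
    rw [← Real.rpow_mul_natCast hfac.le, neg_mul, one_div, inv_mul_cancel₀ (by positivity),
      Real.rpow_neg_one, inv_mul_cancel₀ hfac.ne']
  have : IsProbabilityMeasure (gammaMeasure ((M + 1 : ℕ) : ℝ) 1) :=
    isProbabilityMeasure_gammaMeasure (by positivity) one_pos
  have : NullSingletonClass (gammaMeasure ((M + 1 : ℕ) : ℝ) 1) := by
    unfold gammaMeasure
    infer_instance
  have tail_eq : gammaMeasure ((M + 1 : ℕ) : ℝ) 1 (Set.Ici x)
      = ENNReal.ofReal (1 - cdf (gammaMeasure ((M + 1 : ℕ) : ℝ) 1) x) := by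
    rw [cdf_eq_real, ← probReal_compl_eq_one_sub measurableSet_Iic, Set.compl_Iic,
      ofReal_measureReal, measure_congr Ioi_ae_eq_Ici]
  exact tail_eq.trans_le (ENNReal.ofReal_le_ofReal (sub_le_sub_left
    (one_sub_exp_neg_pow_le_cdf_gammaMeasure (by positivity) hpow hx) _))

lemma one_sub_one_sub_pow {R : Type*} [CommRing R] (y : R) (N : ℕ) :
    1 - (1 - y) ^ N = ∑ n ∈ Finset.Icc 1 N, (N.choose n : R) * (-1) ^ (n + 1) * y ^ n := by
  have hexpand : (1 - y) ^ N = ∑ n ∈ Finset.range (N + 1), (-y) ^ n * (N.choose n : R) := by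
    rw [sub_eq_neg_add, add_pow]
    simp
  rw [hexpand, Finset.sum_range_succ', Finset.range_eq_Ico, Finset.sum_Ico_add' (fun n =>
    (-y) ^ n * (N.choose n : R)) 0 N 1, zero_add, pow_zero, Nat.choose_zero_right, Nat.cast_one,
    mul_one, sub_add_cancel_right, ← Finset.sum_neg_distrib]
  refine Finset.sum_congr rfl fun n _ => ?_
  rw [neg_pow]
  ring

/-- The upper bound `1 - (1 - e^{-t}) ^ N` for the tails of the gamma distribution with
shape `N`, extended by `0` to `t = ∞`. -/
def gammaTailBound (N : ℕ) (t : ℝ≥0∞) : ℝ := 1 - (1 - (expNeg t).toReal) ^ N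

lemma gammaTailBound_mem_Icc (N : ℕ) (t : ℝ≥0∞) : gammaTailBound N t ∈ Set.Icc (0 : ℝ) 1 := by
  obtain ⟨hnonneg, hle⟩ := toReal_expNeg_mem_Icc t
  have hpow : (1 - (expNeg t).toReal) ^ N ≤ 1 := pow_le_one₀ (by linarith) (by linarith)
  have : 0 ≤ (1 - (expNeg t).toReal) ^ N := pow_nonneg (by linarith) N
  exact ⟨sub_nonneg.2 hpow, by unfold gammaTailBound; linarith⟩

@[fun_prop]
lemma measurable_gammaTailBound (N : ℕ) : Measurable (gammaTailBound N) := by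
  unfold gammaTailBound
  fun_prop

lemma gammaTailBound_eq_sum (N : ℕ) (t : ℝ≥0∞) :
    gammaTailBound N t = ∑ n ∈ Finset.Icc 1 N,
      (N.choose n : ℝ) * (-1) ^ (n + 1) * (expNeg (n * t)).toReal := by
  simp_rw [gammaTailBound, one_sub_one_sub_pow, expNeg_natCast_mul, ENNReal.toReal_pow]

lemma gammaMeasure_one_le_div_le {N : ℕ} (hN : 0 < N) {c : ℝ} (hc : 0 < c) (x : ℝ≥0∞) :
    gammaMeasure N 1 {y | 1 ≤ ENNReal.ofReal (c * y) / x} ≤ ENNReal.ofReal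
      (gammaTailBound N (ENNReal.ofReal ((N.factorial : ℝ) ^ (-(1 / (N : ℝ))) / c) * x)) := by
  rcases eq_or_ne x ∞ with rfl | hx
  · simp
  have hsub : {y | 1 ≤ ENNReal.ofReal (c * y) / x} ⊆ Set.Ici (x.toReal / c) := by
    intro y hy
    have hle : x ≤ ENNReal.ofReal (c * y) := by simpa using ENNReal.mul_le_of_le_div hy
    rcases le_or_gt 0 (c * y) with hcy | hcy
    · exact (div_le_iff₀' hc).2 (ENNReal.toReal_le_of_le_ofReal hcy hle)
    · simp [ENNReal.ofReal_of_nonpos hcy.le] at hy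
  refine (measure_mono hsub).trans
    ((gammaMeasure_Ici_le hN (div_nonneg ENNReal.toReal_nonneg hc.le)).trans_eq ?_)
  rw [gammaTailBound, expNeg_of_ne_top (ENNReal.mul_ne_top ENNReal.ofReal_ne_top hx),
    ENNReal.toReal_ofReal (Real.exp_pos _).le, ENNReal.toReal_mul,
    ENNReal.toReal_ofReal (by positivity), div_mul_eq_mul_div, mul_div_assoc]

end Alzer

/-! ### Incomplete beta integrals as hypergeometric series -/

section BetaIntegral

/-- The integral `∫₀ᵏ t^(b-1) (t + s)^(-a) dt`, an incomplete beta function up to scaling: the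
radial integrals in the exponent `Ξ` reduce to it. -/
def betaInt (a : ℕ) (b s k : ℝ) : ℝ := ∫ t in (0 : ℝ)..k, t ^ (b - 1) * ((t + s) ^ a)⁻¹

/-- The ratio `(a)_n / (b)_n` of rising factorials. -/
def pochRatio (a b : ℝ) (n : ℕ) : ℝ := (ascPochhammer ℝ n).eval a / (ascPochhammer ℝ n).eval b

lemma pochRatio_succ (a b : ℝ) (n : ℕ) :
    pochRatio a b (n + 1) = pochRatio a b n * ((a + n) / (b + n)) := by
  rw [pochRatio, ascPochhammer_succ_eval, ascPochhammer_succ_eval, mul_div_mul_comm, pochRatio]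

lemma pochRatio_pos {a b : ℝ} (ha : 0 < a) (hb : 0 < b) (n : ℕ) : 0 < pochRatio a b n :=
  div_pos (ascPochhammer_pos n a ha) (ascPochhammer_pos n b hb)

lemma tendsto_pochRatio_mul_pow {a b z : ℝ} (ha : 0 < a) (hb : 0 < b) (hz : 0 < z)
    (hz1 : z < 1) :
    Filter.Tendsto (fun n => pochRatio a b n * z ^ n) Filter.atTop (nhds 0) := by
  have ratio_eq (n : ℕ) : ‖pochRatio a b (n + 1) * z ^ (n + 1)‖ / ‖pochRatio a b n * z ^ n‖
      = (1 + (a - b) / (b + n)) * z := by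
    have := pochRatio_pos ha hb n
    have := pochRatio_pos ha hb (n + 1)
    rw [Real.norm_of_nonneg (by positivity), Real.norm_of_nonneg (by positivity), pochRatio_succ]
    have : b + n ≠ 0 := by positivity
    field_simp
    ring
  refine (summable_of_ratio_test_tendsto_lt_one hz1 (Filter.Eventually.of_forall fun n =>
    (mul_pos (pochRatio_pos ha hb n) (pow_pos hz n)).ne') ?_).tendsto_atTop_zero
  simp_rw [ratio_eq]
  have tendsto_div : Filter.Tendsto (fun n : ℕ => (a - b) / (b + (n : ℝ))) Filter.atTop (nhds 0) :=
    tendsto_const_nhds.div_atTop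
      (Filter.tendsto_atTop_add_const_left _ _ tendsto_natCast_atTop_atTop)
  simpa using (tendsto_div.const_add 1).mul_const z

lemma mul_eval_ascPochhammer_add_one (b : ℝ) (n : ℕ) :
    b * (ascPochhammer ℝ n).eval (b + 1) = (ascPochhammer ℝ n).eval b * (b + n) := by
  rw [← ascPochhammer_succ_eval, ascPochhammer_succ_left]
  simp

variable (a : ℕ) {b s k : ℝ}

lemma continuousOn_inv_add_pow (hs : 0 < s) (hk : 0 ≤ k) :
    ContinuousOn (fun t : ℝ => ((t + s) ^ a)⁻¹) (Set.uIcc 0 k) := by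
  refine ContinuousOn.inv₀ (by fun_prop) fun t ht => ?_
  rw [Set.uIcc_of_le hk] at ht
  have : 0 < t + s := by linarith [ht.1]
  positivity

lemma intervalIntegrable_betaInt (hb : 0 < b) (hs : 0 < s) (hk : 0 ≤ k) :
    IntervalIntegrable (fun t : ℝ => t ^ (b - 1) * ((t + s) ^ a)⁻¹) volume 0 k :=
  (intervalIntegral.intervalIntegrable_rpow' (by linarith)).mul_continuousOn
    (continuousOn_inv_add_pow a hs hk)

lemma hasDerivAt_rpow_div_mul_inv_add_pow (hs : 0 < s) {t : ℝ} (ht : 0 < t) (hb : b ≠ 0) :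
    HasDerivAt (fun t : ℝ => t ^ b / b * ((t + s) ^ a)⁻¹)
      (t ^ (b - 1) * ((t + s) ^ a)⁻¹ - a / b * (t ^ (b + 1 - 1) * ((t + s) ^ (a + 1))⁻¹)) t := by
  have hts : 0 < t + s := by linarith
  have deriv_rpow := (Real.hasDerivAt_rpow_const (x := t) (p := b) (Or.inl ht.ne')).div_const b
  have deriv_inv := (((hasDerivAt_id t).add_const s).pow a).inv (pow_pos hts a).ne'
  convert! deriv_rpow.mul deriv_inv using 1
  cases a with
  | zero =>
    simp
    field_simp
  | succ a =>
    simp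
    field_simp
    ring

-- Integration by parts.
lemma betaInt_succ (hb : 0 < b) (hs : 0 < s) (hk : 0 < k) :
    betaInt a b s k = k ^ b / b * ((k + s) ^ a)⁻¹ + a / b * betaInt (a + 1) (b + 1) s k := by
  have hint := intervalIntegrable_betaInt a hb hs hk.le
  have hint_succ := (intervalIntegrable_betaInt (a + 1) (b := b + 1) (by linarith) hs
    hk.le).const_mul ((a : ℝ) / b)
  have hcont : ContinuousOn (fun t : ℝ => t ^ b / b * ((t + s) ^ a)⁻¹) (Set.Icc 0 k) := by
    rw [← Set.uIcc_of_le hk.le]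
    exact ((Real.continuous_rpow_const hb.le).div_const b).continuousOn.mul
      (continuousOn_inv_add_pow a hs hk.le)
  have hparts := intervalIntegral.integral_eq_sub_of_hasDerivAt_of_le hk.le hcont
    (fun t ht => hasDerivAt_rpow_div_mul_inv_add_pow a hs ht.1 hb.ne') (hint.sub hint_succ)
  rw [intervalIntegral.integral_sub hint hint_succ, intervalIntegral.integral_const_mul,
    Real.zero_rpow hb.ne', zero_div, zero_mul, sub_zero, sub_eq_iff_eq_add] at hparts
  exact hparts

lemma betaInt_nonneg (b : ℝ) (hs : 0 < s) (hk : 0 < k) : 0 ≤ betaInt a b s k := by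
  refine intervalIntegral.integral_nonneg hk.le fun t ht => ?_
  have ht0 := ht.1
  positivity

lemma betaInt_succ_le (hb : 0 < b) (hs : 0 < s) (hk : 0 < k) :
    betaInt (a + 1) (b + 1) s k ≤ k / (k + s) * betaInt a b s k := by
  unfold betaInt
  rw [← intervalIntegral.integral_const_mul]
  refine intervalIntegral.integral_mono_on_of_le_Ioo hk.le
    (intervalIntegrable_betaInt (a + 1) (by linarith) hs hk.le)
    ((intervalIntegrable_betaInt a hb hs hk.le).const_mul _) fun t ⟨ht0, htk⟩ => ?_
  have hts : t + s ≠ 0 := by positivity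
  have ratio_le : t / (t + s) ≤ k / (k + s) := by
    rw [div_le_div_iff₀ (by linarith) (by linarith)]
    nlinarith
  calc t ^ (b + 1 - 1) * ((t + s) ^ (a + 1))⁻¹
      = t / (t + s) * (t ^ (b - 1) * ((t + s) ^ a)⁻¹) := by
        rw [add_sub_right_comm, Real.rpow_add_one ht0.ne', pow_succ]
        field_simp
    _ ≤ _ := mul_le_mul_of_nonneg_right ratio_le (by positivity)

lemma betaInt_add_le (hb : 0 < b) (hs : 0 < s) (hk : 0 < k) (M : ℕ) :
    betaInt (a + M) (b + M) s k ≤ (k / (k + s)) ^ M * betaInt a b s k := by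
  induction M with
  | zero => simp
  | succ M ih =>
    calc betaInt (a + (M + 1)) (b + (M + 1 : ℕ)) s k
        = betaInt (a + M + 1) (b + M + 1) s k := by rw [Nat.cast_succ, add_assoc, add_assoc]
      _ ≤ k / (k + s) * betaInt (a + M) (b + M) s k :=
        betaInt_succ_le (a + M) (by positivity) hs hk
      _ ≤ k / (k + s) * ((k / (k + s)) ^ M * betaInt a b s k) := by gcongr
      _ = _ := by ring

lemma betaInt_eq_sum_add (hb : 0 < b) (hs : 0 < s) (hk : 0 < k) (M : ℕ) :
    betaInt a b s k = (∑ n ∈ Finset.range M,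
        k ^ (b + n) / (b + n) * ((k + s) ^ (a + n))⁻¹ * pochRatio a b n)
      + pochRatio a b M * betaInt (a + M) (b + M) s k := by
  induction M with
  | zero => simp [pochRatio]
  | succ M ih =>
    rw [ih, Finset.sum_range_succ, pochRatio_succ,
      betaInt_succ (a + M) (b := b + M) (by positivity) hs hk, Nat.cast_succ, ← add_assoc,
      ← add_assoc]
    push_cast
    ring

variable {a}

lemma tendsto_pochRatio_mul_betaInt (ha : 0 < a) (hb : 0 < b) (hs : 0 < s) (hk : 0 < k) :
    Filter.Tendsto (fun M : ℕ => pochRatio a b M * betaInt (a + M) (b + M) s k)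
      Filter.atTop (nhds 0) := by
  have pochRatio_nonneg (M : ℕ) : 0 ≤ pochRatio a b M := (pochRatio_pos (by positivity) hb M).le
  have hbound := (tendsto_pochRatio_mul_pow (Nat.cast_pos.2 ha) hb (z := k / (k + s))
    (by positivity) ((div_lt_one (by linarith)).2 (by linarith))).mul_const (betaInt a b s k)
  rw [zero_mul] at hbound
  refine squeeze_zero (fun M => mul_nonneg (pochRatio_nonneg M) (betaInt_nonneg _ _ hs hk))
    (fun M => ?_) hbound
  rw [mul_assoc]
  exact mul_le_mul_of_nonneg_left (betaInt_add_le a hb hs hk M) (pochRatio_nonneg M)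

lemma hasSum_betaInt (ha : 0 < a) (hb : 0 < b) (hs : 0 < s) (hk : 0 < k) :
    HasSum (fun n : ℕ => k ^ (b + n) / (b + n) * ((k + s) ^ (a + n))⁻¹ * pochRatio a b n)
      (betaInt a b s k) := by
  refine (hasSum_iff_tendsto_nat_of_nonneg (fun n => ?_) _).2 ?_
  · have := pochRatio_pos (Nat.cast_pos.2 ha) hb n
    positivity
  · have partial_sums := (tendsto_pochRatio_mul_betaInt ha hb hs hk).const_sub (betaInt a b s k)
    rw [sub_zero] at partial_sums
    exact partial_sums.congr fun M => sub_eq_iff_eq_add.2 (betaInt_eq_sum_add a hb hs hk M)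

lemma betaInt_eq_hypergeometric (ha : 0 < a) (hb : 0 < b) (hs : 0 < s) (hk : 0 < k) :
    betaInt a b s k = k ^ b / (b * (k + s) ^ a)
      * ordinaryHypergeometric (1 : ℝ) (a : ℝ) (b + 1) (k / (k + s)) := by
  rw [← (hasSum_betaInt ha hb hs hk).tsum_eq, ordinaryHypergeometric_eq_tsum, ← tsum_mul_left]
  refine tsum_congr fun n => ?_
  have eval_add_one : (ascPochhammer ℝ n).eval (b + 1)
      = (ascPochhammer ℝ n).eval b * (b + n) / b := by
    rw [← mul_eval_ascPochhammer_add_one]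
    field_simp
  have eval_pos := ascPochhammer_pos n b hb
  have : 0 < b + n := by positivity
  have : 0 < k + s := by positivity
  have hfac : (n.factorial : ℝ) ≠ 0 := by positivity
  rw [ascPochhammer_eval_one, eval_add_one, pochRatio, Real.rpow_add hk, Real.rpow_natCast,
    smul_eq_mul, pow_add, div_pow]
  field_simp

lemma betaInt_inv_eq_hypergeometric (hb : 0 < b) (hs : 0 < s) (hk : 0 < k) (m : ℕ) :
    (s ^ (m + 1))⁻¹ * betaInt (m + 1) b s⁻¹ k⁻¹
      = k ^ ((m : ℝ) + (1 - b)) / (b * (s + k) ^ (m + 1))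
        * ordinaryHypergeometric (1 : ℝ) ((m + 1 : ℕ) : ℝ) (b + 1) (s / (s + k)) := by
  have ratio_eq : k⁻¹ / (k⁻¹ + s⁻¹) = s / (s + k) := by field_simp
  have inv_add_inv_eq : k⁻¹ + s⁻¹ = (s + k) / (k * s) := by field_simp
  have rpow_eq : k ^ ((m : ℝ) + (1 - b)) = k ^ (m + 1) / k ^ b := by
    rw [← add_sub_assoc, Real.rpow_sub hk, Real.rpow_add_one hk.ne', Real.rpow_natCast, pow_succ]
  rw [betaInt_eq_hypergeometric (Nat.succ_pos m) hb (inv_pos.2 hs) (inv_pos.2 hk), ratio_eq,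
    inv_add_inv_eq, rpow_eq, Real.inv_rpow hk.le, ← mul_assoc]
  congr 1
  have : s + k ≠ 0 := by positivity
  rw [div_pow, mul_pow]
  generalize s + k = A at *
  field_simp

end BetaIntegral

/-! ### Radial integrals -/

section Radial

lemma one_sub_inv_one_add_pow {x : ℝ} (hx : 0 ≤ x) (N : ℕ) :
    1 - ((1 + x) ^ N)⁻¹ = x * ∑ m ∈ Finset.range N, ((1 + x) ^ (m + 1))⁻¹ := by
  induction N with
  | zero => simp
  | succ N ih =>
    rw [Finset.sum_range_succ, mul_add, ← ih]
    field_simp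
    ring

/-- The integrand `r (1 - (1 + s w r^{-α})^{-N})`: in polar coordinates, `1` minus the Laplace
transform at `s` of the power `w r^{-α} g` received at distance `r`, where `g` is gamma with shape
`N` and scale `1`. -/
def radial (s w α : ℝ) (N : ℕ) (r : ℝ) : ℝ := r * (1 - ((1 + s * (w * r ^ (-α))) ^ N)⁻¹)

/-- A finite combination of integrands of `betaInt`, the form that `radial` takes after a
substitution. -/
def betaSum (A : ℝ) (N : ℕ) (c b : ℕ → ℝ) (s t : ℝ) : ℝ :=
  A * ∑ m ∈ Finset.range N, c m * (t ^ (b m - 1) * ((t + s) ^ (m + 1))⁻¹)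

lemma intervalIntegrable_betaSum (A : ℝ) (N : ℕ) (c : ℕ → ℝ) {b : ℕ → ℝ} {s k : ℝ}
    (hb : ∀ m, 0 < b m) (hs : 0 < s) (hk : 0 ≤ k) :
    IntervalIntegrable (betaSum A N c b s) volume 0 k := by
  refine IntervalIntegrable.const_mul ?_ _
  simpa only [Finset.sum_fn] using IntervalIntegrable.sum _ fun m _ =>
    (intervalIntegrable_betaInt (m + 1) (hb m) hs hk).const_mul (c m)

lemma integral_betaSum (A : ℝ) (N : ℕ) (c : ℕ → ℝ) {b : ℕ → ℝ} {s k : ℝ}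
    (hb : ∀ m, 0 < b m) (hs : 0 < s) (hk : 0 ≤ k) :
    ∫ t in (0 : ℝ)..k, betaSum A N c b s t
      = A * ∑ m ∈ Finset.range N, c m * betaInt (m + 1) (b m) s k := by
  simp only [betaSum]
  rw [intervalIntegral.integral_const_mul, intervalIntegral.integral_finsetSum fun m _ =>
    (intervalIntegrable_betaInt (m + 1) (hb m) hs hk).const_mul (c m)]
  simp_rw [intervalIntegral.integral_const_mul]
  rfl

lemma integrableOn_and_integral_eq_of_image_eq_Ioo {S : Set ℝ} (hS : MeasurableSet S)
    {f f' F G : ℝ → ℝ} {k : ℝ} (hk : 0 ≤ k) (hf : ∀ r ∈ S, HasDerivWithinAt f (f' r) S r)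
    (hinj : Set.InjOn f S) (himage : f '' S = Set.Ioo 0 k) (hG : IntervalIntegrable G volume 0 k)
    (hFG : ∀ r ∈ S, |f' r| • G (f r) = F r) :
    IntegrableOn F S ∧ ∫ r in S, F r = ∫ t in (0 : ℝ)..k, G t := by
  constructor
  · rw [intervalIntegrable_iff_integrableOn_Ioo_of_le hk, ← himage,
      integrableOn_image_iff_integrableOn_abs_deriv_smul hS hf hinj] at hG
    exact hG.congr_fun hFG hS
  · rw [intervalIntegral.integral_of_le hk, integral_Ioc_eq_integral_Ioo, ← himage,
      integral_image_eq_integral_abs_deriv_smul hS hf hinj]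
    exact (setIntegral_congr_fun hS hFG).symm

variable {s w α D : ℝ}

lemma image_rpow_div_Ioo (hα : 0 < α) (hD : 0 < D) (hw : 0 < w) :
    (fun r : ℝ => r ^ α / w) '' Set.Ioo 0 D = Set.Ioo 0 (D ^ α / w) := by
  ext t
  constructor
  · rintro ⟨r, ⟨hr0, hrD⟩, rfl⟩
    exact ⟨by positivity, div_lt_div_of_pos_right (Real.rpow_lt_rpow hr0.le hrD hα) hw⟩
  · rintro ⟨ht0, ht⟩
    have hwt : 0 < w * t := by positivity
    refine ⟨(w * t) ^ α⁻¹, ⟨by positivity, ?_⟩, ?_⟩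
    · rwa [Real.rpow_inv_lt_iff_of_pos hwt.le hD.le hα, mul_comm, ← lt_div_iff₀ hw]
    · simp only [Real.rpow_inv_rpow hwt.le hα.ne', mul_div_cancel_left₀ t hw.ne']

lemma image_mul_rpow_neg_Ioi (hα : 0 < α) (hD : 0 < D) (hw : 0 < w) :
    (fun r : ℝ => w * r ^ (-α)) '' Set.Ioi D = Set.Ioo 0 ((D ^ α / w)⁻¹) := by
  rw [inv_div]
  ext t
  constructor
  · rintro ⟨r, hr : D < r, rfl⟩
    have hr0 : 0 < r := hD.trans hr
    refine ⟨by positivity, ?_⟩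
    simp only [Real.rpow_neg hr0.le, ← div_eq_mul_inv]
    exact div_lt_div_of_pos_left hw (by positivity) (Real.rpow_lt_rpow hD.le hr hα)
  · rintro ⟨ht0, ht⟩
    have hwt : 0 < w / t := by positivity
    refine ⟨(w / t) ^ α⁻¹, ?_, ?_⟩
    · rwa [Set.mem_Ioi, Real.lt_rpow_inv_iff_of_pos hD.le hwt.le hα,
        lt_div_comm₀ (by positivity) ht0]
    · simp only [Real.rpow_neg (Real.rpow_nonneg hwt.le _), Real.rpow_inv_rpow hwt.le hα.ne']
      field_simp

-- The substitution `t = r^α / w`, for which `s w r^{-α} = s / t`.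
lemma deriv_smul_betaSum_near {r : ℝ} (hs : 0 < s) (hw : 0 < w) (hα : 0 < α) (N : ℕ)
    (hr : 0 < r) :
    |α * r ^ (α - 1) / w| • betaSum (s * (w ^ (2 / α) / α)) N (fun _ => 1)
        (fun m => (m : ℝ) + 2 / α) s (r ^ α / w) = radial s w α N r := by
  rw [abs_of_nonneg (by positivity), radial, one_sub_inv_one_add_pow (by positivity), betaSum]
  simp only [smul_eq_mul, Finset.mul_sum]
  refine Finset.sum_congr rfl fun m _ => ?_
  have rpow_eq : (r ^ α / w) ^ ((m : ℝ) + 2 / α - 1)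
      = (r ^ α / w) ^ m * (r ^ 2 / w ^ (2 / α)) / (r ^ α / w) := by
    rw [Real.rpow_sub_one (by positivity), Real.rpow_add (by positivity), Real.rpow_natCast,
      Real.div_rpow (by positivity) hw.le (2 / α), ← Real.rpow_mul hr.le,
      mul_div_cancel₀ _ hα.ne', Real.rpow_two]
  have one_add_eq : 1 + s * (w * r ^ (-α)) = (r ^ α / w + s) / (r ^ α / w) := by
    rw [Real.rpow_neg hr.le]
    field_simp
  rw [rpow_eq, one_add_eq, Real.rpow_sub_one hr.ne', Real.rpow_neg hr.le]
  simp only [div_pow]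
  have : r ^ α / w + s ≠ 0 := by positivity
  have : w ^ (2 / α) ≠ 0 := by positivity
  have : r ^ α ≠ 0 := by positivity
  generalize r ^ α / w + s = A at *
  field_simp
  ring

lemma integrableOn_and_integral_radial_near (hs : 0 < s) (hw : 0 < w) (hα : 0 < α) (hD : 0 < D)
    (N : ℕ) :
    IntegrableOn (radial s w α N) (Set.Ioc 0 D) ∧
    ∫ r in Set.Ioc 0 D, radial s w α N r = s * (w ^ (2 / α) / α)
      * ∑ m ∈ Finset.range N, betaInt (m + 1) (m + 2 / α) s (D ^ α / w) := by
  have hderiv (r : ℝ) (hr : r ∈ Set.Ioo 0 D) : HasDerivWithinAt (fun r : ℝ => r ^ α / w)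
      (α * r ^ (α - 1) / w) (Set.Ioo 0 D) r :=
    ((Real.hasDerivAt_rpow_const (Or.inl hr.1.ne')).div_const w).hasDerivWithinAt
  have hinj : Set.InjOn (fun r : ℝ => r ^ α / w) (Set.Ioo 0 D) := fun r hr r' hr' h =>
    (Real.rpow_left_inj hr.1.le hr'.1.le hα.ne').1 ((div_left_inj' hw.ne').1 h)
  have hb (m : ℕ) : 0 < (m : ℝ) + 2 / α := by positivity
  have hk : 0 ≤ D ^ α / w := by positivity
  rw [integrableOn_Ioc_iff_integrableOn_Ioo, integral_Ioc_eq_integral_Ioo]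
  simpa only [integral_betaSum _ _ _ hb hs hk, one_mul]
    using integrableOn_and_integral_eq_of_image_eq_Ioo measurableSet_Ioo hk hderiv hinj
      (image_rpow_div_Ioo hα hD hw) (intervalIntegrable_betaSum _ N _ hb hs hk)
      fun r hr => deriv_smul_betaSum_near hs hw hα N hr.1

-- The substitution `t = w r^{-α}`.
lemma deriv_smul_betaSum_far {r : ℝ} (hs : 0 < s) (hw : 0 < w) (hα : 0 < α) (N : ℕ)
    (hr : 0 < r) :
    |w * (-α * r ^ (-α - 1))| • betaSum (s * (w ^ (2 / α) / α)) N (fun m => (s ^ (m + 1))⁻¹)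
        (fun _ => 1 - 2 / α) s⁻¹ (w * r ^ (-α)) = radial s w α N r := by
  have abs_deriv : |w * (-α * r ^ (-α - 1))| = w * (α * (r ^ (-α) / r)) := by
    rw [abs_mul, abs_mul, abs_neg, abs_of_pos hw, abs_of_pos hα, abs_of_nonneg (by positivity),
      Real.rpow_sub_one hr.ne']
  rw [abs_deriv, radial, one_sub_inv_one_add_pow (by positivity), betaSum]
  simp only [smul_eq_mul, Finset.mul_sum]
  refine Finset.sum_congr rfl fun m _ => ?_
  have rpow_eq : (w * r ^ (-α)) ^ (1 - 2 / α - 1) = r ^ 2 / w ^ (2 / α) := by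
    rw [sub_sub_cancel_left, Real.mul_rpow hw.le (by positivity), ← Real.rpow_mul hr.le,
      Real.rpow_neg hw.le, neg_mul_neg, mul_div_cancel₀ _ hα.ne', Real.rpow_two,
      inv_mul_eq_div]
  have add_inv_eq : w * r ^ (-α) + s⁻¹ = (1 + s * (w * r ^ (-α))) / s := by
    field_simp
    ring
  rw [rpow_eq, add_inv_eq, div_pow]
  have : 1 + s * (w * r ^ (-α)) ≠ 0 := by positivity
  have : w ^ (2 / α) ≠ 0 := by positivity
  generalize 1 + s * (w * r ^ (-α)) = B at *
  field_simp

lemma integrableOn_and_integral_radial_far (hs : 0 < s) (hw : 0 < w) (hα : 2 < α) (hD : 0 < D)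
    (N : ℕ) :
    IntegrableOn (radial s w α N) (Set.Ioi D) ∧
    ∫ r in Set.Ioi D, radial s w α N r = s * (w ^ (2 / α) / α)
      * ∑ m ∈ Finset.range N, (s ^ (m + 1))⁻¹
          * betaInt (m + 1) (1 - 2 / α) s⁻¹ (D ^ α / w)⁻¹ := by
  have hα0 : 0 < α := two_pos.trans hα
  have hderiv (r : ℝ) (hr : r ∈ Set.Ioi D) : HasDerivWithinAt (fun r : ℝ => w * r ^ (-α))
      (w * (-α * r ^ (-α - 1))) (Set.Ioi D) r :=
    ((Real.hasDerivAt_rpow_const (Or.inl (hD.trans hr).ne')).const_mul w).hasDerivWithinAt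
  have hinj : Set.InjOn (fun r : ℝ => w * r ^ (-α)) (Set.Ioi D) := fun r hr r' hr' h =>
    (Real.rpow_left_inj (hD.trans hr).le (hD.trans hr').le (neg_ne_zero.2 hα0.ne')).1
      (mul_left_cancel₀ hw.ne' h)
  have hb (_ : ℕ) : 0 < 1 - 2 / α := sub_pos.2 ((div_lt_one hα0).2 hα)
  have hk : 0 ≤ (D ^ α / w)⁻¹ := by positivity
  simpa only [integral_betaSum _ _ _ hb (inv_pos.2 hs) hk]
    using integrableOn_and_integral_eq_of_image_eq_Ioo measurableSet_Ioi hk hderiv hinj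
      (image_mul_rpow_neg_Ioi hα0 hD hw) (intervalIntegrable_betaSum _ N _ hb (inv_pos.2 hs) hk)
      fun r hr => deriv_smul_betaSum_far hs hw hα0 N (hD.trans hr)

end Radial

/-! ### Grouping independent families -/

lemma comap_pi_le_iSup_range {Ω ι κ β : Type*} [MeasurableSpace β] (X : ι → Ω → β)
    (e : κ → ι) :
    MeasurableSpace.comap (fun ω k => X (e k) ω) MeasurableSpace.pi
      ≤ ⨆ i ∈ Set.range e, MeasurableSpace.comap (X i) inferInstance := by
  rw [MeasurableSpace.pi, MeasurableSpace.comap_iSup]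
  refine iSup_le fun k => ?_
  rw [MeasurableSpace.comap_comp]
  exact le_iSup₂ (f := fun i (_ : i ∈ Set.range e) => MeasurableSpace.comap (X i) inferInstance)
    (e k) ⟨k, rfl⟩

section Grouping

variable {Ω ι κ κ' β : Type*} [MeasurableSpace Ω] [MeasurableSpace β] {P : Measure Ω}

lemma iIndepFun_curry {X : ι → κ → Ω → β} (hX : ∀ i k, Measurable (X i k))
    (h : iIndepFun (fun q : (_ : ι) × κ => X q.1 q.2) P) :
    iIndepFun (fun i ω k => X i k ω) P := by
  have := h.isProbabilityMeasure
  have (i : ι) (k : κ) : IsProbabilityMeasure (P.map (X i k)) :=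
    Measure.isProbabilityMeasure_map (hX i k).aemeasurable
  have hjoint := (iIndepFun_iff_map_fun_eq_infinitePi_map
    fun q : (_ : ι) × κ => hX q.1 q.2).1 h
  have hrow (i : ι) : P.map (fun ω k => X i k ω) = Measure.infinitePi fun k => P.map (X i k) :=
    (iIndepFun_iff_map_fun_eq_infinitePi_map (hX i)).1
      (h.precomp (g := fun k => (⟨i, k⟩ : (_ : ι) × κ)) fun k k' hk => by simpa using hk)
  rw [iIndepFun_iff_map_fun_eq_infinitePi_map fun i => measurable_pi_lambda _ (hX i)]
  simp_rw [hrow]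
  rw [← Measure.infinitePi_map_piCurry (fun i k => P.map (X i k)), ← hjoint,
    Measure.map_map (by fun_prop) (by fun_prop)]
  rfl

lemma indepFun_of_disjoint_range {X : ι → Ω → β} (hX : ∀ i, Measurable (X i))
    (h : iIndepFun X P) {f : κ → ι} {g : κ' → ι} (hfg : ∀ k k', f k ≠ g k') :
    IndepFun (fun ω k => X (f k) ω) (fun ω k => X (g k) ω) P := by
  have hdisj : Disjoint (Set.range f) (Set.range g) := by
    rw [Set.disjoint_range_iff]
    exact hfg
  have hind := indep_iSup_of_disjoint (fun i => (hX i).comap_le) h.iIndep hdisj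
  rw [IndepFun_iff_Indep]
  exact indep_of_indep_of_le_left (indep_of_indep_of_le_right hind (comap_pi_le_iSup_range X g))
    (comap_pi_le_iSup_range X f)

end Grouping

section Regrouping

variable {Ω α β γ δ : Type*} [MeasurableSpace α] [MeasurableSpace β] [MeasurableSpace γ]
  [MeasurableSpace δ]

lemma comap_prodMk_eq_generateFrom (X : Ω → α) (Z : Ω → γ) :
    MeasurableSpace.comap (fun ω => (X ω, Z ω)) Prod.instMeasurableSpace
      = MeasurableSpace.generateFrom {s | ∃ t ∈
          Set.image2 (· ×ˢ ·) {s | MeasurableSet s} {t | MeasurableSet t},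
          (fun ω => (X ω, Z ω)) ⁻¹' t = s} := by
  rw [← generateFrom_prod, MeasurableSpace.comap_generateFrom]
  rfl

lemma indepFun_prodMk_comm [MeasurableSpace Ω] {P : Measure Ω} [IsProbabilityMeasure P]
    {X : Ω → α} {Y : Ω → β} {Z : Ω → γ} {W : Ω → δ}
    (hX : Measurable X) (hY : Measurable Y) (hZ : Measurable Z) (hW : Measurable W)
    (hXY : IndepFun X Y P) (hZW : IndepFun Z W P)
    (h : IndepFun (fun ω => (X ω, Y ω)) (fun ω => (Z ω, W ω)) P) :
    IndepFun (fun ω => (X ω, Z ω)) (fun ω => (Y ω, W ω)) P := by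
  have hrect {a b c d} (ha : MeasurableSet a) (hb : MeasurableSet b) (hc : MeasurableSet c)
      (hd : MeasurableSet d) : P (X ⁻¹' a ∩ Y ⁻¹' b ∩ (Z ⁻¹' c ∩ W ⁻¹' d))
        = P (X ⁻¹' a) * P (Y ⁻¹' b) * (P (Z ⁻¹' c) * P (W ⁻¹' d)) := by
    rw [← hXY.measure_inter_preimage_eq_mul _ _ ha hb,
      ← hZW.measure_inter_preimage_eq_mul _ _ hc hd]
    exact h.measure_inter_preimage_eq_mul _ _ (ha.prod hb) (hc.prod hd)
  rw [IndepFun_iff_Indep]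
  refine IndepSets.indep (hX.prodMk hZ).comap_le (hY.prodMk hW).comap_le
    (isPiSystem_prod.comap _) (isPiSystem_prod.comap _)
    (comap_prodMk_eq_generateFrom X Z) (comap_prodMk_eq_generateFrom Y W) ?_
  rw [IndepSets_iff]
  rintro _ _ ⟨_, ⟨a, ha, c, hc, rfl⟩, rfl⟩ ⟨_, ⟨b, hb, d, hd, rfl⟩, rfl⟩
  have hXZ := hrect ha .univ hc .univ
  have hYW := hrect .univ hb .univ hd
  simp only [Set.preimage_univ, Set.inter_univ, Set.univ_inter, measure_univ, mul_one,
    one_mul] at hXZ hYW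
  simp only [Set.mk_preimage_prod]
  rw [hXZ, hYW, Set.inter_inter_inter_comm, hrect ha hb hc hd]
  ring

end Regrouping

/-! ### The power received over one link -/

lemma measurable_linkType_select {E F : Type*} [MeasurableSpace E] [MeasurableSpace F]
    {t : E → LinkType} (ht : MeasurableSet {x | t x = los}) {f : LinkType → E → F}
    (hf : ∀ j, Measurable (f j)) : Measurable fun x => f (t x) x := by
  classical
  have hite (x : E) : f (t x) x = if t x = los then f los x else f nlos x := by
    cases t x <;> simp
  simp_rw [hite]
  exact Measurable.ite ht (hf los) (hf nlos)

lemma sum_linkType {M : Type*} [AddCommMonoid M] (f : LinkType → M) :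
    ∑ j : LinkType, f j = f los + f nlos :=
  Finset.sum_pair (by simp)

lemma sum_lobe {M : Type*} [AddCommMonoid M] (f : Lobe → M) :
    ∑ v : Lobe, f v = f .main + f .side :=
  Finset.sum_pair (by simp)

/-- Indices of the marks of a single link to an eavesdropper. -/
inductive LinkMark : Type
  | block
  | fade (j : LinkType)
  | angle
  deriving DecidableEq

/-- The mark of the link from base station `i` to eavesdropper `k`. -/
def eveMark (i k : ℕ) : LinkMark → Mark
  | .block => .eveBlock i k
  | .fade j => .eveFade j i k
  | .angle => .eveAngle i k

lemma isProbabilityMeasure_cond_Icc {a b : ℝ} (hab : a < b) :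
    IsProbabilityMeasure (cond volume (Set.Icc a b)) :=
  cond_isProbabilityMeasure_of_finite (by simp [hab]) (by simp)

lemma cond_Icc_apply (a b : ℝ) (s : Set ℝ) :
    cond volume (Set.Icc a b) s = (ENNReal.ofReal (b - a))⁻¹ * volume (Set.Icc a b ∩ s) := by
  rw [cond_apply measurableSet_Icc, Real.volume_Icc]

instance isProbabilityMeasure_markLaw (p : Params) (c : Mark) :
    IsProbabilityMeasure (markLaw p c) := by
  have hN (j : LinkType) : (0 : ℝ) < p.N j := Nat.cast_pos.2 (p.N_pos j)
  cases c
  · exact isProbabilityMeasure_cond_Icc zero_lt_one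
  · exact isProbabilityMeasure_gammaMeasure (hN _) one_pos
  · exact isProbabilityMeasure_cond_Icc zero_lt_one
  · exact isProbabilityMeasure_gammaMeasure (hN _) one_pos
  · exact isProbabilityMeasure_cond_Icc (by norm_num)

namespace Params

variable (p : Params)

/-- The law of a mark of a link to an eavesdropper; it does not depend on the link. -/
def linkLaw (c : LinkMark) : Measure ℝ := markLaw p (eveMark 0 0 c)

/-- The joint law of the marks of a link to an eavesdropper. -/
def linkMarksLaw : Measure (LinkMark → ℝ) := Measure.infinitePi p.linkLaw

/-- The type of a link of length `d` with blockage mark `b`. -/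
def linkType (d b : ℝ) : LinkType := if b < p.qLOS d then los else nlos

/-- The lobe of the antenna pattern containing the angle `θ`. -/
def lobe (θ : ℝ) : Lobe := if |θ| ≤ p.thetaB then .main else .side

/-- The power received by an eavesdropper over a link of length `d` with marks `y`. -/
def linkPower (d : ℝ) (y : LinkMark → ℝ) : ℝ :=
  p.gain (y .angle) * p.pathLoss (p.linkType d (y .block)) d
    * y (.fade (p.linkType d (y .block)))

/-- The probability that a link of length `d` is of type `j`. -/
def linkProb : LinkType → ℝ → ℝ
  | los, d => p.qLOS d
  | nlos, d => 1 - p.qLOS d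

instance isProbabilityMeasure_linkLaw (c : LinkMark) : IsProbabilityMeasure (p.linkLaw c) :=
  isProbabilityMeasure_markLaw p _

lemma linkType_eq_los_iff {d b : ℝ} : p.linkType d b = los ↔ b < p.qLOS d := by
  simp [linkType]

lemma linkType_eq_nlos_iff {d b : ℝ} : p.linkType d b = nlos ↔ p.qLOS d ≤ b := by
  simp [linkType]

lemma lobe_eq_main_iff {θ : ℝ} : p.lobe θ = .main ↔ θ ∈ Set.Icc (-p.thetaB) p.thetaB := by
  simp [lobe, abs_le]

lemma lobe_eq_side_iff {θ : ℝ} : p.lobe θ = .side ↔ θ ∉ Set.Icc (-p.thetaB) p.thetaB := by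
  simp [lobe, abs_le]

lemma lobeGain_pos (v : Lobe) : 0 < p.lobeGain v := by
  cases v
  · exact p.Ms_pos
  · exact p.ms_pos

lemma gain_eq (θ : ℝ) : p.gain θ = p.lobeGain (p.lobe θ) := by
  unfold gain lobe
  split_ifs <;> rfl

lemma lobeProb_nonneg (v : Lobe) : 0 ≤ p.lobeProb v := by
  have := p.thetaB_nonneg
  have := p.thetaB_le
  cases v
  · exact div_nonneg (by linarith) (by norm_num)
  · exact div_nonneg (by linarith) (by norm_num)

lemma sum_lobeProb : ∑ v : Lobe, p.lobeProb v = 1 := by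
  rw [sum_lobe]
  simp only [lobeProb]
  ring

lemma qLOS_nonneg (d : ℝ) : 0 ≤ p.qLOS d := by
  unfold qLOS
  split_ifs
  · exact p.C_nonneg
  · exact le_rfl

lemma qLOS_le_one (d : ℝ) : p.qLOS d ≤ 1 := by
  unfold qLOS
  split_ifs
  · exact p.C_le_one
  · exact zero_le_one

lemma linkProb_nonneg (j : LinkType) (d : ℝ) : 0 ≤ p.linkProb j d := by
  cases j
  · exact p.qLOS_nonneg d
  · exact sub_nonneg.2 (p.qLOS_le_one d)

lemma sum_linkProb (d : ℝ) : ∑ j : LinkType, p.linkProb j d = 1 := by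
  rw [sum_linkType]
  simp [linkProb]

lemma pathLoss_nonneg (j : LinkType) {d : ℝ} (hd : 0 ≤ d) : 0 ≤ p.pathLoss j d :=
  mul_nonneg (p.K_pos j).le (Real.rpow_nonneg hd _)

@[fun_prop]
lemma measurable_qLOS : Measurable p.qLOS :=
  Measurable.ite measurableSet_Iic measurable_const measurable_const

@[fun_prop]
lemma measurable_gain : Measurable p.gain :=
  Measurable.ite (measurableSet_le (by fun_prop) measurable_const) measurable_const measurable_const

@[fun_prop]
lemma measurable_pathLoss (j : LinkType) : Measurable (p.pathLoss j) := by
  unfold pathLoss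
  fun_prop

lemma measurableSet_linkType_eq (j : LinkType) :
    MeasurableSet {q : ℝ × ℝ | p.linkType q.1 q.2 = j} := by
  cases j
  · simp only [linkType_eq_los_iff]
    exact measurableSet_lt (by fun_prop) (by fun_prop)
  · simp only [linkType_eq_nlos_iff]
    exact measurableSet_le (by fun_prop) (by fun_prop)

lemma measurableSet_setOf_linkType (d : ℝ) (j : LinkType) :
    MeasurableSet {b | p.linkType d b = j} :=
  (p.measurableSet_linkType_eq j).preimage (f := fun b : ℝ => (d, b)) (by fun_prop)

lemma measurableSet_lobe (v : Lobe) : MeasurableSet {θ | p.lobe θ = v} := by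
  cases v
  · simp only [lobe_eq_main_iff]
    exact measurableSet_Icc
  · simp only [lobe_eq_side_iff]
    exact measurableSet_Icc.compl

@[fun_prop]
lemma measurable_linkPower : Measurable fun q : ℝ × (LinkMark → ℝ) => p.linkPower q.1 q.2 :=
  measurable_linkType_select (t := fun q : ℝ × (LinkMark → ℝ) => p.linkType q.1 (q.2 .block))
    (f := fun j q => p.gain (q.2 .angle) * p.pathLoss j q.1 * q.2 (.fade j))
    ((p.measurableSet_linkType_eq los).preimage
      (f := fun q : ℝ × (LinkMark → ℝ) => (q.1, q.2 .block)) (by fun_prop)) (by fun_prop)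

lemma uniform_linkType (d : ℝ) (j : LinkType) :
    cond volume (Set.Icc (0 : ℝ) 1) {b | p.linkType d b = j}
      = ENNReal.ofReal (p.linkProb j d) := by
  have h0 := p.qLOS_nonneg d
  have h1 := p.qLOS_le_one d
  rw [cond_Icc_apply]
  cases j
  · have : Set.Icc (0 : ℝ) 1 ∩ {b | p.linkType d b = los} = Set.Ico 0 (p.qLOS d) := by
      ext b
      simp only [linkType_eq_los_iff, Set.mem_inter_iff, Set.mem_Icc, Set.mem_ofPred_eq,
        Set.mem_Ico]
      exact ⟨fun h => ⟨h.1.1, h.2⟩, fun h => ⟨⟨h.1, h.2.le.trans h1⟩, h.2⟩⟩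
    rw [this]
    simp [linkProb]
  · have : Set.Icc (0 : ℝ) 1 ∩ {b | p.linkType d b = nlos} = Set.Icc (p.qLOS d) 1 := by
      ext b
      simp only [linkType_eq_nlos_iff, Set.mem_inter_iff, Set.mem_Icc, Set.mem_ofPred_eq]
      exact ⟨fun h => ⟨h.2, h.1.2⟩, fun h => ⟨⟨h0.trans h.1, h.2⟩, h.1⟩⟩
    rw [this]
    simp [linkProb]

lemma uniform_lobe_main :
    cond volume (Set.Icc (-180 : ℝ) 180) {θ | p.lobe θ = .main}
      = ENNReal.ofReal (p.lobeProb .main) := by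
  have hsub : Set.Icc (-p.thetaB) p.thetaB ⊆ Set.Icc (-180) 180 :=
    Set.Icc_subset_Icc (neg_le_neg p.thetaB_le) p.thetaB_le
  simp only [lobe_eq_main_iff, Set.ofPred_mem_eq]
  rw [cond_Icc_apply, Set.inter_eq_right.2 hsub, Real.volume_Icc,
    ← ENNReal.ofReal_inv_of_pos (by norm_num), ← ENNReal.ofReal_mul (by norm_num), lobeProb]
  congr 1
  ring

lemma uniform_lobe (v : Lobe) :
    cond volume (Set.Icc (-180 : ℝ) 180) {θ | p.lobe θ = v} = ENNReal.ofReal (p.lobeProb v) := by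
  cases v
  · exact p.uniform_lobe_main
  · have := isProbabilityMeasure_cond_Icc (show (-180 : ℝ) < 180 by norm_num)
    have hcompl : {θ | p.lobe θ = .side} = {θ | p.lobe θ = .main}ᶜ := by
      ext θ
      rw [Set.mem_compl_iff, Set.mem_ofPred_eq, Set.mem_ofPred_eq, lobe_eq_side_iff,
        lobe_eq_main_iff]
    rw [hcompl, prob_compl_eq_one_sub (p.measurableSet_lobe _), p.uniform_lobe_main,
      ← ENNReal.ofReal_one, ← ENNReal.ofReal_sub _ (p.lobeProb_nonneg _), ← p.sum_lobeProb,
      sum_lobe, add_sub_cancel_left]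

/-! ### The Laplace transform of the power received over one link -/

/-- The random variable `e^{-s W}`, with `W` the power received over a link of length `d` with
marks `y`. -/
def linkFactor (s d : ℝ) (y : LinkMark → ℝ) : ℝ≥0∞ :=
  expNeg (ENNReal.ofReal (s * p.linkPower d y))

/-- The part of `linkFactor` coming from links of type `j` in the lobe `v`, as a product of
functions of the separate marks. -/
def linkFactorPart (s d : ℝ) (j : LinkType) (v : Lobe) : LinkMark → ℝ → ℝ≥0∞
  | .block => Set.indicator {b | p.linkType d b = j} 1
  | .angle => Set.indicator {θ | p.lobe θ = v} 1
  | .fade _ => fun g => expNeg (ENNReal.ofReal (s * (p.lobeGain v * p.pathLoss j d) * g))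

/-- The Laplace transform at `s` of the power received over a link of length `d`. -/
def linkLaplace (s d : ℝ) : ℝ :=
  ∑ j : LinkType, ∑ v : Lobe, p.linkProb j d * p.lobeProb v
    * ((1 + s * (p.lobeGain v * p.pathLoss j d)) ^ p.N j)⁻¹

lemma linkFactor_le_one (s d : ℝ) (y : LinkMark → ℝ) : p.linkFactor s d y ≤ 1 :=
  expNeg_le_one _

lemma measurable_linkFactor (s : ℝ) :
    Measurable fun q : ℝ × (LinkMark → ℝ) => p.linkFactor s q.1 q.2 := by
  unfold linkFactor
  fun_prop

lemma measurable_linkFactorPart (s d : ℝ) (j : LinkType) (v : Lobe) (c : LinkMark) :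
    Measurable (p.linkFactorPart s d j v c) := by
  cases c
  · exact measurable_one.indicator (p.measurableSet_setOf_linkType d j)
  · unfold linkFactorPart
    fun_prop
  · exact measurable_one.indicator (p.measurableSet_lobe v)

lemma prod_linkFactorPart (s d : ℝ) (j : LinkType) (v : Lobe) (y : LinkMark → ℝ) :
    ∏ c ∈ ({.block, .angle, .fade j} : Finset LinkMark), p.linkFactorPart s d j v c (y c)
      = if j = p.linkType d (y .block) ∧ v = p.lobe (y .angle)
        then p.linkFactor s d y else 0 := by
  rw [Finset.prod_insert (by simp), Finset.prod_insert (by simp), Finset.prod_singleton]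
  simp only [linkFactorPart, Set.indicator_apply, Set.mem_ofPred_eq, eq_comm (b := j),
    eq_comm (b := v), Pi.one_apply]
  split_ifs <;> simp_all [linkFactor, linkPower, gain_eq, mul_assoc]

lemma linkFactor_eq_sum (s d : ℝ) (y : LinkMark → ℝ) :
    p.linkFactor s d y = ∑ j : LinkType, ∑ v : Lobe,
      ∏ c ∈ {.block, .angle, .fade j}, p.linkFactorPart s d j v c (y c) := by
  simp only [prod_linkFactorPart, ite_and, Finset.sum_ite_irrel, Finset.sum_ite_eq',
    Finset.sum_const_zero, Finset.mem_univ, if_true]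

lemma lintegral_linkFactorPart_fade {s d : ℝ} (hs : 0 ≤ s) (hd : 0 ≤ d) (j : LinkType) (v : Lobe) :
    ∫⁻ g, p.linkFactorPart s d j v (.fade j) g ∂p.linkLaw (.fade j)
      = ENNReal.ofReal (((1 + s * (p.lobeGain v * p.pathLoss j d)) ^ p.N j)⁻¹) := by
  have hnn : 0 ≤ s * (p.lobeGain v * p.pathLoss j d) :=
    mul_nonneg hs (mul_nonneg (p.lobeGain_pos v).le (p.pathLoss_nonneg j hd))
  have hlaplace := lintegral_expNeg_mul_gammaMeasure (Nat.cast_pos.2 (p.N_pos j)) one_pos hnn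
  rw [Real.rpow_natCast, one_div, inv_pow] at hlaplace
  exact hlaplace

lemma lintegral_prod_linkFactorPart {s d : ℝ} (hs : 0 ≤ s) (hd : 0 ≤ d) (j : LinkType)
    (v : Lobe) :
    ∫⁻ y, ∏ c ∈ ({.block, .angle, .fade j} : Finset LinkMark),
        p.linkFactorPart s d j v c (y c) ∂p.linkMarksLaw
      = ENNReal.ofReal (p.linkProb j d * p.lobeProb v
        * ((1 + s * (p.lobeGain v * p.pathLoss j d)) ^ p.N j)⁻¹) := by
  have hmeas := p.measurable_linkFactorPart s d j v
  have hmarginal (c : LinkMark) : ∫⁻ y, p.linkFactorPart s d j v c (y c) ∂p.linkMarksLaw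
      = ∫⁻ t, p.linkFactorPart s d j v c t ∂(p.linkLaw c) :=
    (measurePreserving_eval_infinitePi p.linkLaw c).lintegral_comp (hmeas c)
  have hblock : ∫⁻ b, p.linkFactorPart s d j v .block b ∂p.linkLaw .block
      = ENNReal.ofReal (p.linkProb j d) := by
    rw [← p.uniform_linkType d j]
    exact lintegral_indicator_one (p.measurableSet_setOf_linkType d j)
  have hangle : ∫⁻ θ, p.linkFactorPart s d j v .angle θ ∂p.linkLaw .angle
      = ENNReal.ofReal (p.lobeProb v) := by
    rw [← p.uniform_lobe v]
    exact lintegral_indicator_one (p.measurableSet_lobe v)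
  have hind : iIndepFun (fun c (y : LinkMark → ℝ) => p.linkFactorPart s d j v c (y c))
      p.linkMarksLaw := iIndepFun_infinitePi hmeas
  rw [lintegral_prod_eq_prod_lintegral_of_indepFun _ _ hind
      fun c => (hmeas c).comp (measurable_pi_apply c),
    Finset.prod_insert (by simp), Finset.prod_insert (by simp), Finset.prod_singleton,
    hmarginal, hmarginal, hmarginal, hblock, hangle, p.lintegral_linkFactorPart_fade hs hd,
    ← ENNReal.ofReal_mul (p.lobeProb_nonneg _), ← ENNReal.ofReal_mul (p.linkProb_nonneg _ _),
    mul_assoc]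

lemma lintegral_linkFactor {s d : ℝ} (hs : 0 ≤ s) (hd : 0 ≤ d) :
    ∫⁻ y, p.linkFactor s d y ∂p.linkMarksLaw = ENNReal.ofReal (p.linkLaplace s d) := by
  have hmeas (j : LinkType) (v : Lobe) : Measurable fun y : LinkMark → ℝ =>
      ∏ c ∈ ({.block, .angle, .fade j} : Finset LinkMark), p.linkFactorPart s d j v c (y c) :=
    Finset.measurable_prod _ fun c _ =>
      (p.measurable_linkFactorPart s d j v c).comp (measurable_pi_apply c)
  have hnn (j : LinkType) (v : Lobe) : 0 ≤ p.linkProb j d * p.lobeProb v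
      * ((1 + s * (p.lobeGain v * p.pathLoss j d)) ^ p.N j)⁻¹ := by
    have := p.linkProb_nonneg j d
    have := p.lobeProb_nonneg v
    have := p.pathLoss_nonneg j hd
    have := (p.lobeGain_pos v).le
    positivity
  simp_rw [p.linkFactor_eq_sum, linkLaplace]
  rw [lintegral_finsetSum _ fun j _ => Finset.measurable_sum _ fun v _ => hmeas j v,
    ENNReal.ofReal_sum_of_nonneg fun j _ => Finset.sum_nonneg fun v _ => hnn j v]
  simp_rw [lintegral_finsetSum _ fun v _ => hmeas _ v, p.lintegral_prod_linkFactorPart hs hd,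
    ENNReal.ofReal_sum_of_nonneg fun v _ => hnn _ v]

end Params

/-! ### The Laplace exponent as a radial integral -/

namespace Params

variable (p : Params) {s s' d r : ℝ}

/-- The deficit `1 - E e^{-s W}` of the Laplace transform of the power `W` received over a link of
length `d`. -/
def linkLoss (s d : ℝ) : ℝ :=
  ∑ j : LinkType, ∑ v : Lobe, p.linkProb j d * p.lobeProb v
    * (1 - ((1 + s * (p.lobeGain v * p.pathLoss j d)) ^ p.N j)⁻¹)

lemma one_sub_linkLaplace (s d : ℝ) : 1 - p.linkLaplace s d = p.linkLoss s d := by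
  unfold linkLaplace linkLoss
  simp_rw [mul_sub, mul_one, Finset.sum_sub_distrib]
  congr 1
  simp_rw [← Finset.mul_sum, p.sum_lobeProb, mul_one, p.sum_linkProb]

lemma lobeGain_mul_pathLoss_nonneg (hd : 0 ≤ d) (j : LinkType) (v : Lobe) :
    0 ≤ p.lobeGain v * p.pathLoss j d :=
  mul_nonneg (p.lobeGain_pos v).le (p.pathLoss_nonneg j hd)

lemma linkLaplace_nonneg (hs : 0 ≤ s) (hd : 0 ≤ d) : 0 ≤ p.linkLaplace s d := by
  refine Finset.sum_nonneg fun j _ => Finset.sum_nonneg fun v _ => ?_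
  have := p.linkProb_nonneg j d
  have := p.lobeProb_nonneg v
  have := p.lobeGain_mul_pathLoss_nonneg hd j v
  positivity

lemma linkLoss_mono (hs : 0 ≤ s) (hss : s ≤ s') (hd : 0 ≤ d) :
    p.linkLoss s d ≤ p.linkLoss s' d := by
  refine Finset.sum_le_sum fun j _ => Finset.sum_le_sum fun v _ =>
    mul_le_mul_of_nonneg_left ?_ (mul_nonneg (p.linkProb_nonneg j d) (p.lobeProb_nonneg v))
  have := p.lobeGain_mul_pathLoss_nonneg hd j v
  gcongr

lemma linkLoss_zero (d : ℝ) : p.linkLoss 0 d = 0 := by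
  simp [linkLoss]

lemma linkLoss_nonneg (hs : 0 ≤ s) (hd : 0 ≤ d) : 0 ≤ p.linkLoss s d :=
  (p.linkLoss_zero d).ge.trans (p.linkLoss_mono le_rfl hs hd)

lemma tendsto_linkLoss (d : ℝ) :
    Filter.Tendsto (fun s => p.linkLoss s d) (nhds 0) (nhds 0) := by
  have hcont : ContinuousAt (fun s => p.linkLoss s d) 0 := by
    unfold linkLoss
    refine tendsto_finsetSum _ fun j _ => tendsto_finsetSum _ fun v _ => ?_
    exact continuousAt_const.mul (continuousAt_const.sub
      (ContinuousAt.inv₀ (by fun_prop) (by simp)))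
  rwa [ContinuousAt, linkLoss_zero] at hcont

lemma one_sub_lintegral_linkFactor (hs : 0 ≤ s) (hd : 0 ≤ d) :
    1 - ∫⁻ y, p.linkFactor s d y ∂p.linkMarksLaw = ENNReal.ofReal (p.linkLoss s d) := by
  rw [p.lintegral_linkFactor hs hd, ← one_sub_linkLaplace,
    ENNReal.ofReal_sub _ (p.linkLaplace_nonneg hs hd), ENNReal.ofReal_one]

lemma mul_linkLoss_eq_radial (s r : ℝ) :
    r * p.linkLoss s r = ∑ j : LinkType, ∑ v : Lobe, p.linkProb j r * p.lobeProb v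
      * radial s (p.lobeGain v * p.K j) (p.α j) (p.N j) r := by
  unfold linkLoss radial pathLoss
  simp_rw [Finset.mul_sum, mul_assoc]
  refine Finset.sum_congr rfl fun j _ => Finset.sum_congr rfl fun v _ => ?_
  ring

lemma linkProb_of_le (j : LinkType) (hr : r ≤ p.D) : p.linkProb j r = p.q j := by
  cases j <;> simp [linkProb, q, qLOS, hr]

lemma qLOS_of_lt (hr : p.D < r) : p.qLOS r = 0 :=
  if_neg hr.not_ge

lemma kappa_pos (j : LinkType) (v : Lobe) : 0 < p.kappa j v :=
  div_pos (Real.rpow_pos_of_pos p.D_pos _) (mul_pos (p.lobeGain_pos v) (p.K_pos j))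

lemma integrableOn_and_integral_linkLoss_near (hs : 0 < s) :
    IntegrableOn (fun r => r * p.linkLoss s r) (Set.Ioc 0 p.D) ∧
    ∫ r in Set.Ioc 0 p.D, r * p.linkLoss s r
      = ∑ j : LinkType, ∑ v : Lobe, p.q j * p.lobeProb v
        * (s * ((p.lobeGain v * p.K j) ^ (2 / p.α j) / p.α j) * ∑ m ∈ Finset.range (p.N j),
          betaInt (m + 1) (m + 2 / p.α j) s (p.kappa j v)) := by
  have hrad (j : LinkType) (v : Lobe) := integrableOn_and_integral_radial_near hs
    (mul_pos (p.lobeGain_pos v) (p.K_pos j)) (p.α_pos j) p.D_pos (p.N j)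
  have hcongr : Set.EqOn (fun r => r * p.linkLoss s r) (fun r => ∑ j : LinkType, ∑ v : Lobe,
      p.q j * p.lobeProb v * radial s (p.lobeGain v * p.K j) (p.α j) (p.N j) r)
      (Set.Ioc 0 p.D) := fun r hr => by
    simp only [mul_linkLoss_eq_radial, p.linkProb_of_le _ hr.2]
  have hint (j : LinkType) (v : Lobe) : IntegrableOn (fun r => p.q j * p.lobeProb v
      * radial s (p.lobeGain v * p.K j) (p.α j) (p.N j) r) (Set.Ioc 0 p.D) :=
    (hrad j v).1.const_mul _
  constructor
  · exact IntegrableOn.congr_fun (integrable_finsetSum _ fun j _ =>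
      integrable_finsetSum _ fun v _ => hint j v) hcongr.symm measurableSet_Ioc
  · rw [setIntegral_congr_fun measurableSet_Ioc hcongr,
      integral_finsetSum _ fun j _ => integrable_finsetSum _ fun v _ => hint j v]
    refine Finset.sum_congr rfl fun j _ => ?_
    rw [integral_finsetSum _ fun v _ => hint j v]
    refine Finset.sum_congr rfl fun v _ => ?_
    rw [integral_const_mul, (hrad j v).2, kappa]

lemma integrableOn_and_integral_linkLoss_far (hs : 0 < s) :
    IntegrableOn (fun r => r * p.linkLoss s r) (Set.Ioi p.D) ∧
    ∫ r in Set.Ioi p.D, r * p.linkLoss s r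
      = ∑ v : Lobe, p.lobeProb v
        * (s * ((p.lobeGain v * p.K nlos) ^ (2 / p.α nlos) / p.α nlos)
          * ∑ m ∈ Finset.range (p.N nlos), (s ^ (m + 1))⁻¹
            * betaInt (m + 1) (1 - 2 / p.α nlos) s⁻¹ (p.kappa nlos v)⁻¹) := by
  have hrad (v : Lobe) := integrableOn_and_integral_radial_far hs
    (mul_pos (p.lobeGain_pos v) (p.K_pos nlos)) p.two_lt_α_nlos p.D_pos (p.N nlos)
  have hcongr : Set.EqOn (fun r => r * p.linkLoss s r) (fun r => ∑ v : Lobe,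
      p.lobeProb v * radial s (p.lobeGain v * p.K nlos) (p.α nlos) (p.N nlos) r)
      (Set.Ioi p.D) := fun r hr => by
    simp [mul_linkLoss_eq_radial, sum_linkType, linkProb, p.qLOS_of_lt hr]
  have hint (v : Lobe) : IntegrableOn (fun r => p.lobeProb v
      * radial s (p.lobeGain v * p.K nlos) (p.α nlos) (p.N nlos) r) (Set.Ioi p.D) :=
    (hrad v).1.const_mul _
  constructor
  · exact IntegrableOn.congr_fun (integrable_finsetSum _ fun v _ => hint v) hcongr.symm
      measurableSet_Ioi
  · rw [setIntegral_congr_fun measurableSet_Ioi hcongr, integral_finsetSum _ fun v _ => hint v]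
    refine Finset.sum_congr rfl fun v _ => ?_
    rw [integral_const_mul, (hrad v).2, kappa]

lemma integrableOn_linkLoss (hs : 0 < s) :
    IntegrableOn (fun r => r * p.linkLoss s r) (Set.Ioi 0) := by
  rw [← Set.Ioc_union_Ioi_eq_Ioi p.D_pos.le]
  exact (p.integrableOn_and_integral_linkLoss_near hs).1.union
    (p.integrableOn_and_integral_linkLoss_far hs).1

lemma betaInt_kappa_near (hs : 0 < s) (j : LinkType) (v : Lobe) (m : ℕ) :
    betaInt (m + 1) (m + 2 / p.α j) s (p.kappa j v)
      = p.kappa j v ^ ((m : ℝ) + 2 / p.α j)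
          / (((m : ℝ) + 2 / p.α j) * (s + p.kappa j v) ^ (m + 1))
        * ordinaryHypergeometric (1 : ℝ) ((m : ℝ) + 1) ((m : ℝ) + 2 / p.α j + 1)
            (p.kappa j v / (p.kappa j v + s)) := by
  have := p.α_pos j
  rw [betaInt_eq_hypergeometric (Nat.succ_pos m) (by positivity) hs (p.kappa_pos j v),
    add_comm (p.kappa j v) s]
  push_cast
  rfl

lemma betaInt_kappa_far (hs : 0 < s) (v : Lobe) (m : ℕ) :
    (s ^ (m + 1))⁻¹ * betaInt (m + 1) (1 - 2 / p.α nlos) s⁻¹ (p.kappa nlos v)⁻¹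
      = p.kappa nlos v ^ ((m : ℝ) + 2 / p.α nlos)
          / ((1 - 2 / p.α nlos) * (s + p.kappa nlos v) ^ (m + 1))
        * ordinaryHypergeometric (1 : ℝ) ((m : ℝ) + 1) (2 - 2 / p.α nlos)
            (s / (s + p.kappa nlos v)) := by
  have hb : 0 < 1 - 2 / p.α nlos := by
    rw [sub_pos, div_lt_one (p.α_pos _)]
    exact p.two_lt_α_nlos
  rw [betaInt_inv_eq_hypergeometric hb hs (p.kappa_pos nlos v), sub_sub_cancel,
    show 1 - 2 / p.α nlos + 1 = 2 - 2 / p.α nlos by ring]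
  push_cast
  rfl

lemma Xi_eq_neg_integral (hs : 0 < s) :
    p.Xi s = -(2 * Real.pi * p.lamE * ∫ r in Set.Ioi 0, r * p.linkLoss s r) := by
  obtain ⟨hint_near, hnear⟩ := p.integrableOn_and_integral_linkLoss_near hs
  obtain ⟨hint_far, hfar⟩ := p.integrableOn_and_integral_linkLoss_far hs
  rw [← Set.Ioc_union_Ioi_eq_Ioi p.D_pos.le,
    setIntegral_union (by simp) measurableSet_Ioi hint_near hint_far, hnear, hfar]
  simp_rw [p.betaInt_kappa_near hs, p.betaInt_kappa_far hs, Xi]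
  simp only [sum_linkType, sum_lobe]
  ring

lemma Xi_nonpos (hs : 0 < s) : p.Xi s ≤ 0 := by
  have hint : 0 ≤ ∫ r in Set.Ioi 0, r * p.linkLoss s r :=
    setIntegral_nonneg measurableSet_Ioi fun r hr =>
      mul_nonneg (le_of_lt hr) (p.linkLoss_nonneg hs.le (le_of_lt hr))
  have := p.lamE_pos
  rw [p.Xi_eq_neg_integral hs, neg_nonpos]
  positivity

lemma Xi_antitoneOn : AntitoneOn p.Xi (Set.Ioi 0) := fun s hs s' hs' hss => by
  have hint : ∫ r in Set.Ioi 0, r * p.linkLoss s r ≤ ∫ r in Set.Ioi 0, r * p.linkLoss s' r :=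
    setIntegral_mono_on (p.integrableOn_linkLoss hs) (p.integrableOn_linkLoss hs')
      measurableSet_Ioi fun r hr => mul_le_mul_of_nonneg_left
        (p.linkLoss_mono (le_of_lt hs) hss (le_of_lt hr)) (le_of_lt hr)
  have := p.lamE_pos
  rw [p.Xi_eq_neg_integral hs, p.Xi_eq_neg_integral hs', neg_le_neg_iff]
  gcongr

lemma tendsto_Xi : Filter.Tendsto p.Xi (nhdsWithin 0 (Set.Ioi 0)) (nhds 0) := by
  have hlim : Filter.Tendsto (fun s => ∫ r in Set.Ioi 0, r * p.linkLoss s r)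
      (nhdsWithin 0 (Set.Ioi 0)) (nhds (∫ _ in Set.Ioi (0 : ℝ), (0 : ℝ))) := by
    refine tendsto_integral_filter_of_dominated_convergence (fun r => r * p.linkLoss 1 r)
      ?_ ?_ (p.integrableOn_linkLoss one_pos) (ae_of_all _ ?_)
    · filter_upwards [self_mem_nhdsWithin] with s hs
      exact (p.integrableOn_linkLoss hs).aestronglyMeasurable
    · filter_upwards [Ioo_mem_nhdsGT one_pos] with s hs
      filter_upwards [ae_restrict_mem measurableSet_Ioi] with r hr
      have hr0 : (0 : ℝ) ≤ r := le_of_lt hr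
      rw [Real.norm_of_nonneg (mul_nonneg hr0 (p.linkLoss_nonneg hs.1.le hr0))]
      exact mul_le_mul_of_nonneg_left (p.linkLoss_mono hs.1.le hs.2.le hr0) hr0
    · intro r
      simpa using ((p.tendsto_linkLoss r).mono_left nhdsWithin_le_nhds).const_mul r
  have hXi := (hlim.const_mul (2 * Real.pi * p.lamE)).neg
  rw [integral_zero, mul_zero, neg_zero] at hXi
  refine hXi.congr' ?_
  filter_upwards [self_mem_nhdsWithin] with s hs
  exact (p.Xi_eq_neg_integral hs).symm

lemma laplaceIE_le_one (hs : 0 < s) : p.laplaceIE s ≤ 1 :=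
  Real.exp_le_one_iff.2 (p.Xi_nonpos hs)

lemma laplaceIE_pos (s : ℝ) : 0 < p.laplaceIE s := Real.exp_pos _

lemma laplaceIE_zero : p.laplaceIE 0 = 1 := by
  simp [laplaceIE, Xi]

lemma laplaceIE_antitoneOn : AntitoneOn p.laplaceIE (Set.Ici 0) := by
  intro s hs s' _ h
  rcases (Set.mem_Ici.1 hs).eq_or_lt with rfl | hs
  · rcases h.eq_or_lt with rfl | hs'
    · rfl
    · exact p.laplaceIE_zero ▸ p.laplaceIE_le_one hs'
  · exact Real.exp_monotone (p.Xi_antitoneOn hs (hs.trans_le h) h)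

lemma lintegral_linkLoss_plane (hs : 0 < s) (x : Plane) :
    ∫⁻ z : Plane, ENNReal.ofReal (p.linkLoss s ‖x - z‖) ∂(ENNReal.ofReal p.lamE • volume)
      = ENNReal.ofReal (-p.Xi s) := by
  have hdim : Module.finrank ℝ Plane = 2 := by simp
  have hint : Integrable (fun z : Plane => p.linkLoss s ‖z‖) := by
    rw [integrable_fun_norm_addHaar, hdim]
    simpa using p.integrableOn_linkLoss hs
  have hball : (volume : Measure Plane).real (Metric.ball 0 1) = Real.pi := by
    simp [Measure.real, EuclideanSpace.volume_ball_fin_two, Real.pi_pos.le]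
  rw [lintegral_smul_measure,
    lintegral_sub_left_eq_self (fun z : Plane => ENNReal.ofReal (p.linkLoss s ‖z‖)) x,
    ← ofReal_integral_eq_lintegral_ofReal hint
      (ae_of_all _ fun z => p.linkLoss_nonneg hs.le (norm_nonneg z)),
    integral_fun_norm_addHaar, hdim, smul_eq_mul, ← ENNReal.ofReal_mul p.lamE_pos.le,
    p.Xi_eq_neg_integral hs, neg_neg]
  simp only [hball, smul_eq_mul, nsmul_eq_mul, Nat.add_one_sub_one, pow_one, Nat.cast_ofNat]
  congr 1
  ring

lemma lintegral_one_sub_linkFactor (hs : 0 < s) (x : Plane) :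
    ∫⁻ z : Plane, (1 - ∫⁻ y, p.linkFactor s ‖x - z‖ y ∂p.linkMarksLaw)
        ∂(ENNReal.ofReal p.lamE • volume) = ENNReal.ofReal (-p.Xi s) := by
  simp_rw [p.one_sub_lintegral_linkFactor hs.le (norm_nonneg _)]
  exact p.lintegral_linkLoss_plane hs x

end Params

/-! ### The Laplace transform of the total power received from a fixed position -/

namespace Params

variable (p : Params)

/-- The total power received at the points `z k` from a base station at `x`, when the link to
`z k` has the marks `y k`. -/
def totalPower (x : Plane) (z : ℕ → Plane) (y : ℕ → LinkMark → ℝ) : ℝ≥0∞ :=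
  ∑' k, ENNReal.ofReal (p.linkPower ‖x - z k‖ (y k))

lemma measurable_totalPower :
    Measurable fun q : Plane × (ℕ → Plane) × (ℕ → LinkMark → ℝ) =>
      p.totalPower q.1 q.2.1 q.2.2 := by
  unfold totalPower
  refine Measurable.tsum fun k => Measurable.ennreal_ofReal ?_
  exact p.measurable_linkPower.comp
    (f := fun q : Plane × (ℕ → Plane) × (ℕ → LinkMark → ℝ) => (‖q.1 - q.2.1 k‖, q.2.2 k))
    (by fun_prop)

lemma tprod_linkFactor {s : ℝ} (hs : 0 ≤ s) (x : Plane) (z : ℕ → Plane)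
    (y : ℕ → LinkMark → ℝ) :
    ∏' k, p.linkFactor s ‖x - z k‖ (y k) = expNeg (ENNReal.ofReal s * p.totalPower x z y) := by
  simp only [linkFactor, tprod_expNeg, ENNReal.ofReal_mul hs, ENNReal.tsum_mul_left, totalPower]

end Params

lemma eveMark_injective (i : ℕ) :
    Function.Injective fun q : (_ : ℕ) × LinkMark => eveMark i q.1 q.2 := by
  rintro ⟨k, c⟩ ⟨k', c'⟩ h
  cases c <;> cases c' <;> simp_all [eveMark]

lemma markLaw_eveMark (p : Params) (i k : ℕ) (c : LinkMark) :
    markLaw p (eveMark i k c) = p.linkLaw c := by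
  cases c <;> rfl

namespace Network

variable {p : Params} {Ω : Type*} [MeasurableSpace Ω] {P : Measure Ω} (net : Network p P)

/-- The marks of the links from base station `i` to the eavesdroppers. -/
def eveMarks (i : ℕ) (ω : Ω) (k : ℕ) (c : LinkMark) : ℝ := net.mark (eveMark i k c) ω

lemma powerE_eq (ω : Ω) : net.powerE ω = p.totalPower (net.bs (net.serving ω) ω)
    (fun k => net.eve k ω) (net.eveMarks (net.serving ω) ω) := rfl

lemma iIndepFun_eveMarks (i : ℕ) : iIndepFun (fun k ω => net.eveMarks i ω k) P :=
  iIndepFun_curry (X := fun k c ω => net.mark (eveMark i k c) ω)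
    (fun _ _ => net.mark_measurable _) (net.mark_indep.precomp (eveMark_injective i))

lemma measurable_eveMarks (i : ℕ) : Measurable (net.eveMarks i) :=
  measurable_pi_lambda _ fun _ => measurable_pi_lambda _ fun _ => net.mark_measurable _

lemma hasLaw_eveMarks (i k : ℕ) : HasLaw (fun ω => net.eveMarks i ω k) p.linkMarksLaw P :=
  (net.mark_indep.precomp (g := eveMark i k) fun c c' h => by
      simpa using eveMark_injective i (a₁ := ⟨k, c⟩) (a₂ := ⟨k, c'⟩) h).hasLaw_infinitePi
    (fun c => markLaw_eveMark p i k c ▸ net.mark_law (eveMark i k c))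
    (measurable_pi_lambda _ fun c => net.mark_measurable _).aemeasurable

lemma indepFun_eve_eveMarks (i : ℕ) :
    IndepFun (fun ω k => net.eve k ω) (net.eveMarks i) P :=
  net.points_indep_mark.comp (φ := Prod.snd)
    (ψ := fun m : Mark → ℝ => fun k c => m (eveMark i k c)) measurable_snd (by fun_prop)

lemma lintegral_expNeg_totalPower [IsProbabilityMeasure P] (i : ℕ) (x : Plane) {s : ℝ}
    (hs : 0 < s) :
    ∫⁻ ω, expNeg (ENNReal.ofReal s
        * p.totalPower x (fun k => net.eve k ω) (net.eveMarks i ω)) ∂P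
      = ENNReal.ofReal (p.laplaceIE s) := by
  have hmeas : Measurable (Function.uncurry fun (z : Plane) (y : LinkMark → ℝ) =>
      p.linkFactor s ‖x - z‖ y) :=
    (p.measurable_linkFactor s).comp
      (f := fun q : Plane × (LinkMark → ℝ) => (‖x - q.1‖, q.2)) (by fun_prop)
  have hpgf := net.eve_poisson.lintegral_pgf_marked
    (Y := fun k ω => net.eveMarks i ω k)
    (fun k => (measurable_pi_apply k).comp (net.measurable_eveMarks i))
    (net.indepFun_eve_eveMarks i) (net.iIndepFun_eveMarks i) (net.hasLaw_eveMarks i) hmeas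
    (fun z y => p.linkFactor_le_one s _ _)
    (by rw [p.lintegral_one_sub_linkFactor hs x]; exact ENNReal.ofReal_ne_top)
  simp_rw [← p.tprod_linkFactor hs.le]
  rw [hpgf, p.lintegral_one_sub_linkFactor hs x,
    expNeg_ofReal (neg_nonneg.2 (p.Xi_nonpos hs)), neg_neg, Params.laplaceIE]

end Network

/-! ### The nearest base station of each type -/

/-- The other link type. -/
def LinkType.other : LinkType → LinkType
  | los => nlos
  | nlos => los

lemma forall_linkType_iff_other (j : LinkType) {q : LinkType → Prop} :
    (∀ k, q k) ↔ q j ∧ q j.other := by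
  refine ⟨fun h => ⟨h j, h j.other⟩, fun h k => ?_⟩
  cases j <;> cases k
  exacts [h.1, h.2, h.2, h.1]

lemma sum_linkType_other (j : LinkType) (f : LinkType → ℝ) : ∑ k, f k = f j + f j.other := by
  cases j
  · exact sum_linkType f
  · rw [sum_linkType, add_comm]
    rfl

lemma volume_plane_closedBall {r : ℝ} (hr : 0 ≤ r) :
    volume (Metric.closedBall (0 : Plane) r) = ENNReal.ofReal (Real.pi * r ^ 2) := by
  rw [EuclideanSpace.volume_closedBall_fin_two, mul_comm Real.pi,
    ENNReal.ofReal_mul (by positivity), ← ENNReal.ofReal_pow hr, ← NNReal.coe_real_pi,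
    ENNReal.ofReal_coe_nnreal]

lemma volume_plane_ball {r : ℝ} (hr : 0 ≤ r) :
    volume (Metric.ball (0 : Plane) r) = ENNReal.ofReal (Real.pi * r ^ 2) := by
  rw [← volume_plane_closedBall hr, Measure.addHaar_closedBall_eq_addHaar_ball]

lemma volume_plane_ball_inter_closedBall {u d : ℝ} (hu : 0 ≤ u) (hd : 0 ≤ d) :
    volume (Metric.ball (0 : Plane) u ∩ Metric.closedBall 0 d)
      = ENNReal.ofReal (Real.pi * min u d ^ 2) := by
  have hmin : 0 ≤ min u d := le_min hu hd
  refine le_antisymm ?_ ?_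
  · rw [← volume_plane_closedBall hmin]
    refine measure_mono fun x hx => ?_
    simp only [Set.mem_inter_iff, mem_ball_zero_iff, mem_closedBall_zero_iff, le_min_iff] at hx ⊢
    exact ⟨hx.1.le, hx.2⟩
  · rw [← volume_plane_ball hmin]
    refine measure_mono fun x hx => ?_
    simp only [Set.mem_inter_iff, mem_ball_zero_iff, mem_closedBall_zero_iff, lt_min_iff] at hx ⊢
    exact ⟨hx.1, hx.2.le⟩

namespace Params

variable (p : Params)

/-- The probability that a link longer than `D` is of type `j`. -/
def qFar : LinkType → ℝ
  | los => 0
  | nlos => 1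

lemma linkProb_of_lt (j : LinkType) {r : ℝ} (hr : p.D < r) : p.linkProb j r = qFar j := by
  cases j
  · exact p.qLOS_of_lt hr
  · simp only [linkProb, p.qLOS_of_lt hr, qFar, sub_zero]

lemma q_nonneg (j : LinkType) : 0 ≤ p.q j := by
  rw [← p.linkProb_of_le j le_rfl]
  exact p.linkProb_nonneg j _

lemma qFar_nonneg (j : LinkType) : 0 ≤ qFar j := by
  cases j
  · exact le_rfl
  · exact zero_le_one

/-- The mean number of base stations of type `j` at distance less than `u` from the origin. -/
def meanBS (j : LinkType) (u : ℝ) : ℝ :=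
  Real.pi * p.lamB * (p.q j * min u p.D ^ 2 + qFar j * (u ^ 2 - min u p.D ^ 2))

lemma meanBS_of_le (j : LinkType) {u : ℝ} (hu : u ≤ p.D) :
    p.meanBS j u = Real.pi * p.lamB * (p.q j * u ^ 2) := by
  rw [meanBS, min_eq_left hu, sub_self, mul_zero, add_zero]

lemma meanBS_of_ge (j : LinkType) {u : ℝ} (hu : p.D ≤ u) :
    p.meanBS j u = Real.pi * p.lamB * (p.q j * p.D ^ 2 + qFar j * (u ^ 2 - p.D ^ 2)) := by
  rw [meanBS, min_eq_right hu]

lemma meanBS_zero (j : LinkType) : p.meanBS j 0 = 0 := by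
  simp [p.meanBS_of_le j p.D_pos.le]

lemma sq_min_D_le_sq {u : ℝ} (hu : 0 ≤ u) : min u p.D ^ 2 ≤ u ^ 2 :=
  pow_le_pow_left₀ (le_min hu p.D_pos.le) (min_le_left _ _) 2

lemma meanBS_nonneg (j : LinkType) {u : ℝ} (hu : 0 ≤ u) : 0 ≤ p.meanBS j u := by
  have := p.q_nonneg j
  have := qFar_nonneg j
  have := p.lamB_pos
  have := sub_nonneg.2 (p.sq_min_D_le_sq hu)
  unfold meanBS
  positivity

@[fun_prop]
lemma continuous_meanBS (j : LinkType) : Continuous (p.meanBS j) := by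
  unfold meanBS
  fun_prop

@[fun_prop]
lemma measurable_linkProb (j : LinkType) : Measurable (p.linkProb j) := by
  cases j
  · exact p.measurable_qLOS
  · exact measurable_const.sub p.measurable_qLOS

lemma setLIntegral_linkProb_ball (j : LinkType) {u : ℝ} (hu : 0 ≤ u) :
    ∫⁻ x in Metric.ball (0 : Plane) u, ENNReal.ofReal (p.linkProb j ‖x‖)
      = ENNReal.ofReal (Real.pi * (p.q j * min u p.D ^ 2 + qFar j * (u ^ 2 - min u p.D ^ 2))) := by
  have hq := p.q_nonneg j
  have hqFar := qFar_nonneg j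
  have hfar := sub_nonneg.2 (p.sq_min_D_le_sq hu)
  have hnear : ∫⁻ x in Metric.ball (0 : Plane) u ∩ Metric.closedBall 0 p.D,
      ENNReal.ofReal (p.linkProb j ‖x‖)
        = ENNReal.ofReal (p.q j) * ENNReal.ofReal (Real.pi * min u p.D ^ 2) := by
    rw [← volume_plane_ball_inter_closedBall hu p.D_pos.le, ← setLIntegral_const]
    refine setLIntegral_congr_fun (measurableSet_ball.inter measurableSet_closedBall) fun x hx => ?_
    simp only [p.linkProb_of_le j (mem_closedBall_zero_iff.1 hx.2)]
  have hrest : ∫⁻ x in Metric.ball (0 : Plane) u \ Metric.closedBall 0 p.D,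
      ENNReal.ofReal (p.linkProb j ‖x‖)
        = ENNReal.ofReal (qFar j) * ENNReal.ofReal (Real.pi * (u ^ 2 - min u p.D ^ 2)) := by
    rw [mul_sub, ENNReal.ofReal_sub _ (by positivity), ← volume_plane_ball hu,
      ← volume_plane_ball_inter_closedBall hu p.D_pos.le,
      ← measure_sdiff Set.inter_subset_left
        (measurableSet_ball.inter measurableSet_closedBall).nullMeasurableSet
        (measure_inter_lt_top_of_left_ne_top measure_ball_lt_top.ne).ne,
      Set.sdiff_self_inter, ← setLIntegral_const]
    refine setLIntegral_congr_fun (measurableSet_ball.diff measurableSet_closedBall) fun x hx => ?_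
    simp only [p.linkProb_of_lt j (not_le.1 fun h => hx.2 (mem_closedBall_zero_iff.2 h))]
  rw [← lintegral_inter_add_sdiff _ _ measurableSet_closedBall, hnear, hrest,
    ← ENNReal.ofReal_mul hq, ← ENNReal.ofReal_mul hqFar,
    ← ENNReal.ofReal_add (by positivity) (by positivity)]
  congr 1
  ring

lemma lintegral_linkProb_ball (j : LinkType) {u : ℝ} (hu : 0 ≤ u) :
    ∫⁻ x : Plane, (Metric.ball (0 : Plane) u).indicator
        (fun x => ENNReal.ofReal (p.linkProb j ‖x‖)) x ∂(ENNReal.ofReal p.lamB • volume)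
      = ENNReal.ofReal (p.meanBS j u) := by
  rw [lintegral_smul_measure, smul_eq_mul, lintegral_indicator measurableSet_ball,
    p.setLIntegral_linkProb_ball j hu, ← ENNReal.ofReal_mul p.lamB_pos.le, meanBS]
  congr 1
  ring

/-- The marked points at distance at least `u j` from the origin, where `j` is the type of their
link to the origin. -/
def farMarks (u : LinkType → ℝ) : Set (Plane × ℝ) :=
  {q | u (p.linkType ‖q.1‖ q.2) ≤ ‖q.1‖}

lemma measurableSet_farMarks (u : LinkType → ℝ) : MeasurableSet (p.farMarks u) := by
  have hfar : p.farMarks u = ⋃ j : LinkType, {q : Plane × ℝ | p.linkType ‖q.1‖ q.2 = j}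
      ∩ {q : Plane × ℝ | u j ≤ ‖q.1‖} := by
    ext q
    simp [farMarks]
  rw [hfar]
  refine MeasurableSet.iUnion fun j => MeasurableSet.inter ?_ ?_
  · exact (p.measurableSet_linkType_eq j).preimage
      (f := fun q : Plane × ℝ => (‖q.1‖, q.2)) (by fun_prop)
  · exact measurableSet_le measurable_const (by fun_prop)

lemma one_sub_lintegral_farMarks (u : LinkType → ℝ) (x : Plane) :
    1 - ∫⁻ b, (p.farMarks u).indicator 1 (x, b) ∂(cond volume (Set.Icc (0 : ℝ) 1))
      = ∑ j, (Metric.ball (0 : Plane) (u j)).indicator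
        (fun x => ENNReal.ofReal (p.linkProb j ‖x‖)) x := by
  have : IsProbabilityMeasure (cond volume (Set.Icc (0 : ℝ) 1)) :=
    isProbabilityMeasure_cond_Icc zero_lt_one
  have hfar : MeasurableSet {b | (x, b) ∈ p.farMarks u} :=
    (p.measurableSet_farMarks u).preimage measurable_prodMk_left
  have hcompl : {b | (x, b) ∈ p.farMarks u}ᶜ
      = ⋃ j : LinkType, {b | p.linkType ‖x‖ b = j ∧ ‖x‖ < u j} := by
    ext b
    simp [farMarks]
  have hint : ∫⁻ b, (p.farMarks u).indicator 1 (x, b) ∂(cond volume (Set.Icc (0 : ℝ) 1))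
      = cond volume (Set.Icc (0 : ℝ) 1) {b | (x, b) ∈ p.farMarks u} := lintegral_indicator_one hfar
  rw [hint, ← prob_compl_eq_one_sub hfar, hcompl, measure_iUnion, tsum_fintype]
  · refine Finset.sum_congr rfl fun j _ => ?_
    by_cases hx : ‖x‖ < u j
    · rw [Set.indicator_of_mem (mem_ball_zero_iff.2 hx), ← p.uniform_linkType]
      simp [hx]
    · rw [Set.indicator_of_notMem (by rwa [mem_ball_zero_iff])]
      simp [hx]
  · intro j j' hjj'
    rw [Function.onFun, Set.disjoint_left]
    rintro b ⟨rfl, _⟩ ⟨h, _⟩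
    exact hjj' h
  · intro j
    by_cases hx : ‖x‖ < u j
    · simpa [hx] using p.measurableSet_setOf_linkType ‖x‖ j
    · simp [hx]

lemma lintegral_one_sub_farMarks {u : LinkType → ℝ} (hu : ∀ j, 0 ≤ u j) :
    ∫⁻ x, (1 - ∫⁻ b, (p.farMarks u).indicator 1 (x, b) ∂(cond volume (Set.Icc (0 : ℝ) 1)))
      ∂(ENNReal.ofReal p.lamB • (volume : Measure Plane))
      = ENNReal.ofReal (∑ j, p.meanBS j (u j)) := by
  simp_rw [p.one_sub_lintegral_farMarks]
  rw [lintegral_finsetSum _ fun j _ => Measurable.indicator (by fun_prop) measurableSet_ball,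
    ENNReal.ofReal_sum_of_nonneg fun j _ => p.meanBS_nonneg j (hu j)]
  exact Finset.sum_congr rfl fun j _ => p.lintegral_linkProb_ball j (hu j)

/-- The density of the distance to the nearest base station of type `j`. -/
def nearestDensity (j : LinkType) (r : ℝ) : ℝ :=
  2 * Real.pi * p.lamB * r * p.linkProb j r * Real.exp (-p.meanBS j r)

lemma nearestDensity_nonneg (j : LinkType) {r : ℝ} (hr : 0 ≤ r) : 0 ≤ p.nearestDensity j r := by
  have := p.linkProb_nonneg j r
  have := p.lamB_pos
  unfold nearestDensity
  positivity

@[fun_prop]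
lemma measurable_nearestDensity (j : LinkType) : Measurable (p.nearestDensity j) := by
  unfold nearestDensity
  fun_prop

lemma linkProb_le_one (j : LinkType) (r : ℝ) : p.linkProb j r ≤ 1 := by
  cases j
  · exact p.qLOS_le_one r
  · exact sub_le_self 1 (p.qLOS_nonneg r)

lemma hasDerivAt_meanBS (j : LinkType) {r : ℝ} (hr : r ≠ p.D) :
    HasDerivAt (p.meanBS j) (2 * Real.pi * p.lamB * r * p.linkProb j r) r := by
  rcases lt_or_gt_of_ne hr with h | h
  · have hnear : HasDerivAt (fun u : ℝ => Real.pi * p.lamB * (p.q j * u ^ 2))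
        (2 * Real.pi * p.lamB * r * p.linkProb j r) r := by
      rw [p.linkProb_of_le j h.le]
      convert! ((hasDerivAt_pow 2 r).const_mul (p.q j)).const_mul (Real.pi * p.lamB) using 1
      push_cast
      ring
    refine hnear.congr_of_eventuallyEq ?_
    filter_upwards [eventually_lt_nhds h] with u hu using p.meanBS_of_le j hu.le
  · have hfar : HasDerivAt (fun u : ℝ => Real.pi * p.lamB *
        (p.q j * p.D ^ 2 + qFar j * (u ^ 2 - p.D ^ 2)))
        (2 * Real.pi * p.lamB * r * p.linkProb j r) r := by
      rw [p.linkProb_of_lt j h]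
      convert! ((((hasDerivAt_pow 2 r).sub_const (p.D ^ 2)).const_mul (qFar j)).const_add
        (p.q j * p.D ^ 2)).const_mul (Real.pi * p.lamB) using 1
      push_cast
      ring
    refine hfar.congr_of_eventuallyEq ?_
    filter_upwards [eventually_gt_nhds h] with u hu using p.meanBS_of_ge j hu.le

lemma hasDerivAt_neg_exp_neg_meanBS (j : LinkType) {r : ℝ} (hr : r ≠ p.D) :
    HasDerivAt (fun r => -Real.exp (-p.meanBS j r)) (p.nearestDensity j r) r := by
  convert! (p.hasDerivAt_meanBS j hr).neg.exp.neg using 1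
  simp only [nearestDensity, Pi.neg_apply]
  ring

lemma intervalIntegrable_nearestDensity (j : LinkType) (a b : ℝ) :
    IntervalIntegrable (p.nearestDensity j) volume a b := by
  have hcont : Continuous fun r => 2 * Real.pi * p.lamB * r * Real.exp (-p.meanBS j r) := by
    fun_prop
  refine (hcont.intervalIntegrable a b).mono_fun
    (p.measurable_nearestDensity j).aestronglyMeasurable (ae_of_all _ fun r => ?_)
  simp only [nearestDensity]
  rw [mul_right_comm, norm_mul, Real.norm_of_nonneg (p.linkProb_nonneg j r)]
  exact mul_le_of_le_one_right (norm_nonneg _) (p.linkProb_le_one j r)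

lemma lintegral_nearestDensity (j : LinkType) {a b : ℝ} (ha : 0 ≤ a) (hab : a ≤ b) :
    ∫⁻ r in Set.Ico a b, ENNReal.ofReal (p.nearestDensity j r)
      = ENNReal.ofReal (Real.exp (-p.meanBS j a) - Real.exp (-p.meanBS j b)) := by
  have hint := p.intervalIntegrable_nearestDensity j a b
  have hftc := MeasureTheory.integral_eq_of_hasDerivAt_off_countable_of_le
    (fun r => -Real.exp (-p.meanBS j r)) (p.nearestDensity j) hab (Set.countable_singleton p.D)
    (by fun_prop) (fun r hr => p.hasDerivAt_neg_exp_neg_meanBS j hr.2) hint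
  rw [setLIntegral_congr Ico_ae_eq_Ioc, ← ofReal_integral_eq_lintegral_ofReal
    ((intervalIntegrable_iff_integrableOn_Ioc_of_le hab).1 hint),
    ← intervalIntegral.integral_of_le hab, hftc]
  · congr 1
    ring
  · filter_upwards [ae_restrict_mem measurableSet_Ioc] with r hr
    exact p.nearestDensity_nonneg j (ha.trans hr.1.le)

end Params

lemma ennreal_measurableSpace_eq_generateFrom_Ici_ofReal :
    ENNReal.measurableSpace
      = MeasurableSpace.generateFrom {s | ∃ u : ℝ, 0 ≤ u ∧ Set.Ici (ENNReal.ofReal u) = s} := by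
  refine le_antisymm ?_ (MeasurableSpace.generateFrom_le ?_)
  · rw [BorelSpace.measurable_eq (α := ℝ≥0∞), borel_eq_generateFrom_Ici]
    refine MeasurableSpace.generateFrom_le ?_
    rintro _ ⟨u, rfl⟩
    have hIci (u : ℝ) (hu : 0 ≤ u) : MeasurableSet[MeasurableSpace.generateFrom
        {s | ∃ u : ℝ, 0 ≤ u ∧ Set.Ici (ENNReal.ofReal u) = s}] (Set.Ici (ENNReal.ofReal u)) :=
      MeasurableSpace.measurableSet_generateFrom ⟨u, hu, rfl⟩
    rcases eq_or_ne u ∞ with rfl | hu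
    · have htop : Set.Ici (∞ : ℝ≥0∞) = ⋂ n : ℕ, Set.Ici (ENNReal.ofReal n) := by
        ext x
        simp only [Set.Ici_top, Set.mem_singleton_iff, Set.mem_iInter, Set.mem_Ici,
          ENNReal.ofReal_natCast]
        exact ⟨fun h n => h ▸ le_top, fun h => ENNReal.eq_top_of_forall_nnreal_le fun r =>
          (ENNReal.coe_le_coe.2 (Nat.le_ceil r)).trans (by simpa using h ⌈r⌉₊)⟩
      rw [htop]
      exact MeasurableSet.iInter fun n => hIci n (Nat.cast_nonneg n)
    · rw [← ENNReal.ofReal_toReal hu]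
      exact hIci _ ENNReal.toReal_nonneg
  · rintro _ ⟨u, _, rfl⟩
    exact measurableSet_Ici

lemma isPiSystem_Ici_ofReal :
    IsPiSystem {s : Set ℝ≥0∞ | ∃ u : ℝ, 0 ≤ u ∧ Set.Ici (ENNReal.ofReal u) = s} := by
  rintro _ ⟨u, hu, rfl⟩ _ ⟨v, _, rfl⟩ _
  exact ⟨max u v, le_max_of_le_left hu, by rw [Set.Ici_inter_Ici, ENNReal.ofReal_max]⟩

namespace Network

variable {p : Params} {Ω : Type*} [MeasurableSpace Ω] {P : Measure Ω} (net : Network p P)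

lemma userLink_eq (i : ℕ) (ω : Ω) :
    net.userLink i ω = p.linkType ‖net.bs i ω‖ (net.mark (.userBlock i) ω) := rfl

open Classical in
/-- The distance to the nearest base station of type `j` (`∞` if there is none). -/
def nearest (j : LinkType) (ω : Ω) : ℝ≥0∞ :=
  ⨅ i, if net.userLink i ω = j then ‖net.bs i ω‖ₑ else ∞

lemma le_nearest_iff (j : LinkType) (ω : Ω) (u : ℝ≥0∞) :
    u ≤ net.nearest j ω ↔ ∀ i, net.userLink i ω = j → u ≤ ‖net.bs i ω‖ₑ := by
  unfold nearest
  rw [le_iInf_iff]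
  refine forall_congr' fun i => ?_
  split_ifs with h <;> simp [h]

lemma measurableSet_userLink_eq (i : ℕ) (j : LinkType) :
    MeasurableSet {ω | net.userLink i ω = j} :=
  (p.measurableSet_linkType_eq j).preimage
    (f := fun ω => (‖net.bs i ω‖, net.mark (.userBlock i) ω))
    ((net.bs_poisson.measurable i).norm.prodMk (net.mark_measurable _))

@[fun_prop]
lemma measurable_nearest (j : LinkType) : Measurable (net.nearest j) :=
  Measurable.iInf fun i => Measurable.ite (net.measurableSet_userLink_eq i j)
    (net.bs_poisson.measurable i).enorm measurable_const

lemma setOf_le_nearest_eq (u : LinkType → ℝ) :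
    {ω | ∀ j, ENNReal.ofReal (u j) ≤ net.nearest j ω}
      = {ω | ∀ i, (net.bs i ω, net.mark (.userBlock i) ω) ∈ p.farMarks u} := by
  ext ω
  simp only [Set.mem_ofPred_eq, le_nearest_iff, userLink_eq, Params.farMarks, ← ofReal_norm,
    ENNReal.ofReal_le_ofReal_iff (norm_nonneg _)]
  exact ⟨fun h i => h _ i rfl, fun h j i hij => hij ▸ h i⟩

lemma measurableSet_le_nearest (u : LinkType → ℝ) :
    MeasurableSet {ω | ∀ j, ENNReal.ofReal (u j) ≤ net.nearest j ω} := by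
  rw [Set.ofPred_forall]
  exact MeasurableSet.iInter fun j => measurableSet_le measurable_const (net.measurable_nearest j)

lemma measure_forall_le_nearest [IsProbabilityMeasure P] {u : LinkType → ℝ} (hu : ∀ j, 0 ≤ u j) :
    P {ω | ∀ j, ENNReal.ofReal (u j) ≤ net.nearest j ω}
      = ENNReal.ofReal (Real.exp (-∑ j, p.meanBS j (u j))) := by
  have hmark : iIndepFun (fun i => net.mark (.userBlock i)) P :=
    net.mark_indep.precomp (g := Mark.userBlock) fun i i' h => by simpa using h
  have hbsmark : IndepFun (fun ω i => net.bs i ω) (fun ω i => net.mark (.userBlock i) ω) P :=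
    net.points_indep_mark.comp (φ := Prod.fst)
      (ψ := fun m : Mark → ℝ => fun i => m (.userBlock i)) measurable_fst (by fun_prop)
  have hpgf := net.bs_poisson.lintegral_pgf_marked (Y := fun i => net.mark (.userBlock i))
    (ν := cond volume (Set.Icc (0 : ℝ) 1)) (φ := fun x b => (p.farMarks u).indicator 1 (x, b))
    (fun i => net.mark_measurable _) hbsmark hmark (fun i => net.mark_law (.userBlock i))
    (measurable_one.indicator (p.measurableSet_farMarks u))
    (fun x b => Set.indicator_le_self' (fun _ _ => zero_le) _)
    (by rw [p.lintegral_one_sub_farMarks hu]; exact ENNReal.ofReal_ne_top)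
  rw [p.lintegral_one_sub_farMarks hu,
    expNeg_ofReal (Finset.sum_nonneg fun j _ => p.meanBS_nonneg j (hu j))] at hpgf
  rw [← hpgf, ← lintegral_indicator_one (net.measurableSet_le_nearest u)]
  refine lintegral_congr fun ω => ?_
  rw [tprod_indicator_eq_indicator _ fun i => (net.bs i ω, net.mark (.userBlock i) ω),
    net.setOf_le_nearest_eq]
  rfl

lemma measure_le_nearest_inter [IsProbabilityMeasure P] (j : LinkType) {u v : ℝ} (hu : 0 ≤ u)
    (hv : 0 ≤ v) :
    P ({ω | ENNReal.ofReal u ≤ net.nearest j ω} ∩ {ω | ENNReal.ofReal v ≤ net.nearest j.other ω})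
      = ENNReal.ofReal (Real.exp (-(p.meanBS j u + p.meanBS j.other v))) := by
  classical
  have hj : j.other ≠ j := by cases j <;> simp [other]
  have h := net.measure_forall_le_nearest (u := fun k => if k = j then u else v)
    fun k => by split_ifs <;> assumption
  simp only [sum_linkType_other j, forall_linkType_iff_other j, if_true, if_neg hj] at h
  exact h

lemma measure_le_nearest [IsProbabilityMeasure P] (j : LinkType) {u : ℝ} (hu : 0 ≤ u) :
    P {ω | ENNReal.ofReal u ≤ net.nearest j ω} = ENNReal.ofReal (Real.exp (-p.meanBS j u)) := by
  simpa [p.meanBS_zero] using net.measure_le_nearest_inter j hu le_rfl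

lemma indepFun_nearest [IsProbabilityMeasure P] (j : LinkType) :
    IndepFun (net.nearest j) (net.nearest j.other) P := by
  rw [IndepFun_iff_Indep]
  refine IndepSets.indep (net.measurable_nearest _).comap_le (net.measurable_nearest _).comap_le
    (isPiSystem_Ici_ofReal.comap (net.nearest j))
    (isPiSystem_Ici_ofReal.comap (net.nearest j.other)) ?_ ?_ ?_
  · rw [ennreal_measurableSpace_eq_generateFrom_Ici_ofReal, MeasurableSpace.comap_generateFrom]
    rfl
  · rw [ennreal_measurableSpace_eq_generateFrom_Ici_ofReal, MeasurableSpace.comap_generateFrom]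
    rfl
  · rw [IndepSets_iff]
    rintro _ _ ⟨_, ⟨u, hu, rfl⟩, rfl⟩ ⟨_, ⟨v, hv, rfl⟩, rfl⟩
    calc _ = _ := net.measure_le_nearest_inter j hu hv
      _ = _ := by rw [neg_add, Real.exp_add, ENNReal.ofReal_mul (Real.exp_pos _).le,
        ← net.measure_le_nearest j hu, ← net.measure_le_nearest j.other hv]; rfl

lemma map_nearest_Ico [IsProbabilityMeasure P] (j : LinkType) {a b : ℝ} (hab : a ≤ b) :
    (P.restrict {ω | net.nearest j ω ≠ ∞}).map (fun ω => (net.nearest j ω).toReal) (Set.Ico a b)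
      = ENNReal.ofReal (Real.exp (-p.meanBS j (max a 0)) - Real.exp (-p.meanBS j (max b 0))) := by
  have hmeas : Measurable fun ω => (net.nearest j ω).toReal := by fun_prop
  have hevent : (fun ω => (net.nearest j ω).toReal) ⁻¹' Set.Ico a b ∩ {ω | net.nearest j ω ≠ ∞}
      = {ω | ENNReal.ofReal a ≤ net.nearest j ω} \ {ω | ENNReal.ofReal b ≤ net.nearest j ω} := by
    ext ω
    simp only [Set.mem_inter_iff, Set.mem_preimage, Set.mem_Ico, Set.mem_ofPred_eq, Set.mem_sdiff,
      not_le]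
    constructor
    · rintro ⟨⟨ha, hb⟩, hfin⟩
      exact ⟨(ENNReal.ofReal_le_iff_le_toReal hfin).2 ha,
        (ENNReal.lt_ofReal_iff_toReal_lt hfin).2 hb⟩
    · rintro ⟨ha, hb⟩
      exact ⟨⟨(ENNReal.ofReal_le_iff_le_toReal hb.ne_top).1 ha,
        (ENNReal.lt_ofReal_iff_toReal_lt hb.ne_top).1 hb⟩, hb.ne_top⟩
  have hmax (c : ℝ) : ENNReal.ofReal c = ENNReal.ofReal (max c 0) := by simp
  have hsub : {ω | ENNReal.ofReal b ≤ net.nearest j ω} ⊆ {ω | ENNReal.ofReal a ≤ net.nearest j ω} :=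
    fun ω hω => (ENNReal.ofReal_le_ofReal hab).trans hω
  rw [Measure.map_apply hmeas measurableSet_Ico, Measure.restrict_apply (hmeas measurableSet_Ico),
    hevent, measure_sdiff hsub
      (measurableSet_le measurable_const (net.measurable_nearest j)).nullMeasurableSet
      (measure_ne_top _ _), hmax a, hmax b, net.measure_le_nearest j (le_max_right _ _),
    net.measure_le_nearest j (le_max_right _ _), ENNReal.ofReal_sub _ (Real.exp_pos _).le]

lemma map_nearest [IsProbabilityMeasure P] (j : LinkType) :
    (P.restrict {ω | net.nearest j ω ≠ ∞}).map (fun ω => (net.nearest j ω).toReal)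
      = (volume.restrict (Set.Ioi 0)).withDensity
        fun r => ENNReal.ofReal (p.nearestDensity j r) := by
  have : IsFiniteMeasure
      ((P.restrict {ω | net.nearest j ω ≠ ∞}).map (fun ω => (net.nearest j ω).toReal)) :=
    Measure.isFiniteMeasure_map _ _
  refine Measure.ext_of_Ico _ _ fun a b hab => ?_
  have hIco : (Set.Ico a b ∩ Set.Ioi 0 : Set ℝ) =ᵐ[volume] Set.Ico (max a 0) (max b 0) := by
    have hinter : Set.Ico (max a 0) (max b 0) = Set.Ico a b ∩ Set.Ici 0 := by
      ext r
      simp only [Set.mem_Ico, Set.mem_inter_iff, Set.mem_Ici, max_le_iff, lt_max_iff]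
      grind
    rw [hinter]
    exact Filter.EventuallyEq.inter (Filter.EventuallyEq.refl _ _) Ioi_ae_eq_Ici
  rw [net.map_nearest_Ico j hab.le, withDensity_apply _ measurableSet_Ico,
    Measure.restrict_restrict measurableSet_Ico, setLIntegral_congr hIco,
    p.lintegral_nearestDensity j (le_max_right _ _) (max_le_max_right 0 hab.le)]

lemma measure_nearest_eq_ofReal [IsProbabilityMeasure P] (j : LinkType) (u : ℝ) :
    P {ω | net.nearest j ω = ENNReal.ofReal u} = 0 := by
  have hmeas : Measurable fun ω => (net.nearest j ω).toReal := by fun_prop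
  have hatom : ((P.restrict {ω | net.nearest j ω ≠ ∞}).map (fun ω => (net.nearest j ω).toReal))
      {(ENNReal.ofReal u).toReal} = 0 := by
    rw [net.map_nearest j]
    exact measure_singleton _
  rw [Measure.map_apply hmeas (measurableSet_singleton _),
    Measure.restrict_apply (hmeas (measurableSet_singleton _))] at hatom
  refine measure_mono_null (fun ω hω => ?_) hatom
  have hω' : net.nearest j ω = ENNReal.ofReal u := hω
  simp [hω']

lemma ae_nearest_ne_ofReal [IsProbabilityMeasure P] (j : LinkType) (u : ℝ) :
    ∀ᵐ ω ∂P, net.nearest j ω ≠ ENNReal.ofReal u :=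
  measure_eq_zero_iff_ae_notMem.1 (net.measure_nearest_eq_ofReal j u)

lemma measure_lt_nearest [IsProbabilityMeasure P] (j : LinkType) {u : ℝ} (hu : 0 ≤ u) :
    P {ω | ENNReal.ofReal u < net.nearest j ω} = ENNReal.ofReal (Real.exp (-p.meanBS j u)) := by
  rw [← net.measure_le_nearest j hu]
  refine measure_congr ?_
  filter_upwards [net.ae_nearest_ne_ofReal j u] with ω hω
  exact propext ⟨le_of_lt, fun h => lt_of_le_of_ne h (Ne.symm hω)⟩

end Network

/-! ### Association: type and distance of the serving base station -/

namespace Params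

variable (p : Params)

lemma pathLoss_pos (j : LinkType) {r : ℝ} (hr : 0 < r) : 0 < p.pathLoss j r :=
  mul_pos (p.K_pos j) (Real.rpow_pos_of_pos hr _)

lemma pathLoss_le_pathLoss_iff (j : LinkType) {r r' : ℝ} (hr : 0 < r) (hr' : 0 < r') :
    p.pathLoss j r ≤ p.pathLoss j r' ↔ r' ≤ r := by
  rw [pathLoss, pathLoss, mul_le_mul_iff_right₀ (p.K_pos j),
    Real.rpow_le_rpow_iff_of_neg hr hr' (neg_lt_zero.2 (p.α_pos j))]

/-- The distance at which a link of the other type is as good as a link of type `j` and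
length `r`. -/
def tieDist (j : LinkType) (r : ℝ) : ℝ :=
  (p.K j.other / p.K j) ^ (1 / p.α j.other) * r ^ (p.α j / p.α j.other)

lemma tieDist_nonneg (j : LinkType) {r : ℝ} (hr : 0 ≤ r) : 0 ≤ p.tieDist j r := by
  have := p.K_pos j
  have := p.K_pos j.other
  unfold tieDist
  positivity

lemma tieDist_pos (j : LinkType) {r : ℝ} (hr : 0 < r) : 0 < p.tieDist j r := by
  have := p.K_pos j
  have := p.K_pos j.other
  unfold tieDist
  positivity

@[fun_prop]
lemma measurable_tieDist (j : LinkType) : Measurable (p.tieDist j) := by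
  unfold tieDist
  fun_prop

lemma tieDist_rpow (j : LinkType) {r : ℝ} (hr : 0 ≤ r) (c : ℝ) :
    p.tieDist j r ^ c = (p.K j.other / p.K j) ^ (c / p.α j.other)
      * r ^ (c * p.α j / p.α j.other) := by
  have := p.K_pos j
  have := p.K_pos j.other
  rw [tieDist, Real.mul_rpow (by positivity) (by positivity), ← Real.rpow_mul (by positivity),
    ← Real.rpow_mul hr]
  ring_nf

lemma tieDist_sq (j : LinkType) {r : ℝ} (hr : 0 ≤ r) :
    p.tieDist j r ^ 2 = (p.K j.other / p.K j) ^ (2 / p.α j.other)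
      * r ^ (2 * p.α j / p.α j.other) := by
  rw [← Real.rpow_two, p.tieDist_rpow j hr]

lemma pathLoss_tieDist (j : LinkType) {r : ℝ} (hr : 0 < r) :
    p.pathLoss j.other (p.tieDist j r) = p.pathLoss j r := by
  have hK := (p.K_pos j).ne'
  have hK' := (p.K_pos j.other).ne'
  have hα := (p.α_pos j.other).ne'
  rw [pathLoss, pathLoss, p.tieDist_rpow j hr.le, neg_div, div_self hα, Real.rpow_neg_one,
    show -p.α j.other * p.α j / p.α j.other = -p.α j by field_simp]
  field_simp

lemma le_tieDist_iff (j : LinkType) {r r' : ℝ} (hr : 0 < r) (hr' : 0 < r') :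
    r' ≤ p.tieDist j r ↔ p.pathLoss j r ≤ p.pathLoss j.other r' := by
  rw [← p.pathLoss_tieDist j hr, p.pathLoss_le_pathLoss_iff _ (p.tieDist_pos j hr) hr']

lemma tieDist_le_iff (j : LinkType) {r r' : ℝ} (hr : 0 < r) (hr' : 0 < r') :
    p.tieDist j r ≤ r' ↔ p.pathLoss j.other r' ≤ p.pathLoss j r := by
  rw [← p.pathLoss_tieDist j hr, p.pathLoss_le_pathLoss_iff _ hr' (p.tieDist_pos j hr)]

lemma tieDist_los_le {r : ℝ} (hr : 0 < r) (hrD : r ≤ p.D) : p.tieDist los r ≤ p.D :=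
  (p.tieDist_le_iff los hr p.D_pos).2
    (p.nlos_le_los.trans ((p.pathLoss_le_pathLoss_iff los p.D_pos hr).2 hrD))

lemma tieDist_nlos_le_iff {r : ℝ} (hr : 0 < r) :
    p.tieDist nlos r ≤ p.D ↔ r ≤ p.tieDist los p.D := by
  rw [p.tieDist_le_iff nlos hr p.D_pos, p.le_tieDist_iff los p.D_pos hr]
  rfl

/-- The density of the distance to the serving base station on the event that it is of type
`j`. -/
def servedDensity (j : LinkType) (r : ℝ) : ℝ :=
  p.nearestDensity j r * Real.exp (-p.meanBS j.other (p.tieDist j r))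

lemma servedDensity_nonneg (j : LinkType) {r : ℝ} (hr : 0 ≤ r) : 0 ≤ p.servedDensity j r :=
  mul_nonneg (p.nearestDensity_nonneg j hr) (Real.exp_pos _).le

@[fun_prop]
lemma measurable_servedDensity (j : LinkType) : Measurable (p.servedDensity j) := by
  have := (p.continuous_meanBS j.other).measurable
  unfold servedDensity
  fun_prop

lemma distPdf_los_eq {r : ℝ} (hr : 0 < r) :
    p.distPdf los r = p.servedDensity los r / p.assoc los := by
  simp only [distPdf, servedDensity, nearestDensity]
  rcases le_or_gt r p.D with h | h
  · rw [Set.indicator_of_mem (show r ∈ Set.Icc 0 p.D from ⟨hr.le, h⟩), p.linkProb_of_le los h,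
      p.meanBS_of_le los h, other, p.meanBS_of_le nlos (p.tieDist_los_le hr h),
      p.tieDist_sq los hr.le]
    simp only [q, other]
    ring_nf
  · rw [Set.indicator_of_notMem (fun hmem => hmem.2.not_gt h), p.linkProb_of_lt los h]
    simp [qFar]

/-- The part of the density of the serving distance that is due to NLOS base stations serving the
user despite the presence of an LOS base station. -/
def excessDensity (r : ℝ) : ℝ :=
  2 * Real.pi * (1 - p.C) * p.lamB * r * Real.exp (-((1 - p.C) * p.lamB * Real.pi * r ^ 2))
    * (Real.exp (-(p.C * p.lamB * Real.pi * (p.K los / p.K nlos) ^ (2 / p.α los)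
        * r ^ (2 * p.α nlos / p.α los)))
      - Real.exp (-(p.C * p.lamB * Real.pi * p.D ^ 2)))

lemma continuous_excessDensity : Continuous p.excessDensity := by
  have := p.α_pos los
  have := p.α_pos nlos
  have : Continuous fun r : ℝ => r ^ (2 * p.α nlos / p.α los) :=
    Real.continuous_rpow_const (by positivity)
  unfold excessDensity
  fun_prop

lemma excessDensity_nonneg {r : ℝ} (hr : r ∈ Set.Ioc 0 (p.tieDist los p.D)) :
    0 ≤ p.excessDensity r := by
  have := p.C_nonneg
  have := p.lamB_pos
  have := sub_nonneg.2 p.C_le_one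
  have := hr.1
  have hsq : p.tieDist nlos r ^ 2 ≤ p.D ^ 2 :=
    pow_le_pow_left₀ (p.tieDist_nonneg nlos hr.1.le) ((p.tieDist_nlos_le_iff hr.1).2 hr.2) 2
  rw [p.tieDist_sq nlos hr.1.le, other] at hsq
  refine mul_nonneg (by positivity) (sub_nonneg.2 (Real.exp_le_exp.2 (neg_le_neg ?_)))
  rw [mul_assoc _ (_ ^ _) (_ ^ _)]
  gcongr

lemma servedDensity_nlos_eq {r : ℝ} (hr : 0 < r) :
    p.servedDensity nlos r
      = p.nearestDensity nlos r * Real.exp (-(p.C * p.lamB * Real.pi * p.D ^ 2))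
        + if r ≤ p.tieDist los p.D then p.excessDensity r else 0 := by
  simp only [servedDensity, other]
  split_ifs with h
  · have hrD : r ≤ p.D := h.trans (p.tieDist_los_le p.D_pos le_rfl)
    rw [p.meanBS_of_le los ((p.tieDist_nlos_le_iff hr).2 h), nearestDensity,
      p.meanBS_of_le nlos hrD, p.linkProb_of_le nlos hrD, p.tieDist_sq nlos hr.le]
    simp only [q, other, excessDensity]
    ring_nf
  · have htie : p.D ≤ p.tieDist nlos r :=
      (not_le.1 fun hle => h ((p.tieDist_nlos_le_iff hr).1 hle)).le
    rw [p.meanBS_of_ge los htie]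
    simp only [q, qFar]
    ring_nf

lemma nearestDensity_nlos_mul_exp {r : ℝ} (hrD : r ≠ p.D) :
    p.nearestDensity nlos r * Real.exp (-(p.C * p.lamB * Real.pi * p.D ^ 2))
      = 2 * Real.pi * p.lamB * r * Real.exp (-(Real.pi * p.lamB * r ^ 2))
        * ((1 - p.C) * Real.exp (Real.pi * p.C * p.lamB * (r ^ 2 - p.D ^ 2))
            * (if r ≤ p.D then 1 else 0)
          + (if p.D ≤ r then 1 else 0)) := by
  rw [nearestDensity]
  rcases lt_or_gt_of_ne hrD with h | h
  · have hexp : Real.exp (-(Real.pi * p.lamB * (p.q nlos * r ^ 2)))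
          * Real.exp (-(p.C * p.lamB * Real.pi * p.D ^ 2))
        = Real.exp (-(Real.pi * p.lamB * r ^ 2))
          * Real.exp (Real.pi * p.C * p.lamB * (r ^ 2 - p.D ^ 2)) := by
      rw [← Real.exp_add, ← Real.exp_add]
      simp only [q]
      ring_nf
    rw [p.linkProb_of_le nlos h.le, if_pos h.le, if_neg (not_le.2 h), p.meanBS_of_le nlos h.le,
      mul_assoc, hexp]
    simp only [q]
    ring
  · rw [p.linkProb_of_lt nlos h, if_neg (not_le.2 h), if_pos h.le, p.meanBS_of_ge nlos h.le,
      mul_assoc, ← Real.exp_add]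
    simp only [q, qFar]
    ring_nf

lemma distPdf_nlos_eq {r : ℝ} (hr : 0 < r) (hrD : r ≠ p.D) :
    p.distPdf nlos r = p.servedDensity nlos r / p.assoc nlos := by
  have hμ : (p.K nlos / p.K los) ^ (1 / p.α nlos) * p.D ^ (p.α los / p.α nlos)
      = p.tieDist los p.D := rfl
  rw [p.servedDensity_nlos_eq hr, p.nearestDensity_nlos_mul_exp hrD]
  simp only [distPdf, hμ, excessDensity]
  split_ifs <;> ring

lemma ae_distPdf_eq (j : LinkType) : ∀ᵐ r ∂volume.restrict (Set.Ioi (0 : ℝ)),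
    p.distPdf j r = p.servedDensity j r / p.assoc j := by
  have hne : ∀ᵐ r : ℝ ∂volume.restrict (Set.Ioi (0 : ℝ)), r ≠ p.D :=
    ae_restrict_of_ae (measure_eq_zero_iff_ae_notMem.1 (measure_singleton p.D))
  filter_upwards [hne, ae_restrict_mem measurableSet_Ioi] with r hrD hr
  cases j
  · exact p.distPdf_los_eq hr
  · exact p.distPdf_nlos_eq hr hrD

lemma assocNLOS_eq : p.assocNLOS = (∫ r in Set.Ioc 0 (p.tieDist los p.D), p.excessDensity r)
      + Real.exp (-(p.C * p.lamB * Real.pi * p.D ^ 2)) := by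
  have := p.K_pos los
  have := p.K_pos nlos
  have hμ : (p.K los / p.K nlos) ^ (-(1 / p.α nlos)) * p.D ^ (p.α los / p.α nlos)
      = p.tieDist los p.D := by
    rw [tieDist, other, Real.rpow_neg (by positivity), ← Real.inv_rpow (by positivity), inv_div]
  rw [assocNLOS, hμ, intervalIntegral.integral_of_le (p.tieDist_nonneg los p.D_pos.le)]
  congr 1
  · refine integral_congr_ae (ae_of_all _ fun r => ?_)
    simp only [excessDensity]
    ring_nf
  · ring_nf

lemma setIntegral_excessDensity_nonneg :
    0 ≤ ∫ r in Set.Ioc 0 (p.tieDist los p.D), p.excessDensity r :=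
  setIntegral_nonneg measurableSet_Ioc fun _ hr => p.excessDensity_nonneg hr

lemma assocNLOS_pos : 0 < p.assocNLOS := by
  rw [p.assocNLOS_eq]
  exact add_pos_of_nonneg_of_pos p.setIntegral_excessDensity_nonneg (Real.exp_pos _)

lemma setLIntegral_excessDensity :
    ∫⁻ r in Set.Ioc 0 (p.tieDist los p.D), ENNReal.ofReal (p.excessDensity r)
      = ENNReal.ofReal (∫ r in Set.Ioc 0 (p.tieDist los p.D), p.excessDensity r) := by
  refine (ofReal_integral_eq_lintegral_ofReal ?_ ?_).symm
  · exact p.continuous_excessDensity.integrableOn_Icc.mono_set Set.Ioc_subset_Icc_self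
  · filter_upwards [ae_restrict_mem measurableSet_Ioc] with r hr using p.excessDensity_nonneg hr

lemma ofReal_servedDensity_nlos {r : ℝ} (hr : 0 < r) :
    ENNReal.ofReal (p.servedDensity nlos r)
      = ENNReal.ofReal (p.nearestDensity nlos r)
          * ENNReal.ofReal (Real.exp (-(p.C * p.lamB * Real.pi * p.D ^ 2)))
        + (Set.Iic (p.tieDist los p.D)).indicator
            (fun r => ENNReal.ofReal (p.excessDensity r)) r := by
  have hnearest := p.nearestDensity_nonneg nlos hr.le
  rw [p.servedDensity_nlos_eq hr, ← ENNReal.ofReal_mul hnearest, Set.indicator_apply]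
  simp only [Set.mem_Iic]
  split_ifs with h
  · exact ENNReal.ofReal_add (by positivity) (p.excessDensity_nonneg ⟨hr, h⟩)
  · rw [add_zero, add_zero]

lemma tendsto_meanBS_nlos : Filter.Tendsto (p.meanBS nlos) Filter.atTop Filter.atTop := by
  have hpos := mul_pos Real.pi_pos p.lamB_pos
  have hquad : Filter.Tendsto (fun u : ℝ => Real.pi * p.lamB * (u ^ 2 - p.D ^ 2))
      Filter.atTop Filter.atTop :=
    (Filter.tendsto_atTop_add_const_right _ (-p.D ^ 2)
      (Filter.tendsto_pow_atTop two_ne_zero)).const_mul_atTop hpos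
  refine Filter.tendsto_atTop_mono' _ ?_ hquad
  filter_upwards [Filter.eventually_ge_atTop p.D] with u hu
  have := mul_nonneg (p.q_nonneg nlos) (sq_nonneg p.D)
  rw [p.meanBS_of_ge nlos hu, qFar, one_mul]
  exact mul_le_mul_of_nonneg_left (by linarith) hpos.le

/-- The pairs formed by the distance to the nearest base station of type `j` and the distance to
the nearest one of the other type for which the former is strictly preferred by the user. -/
def beats (j : LinkType) : Set (ℝ≥0∞ × ℝ≥0∞) :=
  {x | x.1 ≠ ∞ ∧ ENNReal.ofReal (p.tieDist j x.1.toReal) < x.2}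

lemma measurableSet_beats (j : LinkType) : MeasurableSet (p.beats j) :=
  (measurable_fst (measurableSet_singleton ∞).compl).inter
    (measurableSet_lt (by fun_prop) measurable_snd)

end Params

namespace Network

variable {p : Params} {Ω : Type*} [MeasurableSpace Ω] {P : Measure Ω} (net : Network p P)

/-- The event that the nearest base station of type `j` beats all those of the other type. -/
def served (j : LinkType) : Set Ω :=
  {ω | (net.nearest j ω, net.nearest j.other ω) ∈ p.beats j}

lemma measurableSet_served (j : LinkType) : MeasurableSet (net.served j) :=
  ((net.measurable_nearest j).prodMk (net.measurable_nearest j.other)) (p.measurableSet_beats j)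

lemma lintegral_beats_nearest_other [IsProbabilityMeasure P] (j : LinkType) (f : ℝ → ℝ≥0∞)
    (x : ℝ≥0∞) :
    ∫⁻ ω, (p.beats j).indicator (fun y => f y.1.toReal) (x, net.nearest j.other ω) ∂P
      = ({∞}ᶜ : Set ℝ≥0∞).indicator (fun x =>
          ENNReal.ofReal (Real.exp (-p.meanBS j.other (p.tieDist j x.toReal))) * f x.toReal) x := by
  rcases eq_or_ne x ∞ with rfl | hx
  · simp [Params.beats]
  · rw [Set.indicator_of_mem (by simpa using hx),
      ← net.measure_lt_nearest j.other (p.tieDist_nonneg j ENNReal.toReal_nonneg), mul_comm,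
      ← lintegral_indicator_const
        (measurableSet_lt measurable_const (net.measurable_nearest j.other))]
    refine lintegral_congr fun ω => ?_
    simp only [Set.indicator_apply, Params.beats, Set.mem_ofPred_eq, hx, ne_eq, not_false_eq_true,
      true_and]

lemma lintegral_served [IsProbabilityMeasure P] (j : LinkType) {f : ℝ → ℝ≥0∞}
    (hf : Measurable f) :
    ∫⁻ ω in net.served j, f (net.nearest j ω).toReal ∂P
      = ∫⁻ r in Set.Ioi (0 : ℝ), ENNReal.ofReal (p.servedDensity j r) * f r := by
  set g : ℝ → ℝ≥0∞ := fun r =>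
    ENNReal.ofReal (Real.exp (-p.meanBS j.other (p.tieDist j r))) * f r with hg
  have hgm : Measurable g := by
    have := (p.continuous_meanBS j.other).measurable
    fun_prop
  have hnear := net.measurable_nearest
  have hfin : MeasurableSet {ω | net.nearest j ω ≠ ∞} :=
    hnear j (measurableSet_singleton ∞).compl
  calc ∫⁻ ω in net.served j, f (net.nearest j ω).toReal ∂P
      = ∫⁻ ω, (p.beats j).indicator (fun y => f y.1.toReal)
          (net.nearest j ω, net.nearest j.other ω) ∂P := by
        rw [← lintegral_indicator (net.measurableSet_served j)]
        rfl
    _ = ∫⁻ ω, ∫⁻ ω', (p.beats j).indicator (fun y => f y.1.toReal)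
          (net.nearest j ω, net.nearest j.other ω') ∂P ∂P :=
        lintegral_comp_of_indepFun (net.indepFun_nearest j) (hnear j) (hnear j.other)
          ((hf.comp measurable_fst.ennreal_toReal).indicator (p.measurableSet_beats j))
    _ = ∫⁻ ω in {ω | net.nearest j ω ≠ ∞}, g (net.nearest j ω).toReal ∂P := by
        rw [← lintegral_indicator hfin]
        exact lintegral_congr fun ω => net.lintegral_beats_nearest_other j f _
    _ = ∫⁻ r in Set.Ioi (0 : ℝ), ENNReal.ofReal (p.nearestDensity j r) * g r := by
        rw [← lintegral_map hgm (hnear j).ennreal_toReal, net.map_nearest j,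
          lintegral_withDensity_eq_lintegral_mul _ (by fun_prop) hgm]
        rfl
    _ = ∫⁻ r in Set.Ioi (0 : ℝ), ENNReal.ofReal (p.servedDensity j r) * f r := by
        refine setLIntegral_congr_fun measurableSet_Ioi fun r hr => ?_
        simp only [hg, Params.servedDensity]
        rw [ENNReal.ofReal_mul (p.nearestDensity_nonneg j (le_of_lt hr)), mul_assoc]

lemma ae_nearest_other_ne_tieDist [IsProbabilityMeasure P] (j : LinkType) :
    ∀ᵐ ω ∂P, net.nearest j.other ω ≠ ENNReal.ofReal (p.tieDist j (net.nearest j ω).toReal) := by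
  have hnear := net.measurable_nearest
  set tie : Set (ℝ≥0∞ × ℝ≥0∞) := {x | x.2 = ENNReal.ofReal (p.tieDist j x.1.toReal)}
  have htie : MeasurableSet tie := measurableSet_eq_fun measurable_snd (by fun_prop)
  have hnull : P {ω | (net.nearest j ω, net.nearest j.other ω) ∈ tie} = 0 := by
    rw [measure_prodMk_mem_of_indepFun (net.indepFun_nearest j) (hnear j) (hnear j.other) htie]
    exact (lintegral_congr fun ω => net.measure_nearest_eq_ofReal j.other
      (p.tieDist j (net.nearest j ω).toReal)).trans lintegral_zero
  exact measure_eq_zero_iff_ae_notMem.1 hnull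

lemma ae_norm_bs_pos [IsProbabilityMeasure P] : ∀ᵐ ω ∂P, ∀ i, 0 < ‖net.bs i ω‖ := by
  filter_upwards [ae_all_iff.2 fun j => net.ae_nearest_ne_ofReal j 0] with ω hω i
  have hle := (net.le_nearest_iff (net.userLink i ω) ω _).1 le_rfl i rfl
  have hne := hω (net.userLink i ω)
  rw [ENNReal.ofReal_zero] at hne
  rw [norm_pos_iff, ← enorm_ne_zero]
  exact ((pos_iff_ne_zero.2 hne).trans_le hle).ne'

lemma ae_finite_norm_bs_le : ∀ᵐ ω ∂P, ∀ R : ℝ, {i | ‖net.bs i ω‖ ≤ R}.Finite := by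
  have hball (n : ℕ) : ∀ᵐ ω ∂P, {i | net.bs i ω ∈ Metric.closedBall (0 : Plane) n}.Finite :=
    net.bs_poisson.ae_finite_setOf_mem measurableSet_closedBall (by
      rw [Measure.smul_apply, smul_eq_mul]
      exact ENNReal.mul_ne_top ENNReal.ofReal_ne_top measure_closedBall_lt_top.ne)
  filter_upwards [ae_all_iff.2 hball] with ω hω R
  obtain ⟨n, hn⟩ := exists_nat_ge R
  exact (hω n).subset fun i hi => mem_closedBall_zero_iff.2 (le_trans hi hn)

lemma finite_le_userLoss {ω : Ω} (hpos : ∀ i, 0 < ‖net.bs i ω‖)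
    (hfin : ∀ R : ℝ, {i | ‖net.bs i ω‖ ≤ R}.Finite) {c : ℝ} (hc : 0 < c) :
    {i | c ≤ net.userLoss i ω}.Finite := by
  have hsub : {i | c ≤ net.userLoss i ω}
      ⊆ ⋃ j : LinkType, {i | ‖net.bs i ω‖ ≤ (p.K j / c) ^ (1 / p.α j)} := by
    intro i (hi : c ≤ net.userLoss i ω)
    refine Set.mem_iUnion.2 ⟨net.userLink i ω, ?_⟩
    have hK := p.K_pos (net.userLink i ω)
    change ‖net.bs i ω‖ ≤ _
    rw [one_div, Real.le_rpow_inv_iff_of_pos (hpos i).le (by positivity) (p.α_pos _),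
      le_div_iff₀ hc]
    calc ‖net.bs i ω‖ ^ p.α (net.userLink i ω) * c
        ≤ ‖net.bs i ω‖ ^ p.α (net.userLink i ω) * net.userLoss i ω := by gcongr
      _ = p.K (net.userLink i ω) := by
        rw [userLoss, Params.pathLoss, mul_left_comm, ← Real.rpow_add (hpos i), add_neg_cancel,
          Real.rpow_zero, mul_one]
  exact (Set.finite_iUnion fun j => hfin _).subset hsub

lemma exists_isMax_userLoss {ω : Ω} (hpos : ∀ i, 0 < ‖net.bs i ω‖)
    (hfin : ∀ R : ℝ, {i | ‖net.bs i ω‖ ≤ R}.Finite) :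
    ∃ i, ∀ k, net.userLoss k ω ≤ net.userLoss i ω := by
  obtain ⟨i, hi, hmax⟩ := Set.exists_max_image _ (fun i => net.userLoss i ω)
    (net.finite_le_userLoss hpos hfin (p.pathLoss_pos _ (hpos 0))) ⟨0, le_refl (net.userLoss 0 ω)⟩
  refine ⟨i, fun k => ?_⟩
  rcases le_total (net.userLoss 0 ω) (net.userLoss k ω) with h | h
  · exact hmax k h
  · exact h.trans hi

lemma ae_serving [IsProbabilityMeasure P] : ∀ᵐ ω ∂P,
    0 < ‖net.bs (net.serving ω) ω‖
      ∧ net.nearest (net.userLink (net.serving ω) ω) ω = ‖net.bs (net.serving ω) ω‖ₑ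
      ∧ ω ∈ net.served (net.userLink (net.serving ω) ω) := by
  filter_upwards [net.ae_norm_bs_pos, net.ae_finite_norm_bs_le,
    ae_all_iff.2 net.ae_nearest_other_ne_tieDist] with ω hpos hfin hne
  have hmax : ∀ k, net.userLoss k ω ≤ net.userLoss (net.serving ω) ω :=
    Nat.sInf_mem (net.exists_isMax_userLoss hpos hfin)
  set i := net.serving ω
  set j := net.userLink i ω with hj
  have hnear : net.nearest j ω = ‖net.bs i ω‖ₑ := by
    refine le_antisymm ((net.le_nearest_iff j ω _).1 le_rfl i rfl)
      ((net.le_nearest_iff j ω _).2 fun k hk => ?_)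
    have hki := hmax k
    rw [userLoss, userLoss, hk, ← hj, p.pathLoss_le_pathLoss_iff j (hpos k) (hpos i)] at hki
    rw [← ofReal_norm, ← ofReal_norm]
    exact ENNReal.ofReal_le_ofReal hki
  refine ⟨hpos i, hnear, hnear ▸ enorm_ne_top, ?_⟩
  refine lt_of_le_of_ne ((net.le_nearest_iff j.other ω _).2 fun k hk => ?_) (hne j).symm
  have hki := hmax k
  rw [userLoss, userLoss, hk, ← hj, ← p.tieDist_le_iff j (hpos i) (hpos k)] at hki
  rw [hnear, toReal_enorm, ← ofReal_norm]
  exact ENNReal.ofReal_le_ofReal hki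

lemma ae_notMem_served_inter [IsProbabilityMeasure P] :
    ∀ᵐ ω ∂P, ω ∉ net.served los ∩ net.served nlos := by
  filter_upwards [ae_all_iff.2 fun j => net.ae_nearest_ne_ofReal j 0] with ω hω
  rintro ⟨⟨hlos, hlos_lt⟩, ⟨hnlos, hnlos_lt⟩⟩
  have hpos (j : LinkType) (hj : net.nearest j ω ≠ ∞) : 0 < (net.nearest j ω).toReal :=
    ENNReal.toReal_pos (by simpa using hω j) hj
  simp only [other] at hlos_lt hnlos_lt
  rw [ENNReal.ofReal_lt_iff_lt_toReal (p.tieDist_nonneg _ ENNReal.toReal_nonneg) hnlos, ← not_le,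
    p.le_tieDist_iff _ (hpos los hlos) (hpos nlos hnlos)] at hlos_lt
  rw [ENNReal.ofReal_lt_iff_lt_toReal (p.tieDist_nonneg _ ENNReal.toReal_nonneg) hlos] at hnlos_lt
  exact hlos_lt ((p.tieDist_le_iff _ (hpos nlos hnlos) (hpos los hlos)).1 hnlos_lt.le)

lemma measure_served_add [IsProbabilityMeasure P] :
    P (net.served los) + P (net.served nlos) = 1 := by
  have hinter : P (net.served los ∩ net.served nlos) = 0 :=
    measure_eq_zero_iff_ae_notMem.2 net.ae_notMem_served_inter
  rw [← measure_union_add_inter _ (net.measurableSet_served nlos), hinter, add_zero]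
  refine (mem_ae_iff_prob_eq_one
    ((net.measurableSet_served los).union (net.measurableSet_served nlos))).1 ?_
  filter_upwards [net.ae_serving] with ω hω
  cases hj : net.userLink (net.serving ω) ω
  · exact Or.inl (hj ▸ hω.2.2)
  · exact Or.inr (hj ▸ hω.2.2)

lemma lintegral_servedDensity [IsProbabilityMeasure P] (j : LinkType) :
    ∫⁻ r in Set.Ioi (0 : ℝ), ENNReal.ofReal (p.servedDensity j r) = P (net.served j) := by
  simpa using (net.lintegral_served j (f := fun _ => 1) measurable_const).symm

lemma measure_nearest_nlos_eq_top [IsProbabilityMeasure P] :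
    P {ω | net.nearest nlos ω = ∞} = 0 := by
  have hlim : Filter.Tendsto (fun n : ℕ => ENNReal.ofReal (Real.exp (-p.meanBS nlos (n : ℝ))))
      Filter.atTop (nhds 0) := by
    rw [← ENNReal.ofReal_zero]
    exact ENNReal.tendsto_ofReal (Real.tendsto_exp_neg_atTop_nhds_zero.comp
      (p.tendsto_meanBS_nlos.comp tendsto_natCast_atTop_atTop))
  refine le_antisymm (ge_of_tendsto' hlim fun n => ?_) zero_le
  rw [← net.measure_le_nearest nlos n.cast_nonneg]
  exact measure_mono fun ω (hω : net.nearest nlos ω = ∞) => by simp [hω]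

lemma lintegral_nearestDensity_nlos [IsProbabilityMeasure P] (net : Network p P) :
    ∫⁻ r in Set.Ioi (0 : ℝ), ENNReal.ofReal (p.nearestDensity nlos r) = 1 := by
  have hfin : P {ω | net.nearest nlos ω ≠ ∞} = 1 :=
    (mem_ae_iff_prob_eq_one (net.measurable_nearest nlos (measurableSet_singleton ∞).compl)).1
      (measure_eq_zero_iff_ae_notMem.1 net.measure_nearest_nlos_eq_top)
  have hmass := congrArg (fun μ => μ Set.univ) (net.map_nearest nlos)
  rw [Measure.map_apply (net.measurable_nearest nlos).ennreal_toReal MeasurableSet.univ,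
    withDensity_apply _ MeasurableSet.univ, Measure.restrict_univ, Set.preimage_univ,
    Measure.restrict_apply_univ, hfin] at hmass
  exact hmass.symm

lemma measure_served_nlos [IsProbabilityMeasure P] :
    P (net.served nlos) = ENNReal.ofReal p.assocNLOS := by
  have hIoc : Set.Iic (p.tieDist los p.D) ∩ Set.Ioi 0 = Set.Ioc 0 (p.tieDist los p.D) :=
    Set.inter_comm _ _
  rw [← net.lintegral_servedDensity nlos,
    setLIntegral_congr_fun measurableSet_Ioi fun r hr => p.ofReal_servedDensity_nlos hr,
    lintegral_add_left (by fun_prop), lintegral_mul_const _ (by fun_prop),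
    net.lintegral_nearestDensity_nlos, one_mul, lintegral_indicator measurableSet_Iic,
    Measure.restrict_restrict measurableSet_Iic, hIoc, p.setLIntegral_excessDensity,
    ← ENNReal.ofReal_add (Real.exp_pos _).le p.setIntegral_excessDensity_nonneg,
    p.assocNLOS_eq, add_comm]

lemma measure_served [IsProbabilityMeasure P] (j : LinkType) :
    P (net.served j) = ENNReal.ofReal (p.assoc j) := by
  cases j
  · rw [ENNReal.eq_sub_of_add_eq (measure_ne_top _ _) net.measure_served_add,
      net.measure_served_nlos, Params.assoc, ENNReal.ofReal_sub _ p.assocNLOS_pos.le,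
      ENNReal.ofReal_one]
  · exact net.measure_served_nlos

end Network

/-! ### The bound on the connection probability -/

namespace Params

variable (p : Params)

/-- The argument of the Laplace transform in the `n`-th term of the bound. -/
def laplaceArg (j : LinkType) (n : ℕ) (r : ℝ) : ℝ := p.a j * n * r ^ p.α j / (p.Ms * p.K j)

lemma a_pos (j : LinkType) : 0 < p.a j :=
  Real.rpow_pos_of_pos (by exact_mod_cast Nat.factorial_pos _) _

lemma laplaceArg_nonneg (j : LinkType) (n : ℕ) {r : ℝ} (hr : 0 ≤ r) : 0 ≤ p.laplaceArg j n r := by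
  have := p.a_pos j
  have := p.Ms_pos
  have := p.K_pos j
  unfold laplaceArg
  positivity

lemma laplaceArg_pos (j : LinkType) {r : ℝ} (hr : 0 < r) : 0 < p.laplaceArg j 1 r := by
  have := p.a_pos j
  have := p.Ms_pos
  have := p.K_pos j
  unfold laplaceArg
  positivity

lemma laplaceArg_eq_natCast_mul (j : LinkType) (n : ℕ) (r : ℝ) :
    p.laplaceArg j n r = n * p.laplaceArg j 1 r := by
  unfold laplaceArg
  push_cast
  ring

lemma laplaceArg_one_eq (j : LinkType) {r : ℝ} (hr : 0 ≤ r) :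
    p.laplaceArg j 1 r = p.a j / (p.Ms * p.pathLoss j r) := by
  rw [laplaceArg, pathLoss, Real.rpow_neg hr, Nat.cast_one, mul_one, ← mul_assoc, ← div_eq_mul_inv,
    div_div_eq_mul_div]

@[fun_prop]
lemma measurable_laplaceArg (j : LinkType) (n : ℕ) : Measurable (p.laplaceArg j n) := by
  unfold laplaceArg
  fun_prop

@[fun_prop]
lemma measurable_laplaceIE_max : Measurable fun s => p.laplaceIE (max s 0) :=
  Antitone.measurable fun s s' h => p.laplaceIE_antitoneOn (Set.mem_Ici.2 (le_max_right s 0))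
    (Set.mem_Ici.2 (le_max_right s' 0)) (max_le_max_right 0 h)

/-- The bound on the connection probability of a serving base station of type `j` at
distance `r`. For `0 ≤ r` the maximum is `laplaceArg j n r`; it makes the function measurable. -/
def coverBound (j : LinkType) (r : ℝ) : ℝ :=
  ∑ n ∈ Finset.Icc 1 (p.N j), ((p.N j).choose n : ℝ) * (-1) ^ (n + 1)
    * p.laplaceIE (max (p.laplaceArg j n r) 0)

lemma measurable_coverBound (j : LinkType) : Measurable (p.coverBound j) :=
  Finset.measurable_sum _ fun n _ =>
    (p.measurable_laplaceIE_max.comp (p.measurable_laplaceArg j n)).const_mul _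

lemma mul_coverBound (j : LinkType) (c : ℝ) {r : ℝ} (hr : 0 ≤ r) :
    c * p.coverBound j r = ∑ n ∈ Finset.Icc 1 (p.N j), ((p.N j).choose n : ℝ) * (-1) ^ (n + 1)
      * (c * p.laplaceIE (p.laplaceArg j n r)) := by
  rw [coverBound, Finset.mul_sum]
  refine Finset.sum_congr rfl fun n _ => ?_
  rw [max_eq_left (p.laplaceArg_nonneg j n hr), mul_left_comm]

lemma integrableOn_mul_laplaceIE {f : ℝ → ℝ} (hf : IntegrableOn f (Set.Ioi 0)) (j : LinkType)
    (n : ℕ) : IntegrableOn (fun r => f r * p.laplaceIE (p.laplaceArg j n r)) (Set.Ioi 0) := by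
  have hmax : IntegrableOn (fun r => f r * p.laplaceIE (max (p.laplaceArg j n r) 0))
      (Set.Ioi 0) := by
    refine hf.mul_bdd (c := 1) ((p.measurable_laplaceIE_max.comp
      (p.measurable_laplaceArg j n)).aestronglyMeasurable) (ae_of_all _ fun r => ?_)
    rw [Real.norm_of_nonneg (p.laplaceIE_pos _).le, ← p.laplaceIE_zero]
    exact p.laplaceIE_antitoneOn Set.self_mem_Ici (Set.mem_Ici.2 (le_max_right _ 0))
      (le_max_right _ _)
  refine hmax.congr_fun (fun r hr => ?_) measurableSet_Ioi
  simp only [max_eq_left (p.laplaceArg_nonneg j n (le_of_lt hr))]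

lemma integral_mul_coverBound {f : ℝ → ℝ} (hf : IntegrableOn f (Set.Ioi 0)) (j : LinkType) :
    ∫ r in Set.Ioi (0 : ℝ), f r * p.coverBound j r
      = ∑ n ∈ Finset.Icc 1 (p.N j), ((p.N j).choose n : ℝ) * (-1) ^ (n + 1)
          * ∫ r in Set.Ioi (0 : ℝ), f r * p.laplaceIE (p.laplaceArg j n r) := by
  rw [setIntegral_congr_fun measurableSet_Ioi fun r hr => p.mul_coverBound j (f r) (le_of_lt hr),
    integral_finsetSum _ fun n _ => (p.integrableOn_mul_laplaceIE hf j n).const_mul _]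
  simp_rw [integral_const_mul]

lemma integrableOn_mul_coverBound {f : ℝ → ℝ} (hf : IntegrableOn f (Set.Ioi 0)) (j : LinkType) :
    IntegrableOn (fun r => f r * p.coverBound j r) (Set.Ioi 0) :=
  IntegrableOn.congr_fun
    (integrable_finsetSum _ fun n _ => (p.integrableOn_mul_laplaceIE hf j n).const_mul _)
    (fun r hr => (p.mul_coverBound j (f r) (le_of_lt hr)).symm) measurableSet_Ioi

end Params

namespace Network

variable {p : Params} {Ω : Type*} [MeasurableSpace Ω] {P : Measure Ω}

lemma integrableOn_servedDensity [IsProbabilityMeasure P] (net : Network p P) (j : LinkType) :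
    IntegrableOn (p.servedDensity j) (Set.Ioi 0) := by
  refine ⟨(p.measurable_servedDensity j).aestronglyMeasurable, ?_⟩
  rw [hasFiniteIntegral_iff_ofReal, net.lintegral_servedDensity j]
  · exact measure_lt_top _ _
  · filter_upwards [ae_restrict_mem measurableSet_Ioi] with r hr
    exact p.servedDensity_nonneg j (le_of_lt hr)

lemma integrableOn_distPdf [IsProbabilityMeasure P] (net : Network p P) (j : LinkType) :
    IntegrableOn (p.distPdf j) (Set.Ioi 0) :=
  ((net.integrableOn_servedDensity j).div_const _).congr
    ((p.ae_distPdf_eq j).mono fun _ h => h.symm)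

lemma assoc_le_one [IsProbabilityMeasure P] (net : Network p P) (j : LinkType) :
    p.assoc j ≤ 1 := by
  have hle : P (net.served j) ≤ 1 := prob_le_one
  rwa [net.measure_served j, ENNReal.ofReal_le_one] at hle

lemma assoc_nonneg [IsProbabilityMeasure P] (net : Network p P) (j : LinkType) :
    0 ≤ p.assoc j := by
  cases j
  · exact sub_nonneg.2 (net.assoc_le_one nlos)
  · exact p.assocNLOS_pos.le

lemma ae_assoc_mul_distPdf [IsProbabilityMeasure P] (net : Network p P) (j : LinkType) :
    ∀ᵐ r ∂volume.restrict (Set.Ioi (0 : ℝ)), p.assoc j * p.distPdf j r = p.servedDensity j r := by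
  by_cases hzero : p.assoc j = 0
  · have hmass := net.lintegral_servedDensity j
    rw [net.measure_served j, hzero, ENNReal.ofReal_zero,
      lintegral_eq_zero_iff (p.measurable_servedDensity j).ennreal_ofReal] at hmass
    filter_upwards [hmass, ae_restrict_mem measurableSet_Ioi] with r hr hr0
    rw [hzero, zero_mul]
    exact le_antisymm (p.servedDensity_nonneg j (le_of_lt hr0)) (ENNReal.ofReal_eq_zero.1 hr)
  · filter_upwards [p.ae_distPdf_eq j] with r hr
    rw [hr, mul_div_cancel₀ _ hzero]

end Network

/-! ### Conditioning on the serving base station -/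

lemma measurable_eval_apply {E : Type*} [MeasurableSpace E] :
    Measurable fun q : (ℕ → E) × ℕ => q.1 q.2 :=
  measurable_from_prod_countable_left fun i => measurable_pi_apply i

lemma measurable_sInf_setOf_mem {E : Type*} [MeasurableSpace E] {S : ℕ → Set E}
    (hS : ∀ i, MeasurableSet (S i)) : Measurable fun x => sInf {i | x ∈ S i} := by
  classical
  have hex (x : E) : ∃ i, x ∈ S i ∨ ∀ k, x ∉ S k := by
    by_cases h : ∃ i, x ∈ S i
    · exact h.imp fun _ => Or.inl
    · exact ⟨0, Or.inr (not_exists.1 h)⟩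
  have hfind (x : E) : sInf {i | x ∈ S i} = Nat.find (hex x) := by
    by_cases h : ∃ i, x ∈ S i
    · rw [Nat.sInf_def (s := {i | x ∈ S i}) h]
      exact Nat.find_congr' fun {i} => ⟨Or.inl, fun hi => hi.resolve_right (not_forall_not.2 h)⟩
    · have hempty : {i | x ∈ S i} = ∅ := Set.eq_empty_of_forall_notMem (not_exists.1 h)
      rw [hempty, Nat.sInf_empty, eq_comm, Nat.find_eq_zero]
      exact Or.inr (not_exists.1 h)
  simp_rw [hfind]
  have hnone : MeasurableSet {x | ∀ k, x ∉ S k} := by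
    rw [Set.ofPred_forall]
    exact MeasurableSet.iInter fun k => (hS k).compl
  exact measurable_find hex fun i => (hS i).union hnone

/-- The positions and the blockage marks of all base stations; they determine the serving one. -/
abbrev BSConfig : Type := (ℕ → Plane) × (ℕ → ℝ)

/-- The randomness of the links from one base station that does not affect the choice of the
serving one: the fading to the user for each possible link type, the positions of the
eavesdroppers and the marks of the links to them. -/
abbrev LinkConfig : Type := (LinkType → ℝ) × (ℕ → Plane) × (ℕ → LinkMark → ℝ)

namespace Params

variable (p : Params)

/-- The path loss of the link between the origin and a base station at `x` with blockage
mark `b`. -/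
def markedLoss (x : Plane) (b : ℝ) : ℝ := p.pathLoss (p.linkType ‖x‖ b) ‖x‖

lemma measurableSet_linkType_norm :
    MeasurableSet {q : Plane × ℝ | p.linkType ‖q.1‖ q.2 = los} :=
  (p.measurableSet_linkType_eq los).preimage (f := fun q : Plane × ℝ => (‖q.1‖, q.2)) (by fun_prop)

lemma measurable_markedLoss : Measurable fun q : Plane × ℝ => p.markedLoss q.1 q.2 :=
  measurable_linkType_select (f := fun j (q : Plane × ℝ) => p.pathLoss j ‖q.1‖)
    p.measurableSet_linkType_norm (by fun_prop)

lemma measurable_totalPower_linkConfig :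
    Measurable fun q : (Plane × ℝ) × LinkConfig => p.totalPower q.1.1 q.2.2.1 q.2.2.2 :=
  p.measurable_totalPower.comp
    (f := fun q : (Plane × ℝ) × LinkConfig => (q.1.1, q.2.2.1, q.2.2.2)) (by fun_prop)

/-- The first index of a base station of maximal path loss `L(x, o)` (`0` if there is none). -/
def bestIndex (w : BSConfig) : ℕ :=
  sInf {i | ∀ k, p.markedLoss (w.1 k) (w.2 k) ≤ p.markedLoss (w.1 i) (w.2 i)}

lemma measurable_bestIndex : Measurable p.bestIndex := by
  have hloss (i : ℕ) : Measurable fun w : BSConfig => p.markedLoss (w.1 i) (w.2 i) :=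
    p.measurable_markedLoss.comp (f := fun w : BSConfig => (w.1 i, w.2 i)) (by fun_prop)
  refine measurable_sInf_setOf_mem (S := fun i =>
    {w : BSConfig | ∀ k, p.markedLoss (w.1 k) (w.2 k) ≤ p.markedLoss (w.1 i) (w.2 i)}) fun i => ?_
  rw [Set.ofPred_forall]
  exact MeasurableSet.iInter fun k => measurableSet_le (hloss k) (hloss i)

end Params

namespace Network

variable {p : Params} {Ω : Type*} [MeasurableSpace Ω] {P : Measure Ω} (net : Network p P)

/-- The realized positions and blockage marks of the base stations. -/
def bsConfig (ω : Ω) : BSConfig := (fun i => net.bs i ω, fun i => net.mark (.userBlock i) ω)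

lemma measurable_bsConfig : Measurable net.bsConfig :=
  (measurable_pi_lambda _ net.bs_poisson.measurable).prodMk
    (measurable_pi_lambda _ fun _ => net.mark_measurable _)

lemma measurable_serving : Measurable net.serving :=
  p.measurable_bestIndex.comp net.measurable_bsConfig

/-- The fading of the link from base station `i` to the user, for each possible link type. -/
def userFades (i : ℕ) (ω : Ω) (j : LinkType) : ℝ := net.mark (.userFade j i) ω

/-- The realized configuration of the links from base station `i`. -/
def linkConfig (i : ℕ) (ω : Ω) : LinkConfig :=
  (net.userFades i ω, fun k => net.eve k ω, net.eveMarks i ω)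

lemma measurable_userFades (i : ℕ) : Measurable (net.userFades i) :=
  measurable_pi_lambda _ fun _ => net.mark_measurable _

lemma measurable_eve : Measurable fun ω k => net.eve k ω :=
  measurable_pi_lambda _ net.eve_poisson.measurable

lemma measurable_linkConfig (i : ℕ) : Measurable (net.linkConfig i) :=
  (net.measurable_userFades i).prodMk (net.measurable_eve.prodMk (net.measurable_eveMarks i))

/-- The indices of the marks entering the link configuration of base station `i`. -/
def linkIndex (i : ℕ) : LinkType ⊕ (ℕ × LinkMark) → Mark
  | .inl j => .userFade j i
  | .inr (k, c) => eveMark i k c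

lemma indepFun_bsConfig_linkConfig [IsProbabilityMeasure P] (i : ℕ) :
    IndepFun net.bsConfig (net.linkConfig i) P := by
  have hmarks : IndepFun (fun ω k => net.mark (.userBlock k) ω)
      (fun ω c => net.mark (linkIndex i c) ω) P :=
    indepFun_of_disjoint_range net.mark_measurable net.mark_indep (by
      rintro k (j | ⟨k', c⟩)
      · simp [linkIndex]
      · cases c <;> simp [linkIndex, eveMark])
  have hpoints : IndepFun (fun ω => ((fun k => net.bs k ω), (fun k => net.eve k ω)))
      (fun ω => ((fun k => net.mark (.userBlock k) ω), (fun c => net.mark (linkIndex i c) ω))) P :=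
    net.points_indep_mark.comp (φ := id)
      (ψ := fun m : Mark → ℝ => ((fun k => m (.userBlock k)), (fun c => m (linkIndex i c))))
      measurable_id (by fun_prop)
  have hregroup := indepFun_prodMk_comm (measurable_pi_lambda _ net.bs_poisson.measurable)
    net.measurable_eve (measurable_pi_lambda _ fun k => net.mark_measurable (.userBlock k))
    (measurable_pi_lambda _ fun c => net.mark_measurable (linkIndex i c))
    net.bs_indep_eve hmarks hpoints
  exact hregroup.comp (φ := id) (ψ := fun q : (ℕ → Plane) × (LinkType ⊕ (ℕ × LinkMark) → ℝ) =>
    ((fun j => q.2 (.inl j)), q.1, (fun k c => q.2 (.inr (k, c))))) measurable_id (by fun_prop)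

lemma indepFun_eve_userFades [IsProbabilityMeasure P] (i : ℕ) :
    IndepFun (fun ω => ((fun k => net.eve k ω), net.eveMarks i ω)) (net.userFades i) P := by
  have hmarks : IndepFun (fun ω (c : ℕ × LinkMark) => net.mark (eveMark i c.1 c.2) ω)
      (fun ω j => net.mark (.userFade j i) ω) P :=
    indepFun_of_disjoint_range net.mark_measurable net.mark_indep (by
      rintro ⟨k', c⟩ j
      cases c <;> simp [eveMark])
  have hpoints : IndepFun (fun ω => ((fun k => net.eve k ω), ()))
      (fun ω => ((fun c : ℕ × LinkMark => net.mark (eveMark i c.1 c.2) ω),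
        (fun j => net.mark (.userFade j i) ω))) P :=
    net.points_indep_mark.comp (φ := fun q => (q.2, ()))
      (ψ := fun m : Mark → ℝ => ((fun c : ℕ × LinkMark => m (eveMark i c.1 c.2)),
        (fun j => m (.userFade j i))))
      (by fun_prop) (by fun_prop)
  have hregroup := indepFun_prodMk_comm net.measurable_eve measurable_const
    (measurable_pi_lambda _ fun c => net.mark_measurable _)
    (measurable_pi_lambda _ fun c => net.mark_measurable _)
    (indepFun_const_right _ _) hmarks hpoints
  exact hregroup.comp
    (φ := fun q : (ℕ → Plane) × (ℕ × LinkMark → ℝ) => (q.1, fun k c => q.2 (k, c)))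
    (ψ := Prod.snd) (by fun_prop) measurable_snd

/-- The position and the blockage mark of the serving base station. -/
def servingSite (ω : Ω) : Plane × ℝ :=
  (net.bs (net.serving ω) ω, net.mark (.userBlock (net.serving ω)) ω)

lemma lintegral_serving [IsProbabilityMeasure P] {φ : (Plane × ℝ) × LinkConfig → ℝ≥0∞}
    (hφ : Measurable φ) :
    ∫⁻ ω, φ (net.servingSite ω, net.linkConfig (net.serving ω) ω) ∂P
      = ∫⁻ ω, ∫⁻ ω', φ (net.servingSite ω, net.linkConfig (net.serving ω) ω') ∂P ∂P := by
  have hbest := p.measurable_bestIndex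
  have hsite : Measurable fun w : BSConfig => (w.1 (p.bestIndex w), w.2 (p.bestIndex w)) :=
    (measurable_eval_apply.comp (measurable_fst.prodMk hbest)).prodMk
      (measurable_eval_apply.comp (measurable_snd.prodMk hbest))
  exact lintegral_comp_select_of_indepFun net.indepFun_bsConfig_linkConfig net.measurable_bsConfig
    net.measurable_linkConfig hbest
    (hφ.comp ((hsite.comp measurable_fst).prodMk measurable_snd))

end Network

/-! ### The total power received from the serving base station -/

namespace Network

variable {p : Params} {Ω : Type*} [MeasurableSpace Ω] {P : Measure Ω} (net : Network p P)

lemma measurable_totalPower_eve (i : ℕ) (x : Plane) :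
    Measurable fun ω => p.totalPower x (fun k => net.eve k ω) (net.eveMarks i ω) :=
  p.measurable_totalPower.comp (f := fun ω => (x, (fun k => net.eve k ω), net.eveMarks i ω))
    (measurable_const.prodMk (net.measurable_eve.prodMk (net.measurable_eveMarks i)))

lemma measurable_servingSite_linkConfig :
    Measurable fun ω => (net.servingSite ω, net.linkConfig (net.serving ω) ω) := by
  have hsite : Measurable fun q : Ω × ℕ =>
      ((net.bs q.2 q.1, net.mark (.userBlock q.2) q.1), net.linkConfig q.2 q.1) :=
    measurable_from_prod_countable_left fun i =>
      ((net.bs_poisson.measurable i).prodMk (net.mark_measurable (.userBlock i))).prodMk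
        (net.measurable_linkConfig i)
  exact hsite.comp (measurable_id.prodMk net.measurable_serving)

lemma measurable_powerE : Measurable net.powerE := by
  have hpower := p.measurable_totalPower_linkConfig.comp net.measurable_servingSite_linkConfig
  rwa [funext net.powerE_eq]

lemma lintegral_expNeg_powerE [IsProbabilityMeasure P] {s : ℝ} (hs : 0 < s) :
    ∫⁻ ω, expNeg (ENNReal.ofReal s * net.powerE ω) ∂P = ENNReal.ofReal (p.laplaceIE s) := by
  calc ∫⁻ ω, expNeg (ENNReal.ofReal s * net.powerE ω) ∂P
      = ∫⁻ ω, ∫⁻ ω', expNeg (ENNReal.ofReal s * p.totalPower (net.bs (net.serving ω) ω)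
          (fun k => net.eve k ω') (net.eveMarks (net.serving ω) ω')) ∂P ∂P :=
        net.lintegral_serving
          (measurable_expNeg.comp (p.measurable_totalPower_linkConfig.const_mul _))
    _ = ENNReal.ofReal (p.laplaceIE s) := by
        simp only [net.lintegral_expNeg_totalPower _ _ hs, lintegral_const, measure_univ, mul_one]

lemma ae_powerE_ne_top [IsProbabilityMeasure P] : ∀ᵐ ω ∂P, net.powerE ω ≠ ∞ := by
  refine ae_ne_top_of_tendsto_lintegral_expNeg net.measurable_powerE ?_
  have hlim : Filter.Tendsto (fun s => ENNReal.ofReal (p.laplaceIE s))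
      (nhdsWithin 0 (Set.Ioi 0)) (nhds 1) := by
    simpa [Params.laplaceIE] using
      ENNReal.tendsto_ofReal ((Real.continuous_exp.tendsto 0).comp p.tendsto_Xi)
  refine hlim.congr' ?_
  filter_upwards [self_mem_nhdsWithin] with s hs
  exact (net.lintegral_expNeg_powerE hs).symm

lemma integral_exp_powerE [IsProbabilityMeasure P] {s : ℝ} (hs : 0 < s) :
    ∫ ω, Real.exp (-s * (net.powerE ω).toReal) ∂P = p.laplaceIE s := by
  have hpower := net.measurable_powerE
  rw [integral_eq_lintegral_of_nonneg_ae (ae_of_all _ fun ω => (Real.exp_pos _).le)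
    (Measurable.aestronglyMeasurable (by fun_prop)), ← ENNReal.toReal_ofReal (p.laplaceIE_pos s).le,
    ← net.lintegral_expNeg_powerE hs]
  congr 1
  refine lintegral_congr_ae ?_
  filter_upwards [net.ae_powerE_ne_top] with ω hω
  rw [expNeg_of_ne_top (ENNReal.mul_ne_top ENNReal.ofReal_ne_top hω), ENNReal.toReal_mul,
    ENNReal.toReal_ofReal hs.le, neg_mul]

end Network

/-! ### The secure connection probability -/

namespace Network

variable {p : Params} {Ω : Type*} [MeasurableSpace Ω] {P : Measure Ω} (net : Network p P)

lemma integral_expNeg_totalPower [IsProbabilityMeasure P] (i : ℕ) (x : Plane) {s : ℝ}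
    (hs : 0 < s) :
    ∫ ω, (expNeg (ENNReal.ofReal s
        * p.totalPower x (fun k => net.eve k ω) (net.eveMarks i ω))).toReal ∂P
      = p.laplaceIE s := by
  have hpower := net.measurable_totalPower_eve i x
  rw [integral_toReal (Measurable.aemeasurable (by fun_prop))
    (ae_of_all _ fun ω => (expNeg_le_one _).trans_lt ENNReal.one_lt_top),
    net.lintegral_expNeg_totalPower i x hs, ENNReal.toReal_ofReal (p.laplaceIE_pos s).le]

lemma coverBound_eq_integral [IsProbabilityMeasure P] (i : ℕ) (x : Plane) (j : LinkType) {r : ℝ}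
    (hr : 0 < r) :
    p.coverBound j r = ∫ ω, gammaTailBound (p.N j) (ENNReal.ofReal (p.laplaceArg j 1 r)
      * p.totalPower x (fun k => net.eve k ω) (net.eveMarks i ω)) ∂P := by
  have hpower := net.measurable_totalPower_eve i x
  simp_rw [gammaTailBound_eq_sum]
  rw [integral_finsetSum]
  · refine Finset.sum_congr rfl fun n hn => ?_
    have hn0 : (0 : ℝ) < n := by exact_mod_cast (Finset.mem_Icc.1 hn).1
    have harg : 0 < n * p.laplaceArg j 1 r := mul_pos hn0 (p.laplaceArg_pos j hr)
    simp_rw [← ENNReal.ofReal_natCast n, ← mul_assoc, ← ENNReal.ofReal_mul hn0.le]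
    rw [integral_const_mul, net.integral_expNeg_totalPower i x harg,
      p.laplaceArg_eq_natCast_mul, max_eq_left harg.le]
  · refine fun n _ => Integrable.const_mul ?_ _
    exact Integrable.of_mem_Icc 0 1 (Measurable.aemeasurable (by fun_prop))
      (ae_of_all _ fun ω => toReal_expNeg_mem_Icc _)

lemma coverBound_nonneg [IsProbabilityMeasure P] (net : Network p P) (j : LinkType) {r : ℝ}
    (hr : 0 < r) : 0 ≤ p.coverBound j r := by
  rw [net.coverBound_eq_integral 0 0 j hr]
  exact integral_nonneg fun _ => (gammaTailBound_mem_Icc _ _).1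

lemma ofReal_coverBound [IsProbabilityMeasure P] (i : ℕ) (x : Plane) (j : LinkType) {r : ℝ}
    (hr : 0 < r) :
    ENNReal.ofReal (p.coverBound j r)
      = ∫⁻ ω, ENNReal.ofReal (gammaTailBound (p.N j) (ENNReal.ofReal (p.laplaceArg j 1 r)
        * p.totalPower x (fun k => net.eve k ω) (net.eveMarks i ω))) ∂P := by
  have hpower := net.measurable_totalPower_eve i x
  rw [net.coverBound_eq_integral i x j hr, ofReal_integral_eq_lintegral_ofReal
    (Integrable.of_mem_Icc 0 1 (Measurable.aemeasurable (by fun_prop))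
      (ae_of_all _ fun ω => gammaTailBound_mem_Icc _ _))
    (ae_of_all _ fun ω => (gammaTailBound_mem_Icc _ _).1)]

lemma measure_connected_le [IsProbabilityMeasure P] (i : ℕ) {x : Plane} (hx : 0 < ‖x‖)
    (j : LinkType) :
    P {ω | 1 ≤ ENNReal.ofReal (p.Ms * p.pathLoss j ‖x‖ * net.mark (.userFade j i) ω)
        / p.totalPower x (fun k => net.eve k ω) (net.eveMarks i ω)}
      ≤ ENNReal.ofReal (p.coverBound j ‖x‖) := by
  have hc : 0 < p.Ms * p.pathLoss j ‖x‖ :=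
    mul_pos p.Ms_pos (mul_pos (p.K_pos j) (Real.rpow_pos_of_pos hx _))
  have hpower := net.measurable_totalPower_eve i x
  have hindep : IndepFun (fun ω => p.totalPower x (fun k => net.eve k ω) (net.eveMarks i ω))
      (net.mark (.userFade j i)) P :=
    (net.indepFun_eve_userFades i).comp
      (φ := fun q : (ℕ → Plane) × (ℕ → LinkMark → ℝ) => p.totalPower x q.1 q.2)
      (ψ := fun y : LinkType → ℝ => y j)
      (p.measurable_totalPower.comp (f := fun q : (ℕ → Plane) × (ℕ → LinkMark → ℝ) =>
        (x, q.1, q.2)) (by fun_prop)) (measurable_pi_apply j)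
  have hset : MeasurableSet {q : ℝ≥0∞ × ℝ |
      1 ≤ ENNReal.ofReal (p.Ms * p.pathLoss j ‖x‖ * q.2) / q.1} :=
    measurableSet_le measurable_const (by fun_prop)
  refine (measure_prodMk_mem_of_indepFun hindep hpower (net.mark_measurable _) hset).trans_le ?_
  rw [net.ofReal_coverBound i x j hx, p.laplaceArg_one_eq j hx.le]
  refine lintegral_mono fun ω => ?_
  refine le_trans (le_of_eq ?_) (gammaMeasure_one_le_div_le (p.N_pos j) hc _)
  have hlaw : gammaMeasure (p.N j) 1 = P.map (net.mark (.userFade j i)) :=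
    (net.mark_law (.userFade j i)).map_eq.symm
  rw [hlaw, Measure.map_apply (net.mark_measurable _)
    (measurableSet_le measurable_const (by fun_prop))]
  rfl

end Network

namespace Params

variable (p : Params)

/-- The configurations for which the base station at `q.1.1`, with blockage mark `q.1.2`, is
received at least as well by the user as by the eavesdroppers. -/
def connectedSet : Set ((Plane × ℝ) × LinkConfig) :=
  {q | 1 ≤ ENNReal.ofReal (p.Ms * p.markedLoss q.1.1 q.1.2 * q.2.1 (p.linkType ‖q.1.1‖ q.1.2))
    / p.totalPower q.1.1 q.2.2.1 q.2.2.2}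

lemma measurableSet_connectedSet : MeasurableSet p.connectedSet := by
  have hloss : Measurable fun q : (Plane × ℝ) × LinkConfig => p.markedLoss q.1.1 q.1.2 :=
    p.measurable_markedLoss.comp measurable_fst
  have hfade : Measurable fun q : (Plane × ℝ) × LinkConfig =>
      q.2.1 (p.linkType ‖q.1.1‖ q.1.2) :=
    measurable_linkType_select (f := fun j (q : (Plane × ℝ) × LinkConfig) => q.2.1 j)
      (measurable_fst p.measurableSet_linkType_norm) (by fun_prop)
  exact measurableSet_le measurable_const
    (((hloss.const_mul _).mul hfade).ennreal_ofReal.div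
      p.measurable_totalPower_linkConfig)

end Params

namespace Network

variable {p : Params} {Ω : Type*} [MeasurableSpace Ω] {P : Measure Ω} (net : Network p P)

/-- The event that the user is securely connected, whose probability is `τ_c`. -/
def connected : Set Ω :=
  {ω | 1 ≤ ENNReal.ofReal (p.Ms * net.userLoss (net.serving ω) ω
    * net.userFading (net.serving ω) ω) / net.powerE ω}

lemma measurableSet_connected : MeasurableSet net.connected :=
  net.measurable_servingSite_linkConfig p.measurableSet_connectedSet

lemma measure_connected_le_lintegral [IsProbabilityMeasure P] :
    P net.connected ≤ ∫⁻ ω, ENNReal.ofReal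
      (p.coverBound (net.userLink (net.serving ω) ω) ‖net.bs (net.serving ω) ω‖) ∂P := by
  rw [← lintegral_indicator_one net.measurableSet_connected]
  refine (net.lintegral_serving
    (measurable_one.indicator p.measurableSet_connectedSet)).trans_le (lintegral_mono_ae ?_)
  filter_upwards [net.ae_serving] with ω hω
  refine le_trans ?_ (net.measure_connected_le (net.serving ω) hω.1
    (net.userLink (net.serving ω) ω))
  exact lintegral_indicator_one_le
    {ω' | (net.servingSite ω, net.linkConfig (net.serving ω) ω') ∈ p.connectedSet}

lemma setLIntegral_served_coverBound [IsProbabilityMeasure P] (j : LinkType) :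
    ∫⁻ ω in net.served j, ENNReal.ofReal (p.coverBound j (net.nearest j ω).toReal) ∂P
      = ENNReal.ofReal
        (p.assoc j * ∫ r in Set.Ioi (0 : ℝ), p.distPdf j r * p.coverBound j r) := by
  have hdensity : p.assoc j * ∫ r in Set.Ioi (0 : ℝ), p.distPdf j r * p.coverBound j r
      = ∫ r in Set.Ioi (0 : ℝ), p.servedDensity j r * p.coverBound j r := by
    rw [← integral_const_mul]
    refine integral_congr_ae ?_
    filter_upwards [net.ae_assoc_mul_distPdf j] with r hr
    rw [← hr, mul_assoc]
  rw [net.lintegral_served j (p.measurable_coverBound j).ennreal_ofReal, hdensity,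
    ofReal_integral_eq_lintegral_ofReal
      (p.integrableOn_mul_coverBound (net.integrableOn_servedDensity j) j)]
  · refine setLIntegral_congr_fun measurableSet_Ioi fun r hr => ?_
    exact (ENNReal.ofReal_mul (p.servedDensity_nonneg j (le_of_lt hr))).symm
  · filter_upwards [ae_restrict_mem measurableSet_Ioi] with r hr
    exact mul_nonneg (p.servedDensity_nonneg j (le_of_lt hr)) (net.coverBound_nonneg j hr)

lemma measure_connected_le_sum [IsProbabilityMeasure P] :
    P net.connected ≤ ∑ j, ENNReal.ofReal
      (p.assoc j * ∫ r in Set.Ioi (0 : ℝ), p.distPdf j r * p.coverBound j r) := by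
  have hbound (j : LinkType) : Measurable fun ω =>
      ENNReal.ofReal (p.coverBound j (net.nearest j ω).toReal) :=
    (p.measurable_coverBound j).ennreal_ofReal.comp (net.measurable_nearest j).ennreal_toReal
  calc P net.connected
      ≤ ∫⁻ ω, ∑ j, (net.served j).indicator
          (fun ω => ENNReal.ofReal (p.coverBound j (net.nearest j ω).toReal)) ω ∂P := by
        refine net.measure_connected_le_lintegral.trans (lintegral_mono_ae ?_)
        filter_upwards [net.ae_serving] with ω ⟨_, hnearest, hserved⟩
        refine le_trans (le_of_eq ?_) (Finset.single_le_sum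
          (f := fun j => (net.served j).indicator
            (fun ω => ENNReal.ofReal (p.coverBound j (net.nearest j ω).toReal)) ω)
          (fun _ _ => zero_le) (Finset.mem_univ (net.userLink (net.serving ω) ω)))
        rw [Set.indicator_of_mem hserved, hnearest, toReal_enorm]
    _ = ∑ j, ∫⁻ ω in net.served j,
          ENNReal.ofReal (p.coverBound j (net.nearest j ω).toReal) ∂P := by
        rw [lintegral_finsetSum _ fun j _ => (hbound j).indicator (net.measurableSet_served j)]
        exact Finset.sum_congr rfl fun j _ => lintegral_indicator (net.measurableSet_served j) _
    _ = ∑ j, ENNReal.ofReal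
          (p.assoc j * ∫ r in Set.Ioi (0 : ℝ), p.distPdf j r * p.coverBound j r) :=
        Finset.sum_congr rfl fun j _ => net.setLIntegral_served_coverBound j

lemma integral_distPdf_mul_coverBound_nonneg [IsProbabilityMeasure P] (net : Network p P)
    (j : LinkType) : 0 ≤ ∫ r in Set.Ioi (0 : ℝ), p.distPdf j r * p.coverBound j r := by
  refine integral_nonneg_of_ae ?_
  filter_upwards [p.ae_distPdf_eq j, ae_restrict_mem measurableSet_Ioi] with r hdistPdf hr
  rw [Pi.zero_apply, hdistPdf]
  exact mul_nonneg (div_nonneg (p.servedDensity_nonneg j (le_of_lt hr)) (net.assoc_nonneg j))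
    (net.coverBound_nonneg j hr)

lemma tauC_le [IsProbabilityMeasure P] : net.tauC ≤ ∑ j, p.assoc j
    * ∫ r in Set.Ioi (0 : ℝ), p.distPdf j r * p.coverBound j r := by
  have hnonneg : ∀ j ∈ Finset.univ, 0 ≤ p.assoc j
      * ∫ r in Set.Ioi (0 : ℝ), p.distPdf j r * p.coverBound j r := fun j _ =>
    mul_nonneg (net.assoc_nonneg j) (net.integral_distPdf_mul_coverBound_nonneg j)
  refine ENNReal.toReal_le_of_le_ofReal (Finset.sum_nonneg hnonneg) ?_
  rw [ENNReal.ofReal_sum_of_nonneg hnonneg]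
  exact net.measure_connected_le_sum

end Network

end MmWave

end

theorem theorem4 (p : MmWave.Params) {Ω : Type*} [MeasurableSpace Ω] (P : Measure Ω)
    [IsProbabilityMeasure P] (net : MmWave.Network p P) :
    (∀ᵐ ω ∂P, net.powerE ω ≠ ∞) ∧
    (∀ s : ℝ, 0 < s → ∫ ω, Real.exp (-s * (net.powerE ω).toReal) ∂P = p.laplaceIE s) ∧
    (∀ j : MmWave.LinkType, ∀ n ∈ Finset.Icc 1 (p.N j),
      IntegrableOn (fun r : ℝ => p.distPdf j r
        * p.laplaceIE (p.a j * n * r ^ p.α j / (p.Ms * p.K j))) (Set.Ioi 0)) ∧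
    net.tauC ≤ ∑ j : MmWave.LinkType, p.assoc j * ∑ n ∈ Finset.Icc 1 (p.N j),
      ((p.N j).choose n : ℝ) * (-1) ^ (n + 1) *
        ∫ r in Set.Ioi (0 : ℝ), p.distPdf j r
          * p.laplaceIE (p.a j * n * r ^ p.α j / (p.Ms * p.K j)) ∧
    net.tauC ≤ ∑ j : MmWave.LinkType, ∑ n ∈ Finset.Icc 1 (p.N j),
      ((p.N j).choose n : ℝ) * (-1) ^ (n + 1) *
        ∫ r in Set.Ioi (0 : ℝ), p.distPdf j r
          * p.laplaceIE (p.a j * n * r ^ p.α j / (p.Ms * p.K j)) := by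
  have hsum := fun j => p.integral_mul_coverBound (net.integrableOn_distPdf j) j
  refine ⟨net.ae_powerE_ne_top, fun s hs => net.integral_exp_powerE hs,
    fun j n _ => p.integrableOn_mul_laplaceIE (net.integrableOn_distPdf j) j n, ?_, ?_⟩
  · refine net.tauC_le.trans (le_of_eq (Finset.sum_congr rfl fun j _ => ?_))
    rw [hsum j]
    rfl
  · refine net.tauC_le.trans (Finset.sum_le_sum fun j _ => ?_)
    refine (mul_le_of_le_one_left (net.integral_distPdf_mul_coverBound_nonneg j)
      (net.assoc_le_one j)).trans (le_of_eq ?_)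
    rw [hsum j]
    rfl
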